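/- Let $d\in\mathbb{N}$, $t_0<t$, $\Delta t:=t-t_0$, and let $H:[t_0,t]\to\mathbb{C}^{d\times d}$ be a $C^\infty$ function with Hermitian values (one-sided derivatives at the end points); $\|\cdot\|$ is the spectral norm. Let $U(t,t_0)$ be the time evolution operator generated by $H$, that is, the value at $\tau=t$ of the unique solution of $i\,\partial_\tau U(\tau,t_0)=H(\tau)U(\tau,t_0)$, $U(t_0,t_0)=\mathbb{1}$ on $[t_0,t]$. Let $\Lambda:[t_0,t]\to\mathbb{R}$ be a continuous function with $$\Lambda(\tau)\ \ge\ \|H^{(j)}(\tau)\|^{1/(j+1)}\qquad\text{for all }\tau\in[t_0,t]\text{ and all integers } j\ge 0 .$$ Assume that $\Lambda$ is differentiable on $[t_0,t]$ and that $K\ge 0$ is a constant with $|\dot\Lambda(\tau)|\le K\Lambda(\tau)^2$ for all $\tau\in[t_0,t]$. Let $M\ge 1$, and let $k_1,\dots,k_M$ be positive integers and $a\in\mathbb{R}^M$ with $$\sum_{j=1}^M a_j=1,\qquad \sum_{j=1}^M a_j k_j^{-2m}=0\quad(1\le m\le M-1),\qquad \|a\|_1:=\sum_{j=1}^M|a_j|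 .$$ With the midpoint formula $U_2(t'',t'):=\exp\!\big(-iH(\tfrac{t'+t''}{2})(t''-t')\big)$, define the multiproduct formula $$U_{\vec k}(t'',t'):=\sum_{j=1}^M a_j\prod_{q=1}^{k_j}U_2\!\Big(t'+\tfrac{q}{k_j}(t''-t'),\ t'+\tfrac{q-1}{k_j}(t''-t')\Big).$$ All products are time-ordered, with later factors on the left. Let $\bar\Lambda:=\frac1{\Delta t}\int_{t_0}^t\Lambda(\tau)\,d\tau$. Then for every $\epsilon>0$ there are an integer $r$ and a mesh $t_0<t_1<\dots<t_r=t$ such that $$\Big\|U(t,t_0)-\prod_{i=1}^r U_{\vec k}(t_i,t_{i-1})\Big\|\le\epsilon$$ and $$r\ \le\ \max\left\{1,\ \Big(41\big(1+\tfrac32K\big)\bar\Lambda\,\Delta t\Big)^{1+\frac1{2M}}\Big(\frac{0.32\,\|a\|_1}{\epsilon}\Big)^{\frac1{2M}}\right\}.$$ Moreover, $\bar\Lambda\,\Delta t$ equals the $L^1$ norm $\int_{t_0}^t|\Lambda(\tau)|\,d\tau$ of $\Lambda$, so that the bound is expressed through $\|\Lambda\|_1$. -/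

import Mathlib

open Set MeasureTheory
open scoped Matrix.Norms.L2Operator ContDiff

noncomputable section

/-! Square complex matrices carry the spectral norm (the operator norm induced by the
Euclidean norm), through the scoped instances of `Matrix.Norms.L2Operator`. -/

/-- A `d × d` complex matrix. -/
abbrev CMat (d : ℕ) : Type := Matrix (Fin d) (Fin d) ℂ

/-- `V` solves the initial value problem `i V'(τ) = H(τ) V(τ)`, `V(t₀) = 1` on `[t₀, t]`
(the derivative is one-sided at the end points). -/
def IsPropagator {d : ℕ} (H : ℝ → CMat d) (t₀ t : ℝ) (V : ℝ → CMat d) : Prop :=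
  V t₀ = 1 ∧
    ∀ τ ∈ Icc t₀ t, HasDerivWithinAt V ((-Complex.I) • (H τ * V τ)) (Icc t₀ t) τ

/-- The time evolution operator `U(t, t₀)` generated by `H`: the value at `t` of the solution
of the initial value problem on `[t₀, t]`. For `H` continuous on `[t₀, t]` the solution exists
and is unique: see `exists_isPropagator` and `IsPropagator.eq_propagator`. -/
def propagator {d : ℕ} (H : ℝ → CMat d) (t₀ t : ℝ) : CMat d :=
  Classical.epsilon (IsPropagator H t₀ t) t

/-- The terms of the time-ordered (Dyson) series of `X' = A X`, `X(t₀) = 1`. -/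
def dysonTerm {E : Type*} [NormedRing E] [NormedAlgebra ℝ E]
    (A : ℝ → E) (t₀ : ℝ) : ℕ → ℝ → E
  | 0, _ => 1
  | n + 1, τ => ∫ s in t₀..τ, A s * dysonTerm A t₀ n s

theorem continuous_dysonTerm {E : Type*} [NormedRing E] [NormedAlgebra ℝ E] [CompleteSpace E]
    {A : ℝ → E} (hA : Continuous A) (t₀ : ℝ) (n : ℕ) : Continuous (dysonTerm A t₀ n) := by
  induction n with
  | zero => exact continuous_const
  | succ n ih =>
    exact intervalIntegral.continuous_primitive
      (fun a b => (hA.mul ih).intervalIntegrable a b) t₀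

theorem hasDerivAt_dysonTerm_succ {E : Type*} [NormedRing E] [NormedAlgebra ℝ E]
    [CompleteSpace E] {A : ℝ → E} (hA : Continuous A) (t₀ : ℝ) (n : ℕ) (τ : ℝ) :
    HasDerivAt (dysonTerm A t₀ (n + 1)) (A τ * dysonTerm A t₀ n τ) τ :=
  (hA.mul (continuous_dysonTerm hA t₀ n)).integral_hasStrictDerivAt t₀ τ |>.hasDerivAt

theorem norm_dysonTerm_le {E : Type*} [NormedRing E] [NormedAlgebra ℝ E] [CompleteSpace E]
    {A : ℝ → E} (hA : Continuous A) {C : ℝ} (hC : ∀ s, ‖A s‖ ≤ C) (t₀ : ℝ) (n : ℕ) (τ : ℝ) :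
    ‖dysonTerm A t₀ n τ‖ ≤ ‖(1 : E)‖ * ((C * |τ - t₀|) ^ n / n.factorial) := by
  have hC0 : 0 ≤ C := (norm_nonneg _).trans (hC 0)
  induction n generalizing τ with
  | zero => simp [dysonTerm]
  | succ n ih =>
    have hpt : ∀ s, ‖A s * dysonTerm A t₀ n s‖ ≤
        ‖(1 : E)‖ * C ^ (n + 1) / n.factorial * |s - t₀| ^ n := by
      intro s
      calc ‖A s * dysonTerm A t₀ n s‖ ≤ ‖A s‖ * ‖dysonTerm A t₀ n s‖ := norm_mul_le _ _
        _ ≤ C * (‖(1 : E)‖ * ((C * |s - t₀|) ^ n / n.factorial)) :=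
            mul_le_mul (hC s) (ih s) (norm_nonneg _) hC0
        _ = _ := by rw [mul_pow]; ring
    have hval : ‖(1 : E)‖ * ((C * |τ - t₀|) ^ (n + 1) / (n + 1).factorial) =
        ‖(1 : E)‖ * C ^ (n + 1) / n.factorial * (|τ - t₀| ^ (n + 1) / (n + 1)) := by
      rw [Nat.factorial_succ, mul_pow]
      have : (n.factorial : ℝ) ≠ 0 := by positivity
      push_cast
      field_simp
    rw [hval]
    change ‖∫ s in t₀..τ, A s * dysonTerm A t₀ n s‖ ≤ _
    rcases le_total t₀ τ with h | h
    · refine (intervalIntegral.norm_integral_le_of_norm_le (μ := volume) h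
        (g := fun s => ‖(1 : E)‖ * C ^ (n + 1) / n.factorial * (s - t₀) ^ n)
        (Filter.Eventually.of_forall fun s hs => ?_)
        (Continuous.intervalIntegrable (by fun_prop) _ _)).trans (le_of_eq ?_)
      · have := hpt s
        rwa [abs_of_pos (sub_pos.2 hs.1)] at this
      · rw [intervalIntegral.integral_const_mul, abs_of_nonneg (sub_nonneg.2 h),
          intervalIntegral.integral_comp_sub_right (fun x => x ^ n) t₀, integral_pow]
        simp
    · rw [intervalIntegral.integral_symm, norm_neg]
      refine (intervalIntegral.norm_integral_le_of_norm_le (μ := volume) h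
        (g := fun s => ‖(1 : E)‖ * C ^ (n + 1) / n.factorial * (t₀ - s) ^ n)
        (Filter.Eventually.of_forall fun s hs => ?_)
        (Continuous.intervalIntegrable (by fun_prop) _ _)).trans (le_of_eq ?_)
      · have := hpt s
        rwa [abs_of_nonpos (sub_nonpos.2 hs.2), neg_sub] at this
      · rw [intervalIntegral.integral_const_mul, abs_of_nonpos (sub_nonpos.2 h),
          intervalIntegral.integral_comp_sub_left (fun x => x ^ n) t₀, integral_pow]
        simp

/-- The Schrödinger initial value problem with continuous `H` has a solution. -/
theorem exists_isPropagator {d : ℕ} {H : ℝ → CMat d} {t₀ t : ℝ} (h : t₀ ≤ t)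
    (hH : ContinuousOn H (Icc t₀ t)) : ∃ V, IsPropagator H t₀ t V := by
  have : CompleteSpace (CMat d) := FiniteDimensional.complete ℂ _
  set A : ℝ → CMat d := fun s => (-Complex.I) • IccExtend h ((Icc t₀ t).domRestrict H) s with hAdef
  have hAc : Continuous A :=
    ((continuousOn_iff_continuous_domRestrict.1 hH).Icc_extend' (h := h)).const_smul (-Complex.I)
  have hAeq : ∀ τ ∈ Icc t₀ t, A τ = (-Complex.I) • H τ := fun τ hτ => by
    simp only [hAdef]; rw [IccExtend_of_mem h _ hτ]; rfl
  obtain ⟨C, hC⟩ : ∃ C, ∀ s, ‖A s‖ ≤ C := by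
    obtain ⟨C, hC⟩ := isCompact_Icc.exists_bound_of_continuousOn hH
    refine ⟨C, fun s => ?_⟩
    simp only [hAdef, norm_smul, norm_neg, Complex.norm_I, one_mul]
    exact hC _ (projIcc t₀ t h s).2
  have hC0 : 0 ≤ C := (norm_nonneg _).trans (hC 0)
  have hsum0 : ∀ τ, Summable fun n => dysonTerm A t₀ n τ := fun τ =>
    Summable.of_norm_bounded
      ((Real.summable_pow_div_factorial (C * |τ - t₀|)).mul_left ‖(1 : CMat d)‖)
      (fun n => norm_dysonTerm_le hAc hC t₀ n τ)
  have hderiv : ∀ τ, HasDerivAt (fun s => ∑' n, dysonTerm A t₀ n s)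
      (A τ * ∑' n, dysonTerm A t₀ n τ) τ := by
    intro τ
    set R : ℝ := |τ - t₀| + 1 with hR
    have hb : ∀ n y, y ∈ Metric.ball t₀ R →
        ‖A y * dysonTerm A t₀ n y‖ ≤ C * (‖(1 : CMat d)‖ * ((C * R) ^ n / n.factorial)) := by
      intro n y hy
      have hy' : |y - t₀| ≤ R := by
        have := Metric.mem_ball.1 hy
        rw [Real.dist_eq] at this
        exact this.le
      refine (norm_mul_le _ _).trans (mul_le_mul (hC y)
        ((norm_dysonTerm_le hAc hC t₀ n y).trans ?_) (norm_nonneg _) hC0)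
      gcongr
    have hτ : τ ∈ Metric.ball t₀ R := by
      rw [Metric.mem_ball, Real.dist_eq]; linarith
    have key := hasDerivAt_tsum_of_isPreconnected
      (g := fun n => dysonTerm A t₀ (n + 1)) (g' := fun n s => A s * dysonTerm A t₀ n s)
      (((Real.summable_pow_div_factorial (C * R)).mul_left ‖(1 : CMat d)‖).mul_left C)
      Metric.isOpen_ball (convex_ball t₀ R).isPreconnected
      (fun n y _ => hasDerivAt_dysonTerm_succ hAc t₀ n y) hb hτ
      ((summable_nat_add_iff 1).2 (hsum0 τ)) hτ
    have hsplit : (fun s => ∑' n, dysonTerm A t₀ n s) =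
        fun s => 1 + ∑' n, dysonTerm A t₀ (n + 1) s := by
      funext s
      rw [(hsum0 s).tsum_eq_zero_add]; rfl
    rw [hsplit]
    rw [(hsum0 τ).tsum_mul_left] at key
    exact key.const_add 1
  refine ⟨fun s => ∑' n, dysonTerm A t₀ n s, ?_, fun τ hτ => ?_⟩
  · change ∑' n, dysonTerm A t₀ n t₀ = 1
    rw [(hsum0 t₀).tsum_eq_zero_add]
    simp [dysonTerm]
  · have := (hderiv τ).hasDerivWithinAt (s := Icc t₀ t)
    rwa [hAeq τ hτ, smul_mul_assoc] at this

/-- Every solution of the initial value problem takes at `t` the value `propagator H t₀ t`. -/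
theorem IsPropagator.eq_propagator {d : ℕ} {H : ℝ → CMat d} {t₀ t : ℝ} (h : t₀ ≤ t)
    (hH : ContinuousOn H (Icc t₀ t)) {V : ℝ → CMat d} (hV : IsPropagator H t₀ t V) :
    V t = propagator H t₀ t := by
  have hW : IsPropagator H t₀ t (Classical.epsilon (IsPropagator H t₀ t)) :=
    Classical.epsilon_spec (exists_isPropagator h hH)
  obtain ⟨C, hC⟩ := isCompact_Icc.exists_bound_of_continuousOn hH
  have hder : ∀ {X : ℝ → CMat d}, IsPropagator H t₀ t X → ∀ τ ∈ Ico t₀ t,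
      HasDerivWithinAt X ((-Complex.I) • (H τ * X τ)) (Ici τ) τ := by
    intro X hX τ hτ
    have h1 := (hX.2 τ (Ico_subset_Icc_self hτ)).mono (Icc_subset_Icc_left hτ.1)
    exact h1.mono_of_mem_nhdsWithin (Icc_mem_nhdsGE hτ.2)
  refine ODE_solution_unique_of_mem_Icc_right
    (v := fun τ X => (-Complex.I) • (H τ * X)) (s := fun _ => univ) (K := C.toNNReal)
    (fun τ hτ => ?_) (fun τ hτ => (hV.2 τ hτ).continuousWithinAt) (hder hV)
    (fun _ _ => mem_univ _) (fun τ hτ => (hW.2 τ hτ).continuousWithinAt) (hder hW)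
    (fun _ _ => mem_univ _) (hV.1.trans hW.1.symm) (right_mem_Icc.2 h)
  refine LipschitzOnWith.of_dist_le_mul fun X _ Y _ => ?_
  rw [dist_eq_norm, dist_eq_norm, ← smul_sub, ← mul_sub, norm_smul, norm_neg, Complex.norm_I,
    one_mul]
  refine (norm_mul_le _ _).trans (mul_le_mul_of_nonneg_right ?_ (norm_nonneg _))
  exact (hC τ (Ico_subset_Icc_self hτ)).trans (Real.le_coe_toNNReal C)

/-- `Λ` is a `Λ`-bound for `H` on `[t₀, t]`: a continuous function that dominates
`‖H^{(j)}(τ)‖^{1/(j+1)}` for every order `j ≥ 0` and every `τ ∈ [t₀, t]`. -/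
def IsLambdaBound {d : ℕ} (H : ℝ → CMat d) (Λ : ℝ → ℝ) (t₀ t : ℝ) : Prop :=
  ContinuousOn Λ (Icc t₀ t) ∧
    ∀ τ ∈ Icc t₀ t, ∀ j : ℕ,
      ‖iteratedDerivWithin j H (Icc t₀ t) τ‖ ^ (1 / ((j : ℝ) + 1)) ≤ Λ τ

/-- The time average of `f` over `[t₀, t]`. -/
def timeAverage (f : ℝ → ℝ) (t₀ t : ℝ) : ℝ := 1 / (t - t₀) * ∫ τ in t₀..t, f τ

/-- The time-ordered product `F (n - 1) * ⋯ * F 1 * F 0` (later factors on the left). -/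
def timeOrderedProd {d n : ℕ} (F : Fin n → CMat d) : CMat d :=
  (List.ofFn F).reverse.prod

/-- The midpoint formula `U₂(t, s) = exp(-i H(s + (t - s)/2) (t - s))`. -/
def midpointFormula {d : ℕ} (H : ℝ → CMat d) (t s : ℝ) : CMat d :=
  NormedSpace.exp ((-Complex.I * ((t - s : ℝ) : ℂ)) • H (s + (t - s) / 2))

/-- `U₂^{(k)}(t, s)`: the time-ordered product of `k` midpoint formulas on the uniform
subdivision of `[s, t]` into `k` pieces. -/
def midpointPower {d : ℕ} (H : ℝ → CMat d) (k : ℕ) (t s : ℝ) : CMat d :=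
  timeOrderedProd fun q : Fin k =>
    midpointFormula H (s + (t - s) * ((q : ℝ) + 1) / k) (s + (t - s) * (q : ℝ) / k)

/-- The time-dependent multiproduct formula
`U_k(t, s) = ∑ j, a j • U₂^{(k j)}(t, s)` with base formula the midpoint formula. -/
def multiproductFormula {d M : ℕ} (H : ℝ → CMat d) (a : Fin M → ℝ) (k : Fin M → ℕ)
    (t s : ℝ) : CMat d :=
  ∑ j, (a j : ℂ) • midpointPower H (k j) t s

/-- `(a, k)` are coefficients of a multiproduct formula of order `2 M`: the `k j` are positive
integers and `∑ j, a j / (k j)^(2 m)` is `1` for `m = 0` and `0` for `1 ≤ m ≤ M - 1`. -/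
def IsMultiproductCoeff {M : ℕ} (a : Fin M → ℝ) (k : Fin M → ℕ) : Prop :=
  (∀ j, 0 < k j) ∧
    ∀ m : Fin M, ∑ j, a j / (k j : ℝ) ^ (2 * (m : ℕ)) = if (m : ℕ) = 0 then 1 else 0

/-- The `ℓ¹` norm of a vector. -/
def l1Norm {M : ℕ} (a : Fin M → ℝ) : ℝ := ∑ j, |a j|

end

/-!
Rescale time on a step starting at `s` by `l = Λ s`. The generator becomes a power series whose
coefficients are bounded by `1 / j!`, so the exact solution and the `k`-fold product of midpoint
exponentials are convergent power series in the step size. The order-`n` coefficient of the `k`-fold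
product is, up to the factor `k⁻ⁿ`, a polynomial in `k` of degree at most `n` (an iterated central
antidifference), and time-reversal symmetry gives it the parity of `n`. Hence it is a polynomial in
`k⁻²`, whose constant term is the coefficient of the exact solution, and the conditions on `(a, k)`
cancel all error coefficients of order at most `2 M`. The remaining ones are bounded geometrically
by a multiple of `‖a‖₁`, and also independently of `a`; the second bound matters only when the
tolerance is large.

Since `|Λ'| ≤ K Λ²`, the function `Λ exp (K ∫ Λ)` is nondecreasing, so on a mesh with equal
integrals of `Λ` every rescaled step size `Λ (t_{i-1}) (t_i - t_{i-1})` is at most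
`(1 + 3 K / 2) ∫ Λ / r`. The exact propagators are unitary, so local errors `δ` accumulate to at
most `(1 + δ) ^ r - 1`.
-/

noncomputable section

section PowerSeriesNorm

open Finset PowerSeries

variable {E : Type*} [NormedRing E]

/-- The weighted `ℓ¹` norm `∑ ‖coeff i P‖ h ^ i` of a power series is at most `C`. Bounding the
partial sums states convergence and the estimate at once. -/
def WeightedNormLE (P : E⟦X⟧) (h C : ℝ) : Prop :=
  ∀ n, ∑ i ∈ range n, ‖coeff i P‖ * h ^ i ≤ C

namespace WeightedNormLE

variable {P Q : E⟦X⟧} {h C D : ℝ}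

theorem nonneg (hP : WeightedNormLE P h C) : 0 ≤ C := by
  simpa using hP 0

theorem mono (hP : WeightedNormLE P h C) (hCD : C ≤ D) : WeightedNormLE P h D :=
  fun n => (hP n).trans hCD

theorem norm_coeff_mul_pow_le (hP : WeightedNormLE P h C) (hh : 0 ≤ h) (n : ℕ) :
    ‖coeff n P‖ * h ^ n ≤ C :=
  (single_le_sum (f := fun i => ‖coeff i P‖ * h ^ i) (fun i _ => by positivity)
    (self_mem_range_succ n)).trans (hP (n + 1))

theorem summable_norm_smul [NormedAlgebra ℝ E] (hP : WeightedNormLE P h C) (hh : 0 ≤ h) :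
    Summable fun n => ‖h ^ n • coeff n P‖ :=
  (summable_of_sum_range_le (fun n => by positivity) hP).congr fun n => by
    rw [norm_smul, norm_pow, Real.norm_of_nonneg hh, mul_comm]

theorem monomial (hh : 0 ≤ h) (d : ℕ) (c : E) :
    WeightedNormLE (PowerSeries.monomial d c) h (‖c‖ * h ^ d) := by
  intro n
  have hterm : ∀ i, ‖coeff i (PowerSeries.monomial d c)‖ * h ^ i =
      if i = d then ‖c‖ * h ^ d else 0 := by
    intro i
    rw [coeff_monomial]
    split_ifs with hi <;> simp [hi]
  simp only [hterm, sum_ite_eq']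
  split_ifs
  · rfl
  · positivity

theorem const (hh : 0 ≤ h) (c : E) : WeightedNormLE (PowerSeries.C c) h ‖c‖ := by
  simpa only [monomial_zero_eq_C_apply, pow_zero, mul_one] using monomial hh 0 c

theorem one (h1 : ‖(1 : E)‖ ≤ 1) (hh : 0 ≤ h) : WeightedNormLE (1 : E⟦X⟧) h 1 := by
  simpa only [map_one] using (const hh (1 : E)).mono h1

theorem add (hP : WeightedNormLE P h C) (hQ : WeightedNormLE Q h D) (hh : 0 ≤ h) :
    WeightedNormLE (P + Q) h (C + D) := fun n => by
  refine le_trans ?_ (add_le_add (hP n) (hQ n))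
  rw [← sum_add_distrib]
  refine sum_le_sum fun i _ => ?_
  rw [← add_mul, map_add]
  gcongr
  exact norm_add_le _ _

theorem sum {ι : Type*} {s : Finset ι} {P : ι → E⟦X⟧} {C : ι → ℝ} (hh : 0 ≤ h)
    (hP : ∀ i ∈ s, WeightedNormLE (P i) h (C i)) :
    WeightedNormLE (∑ i ∈ s, P i) h (∑ i ∈ s, C i) := by
  classical
  induction s using Finset.induction_on with
  | empty => exact fun n => by simp
  | insert a s ha ih =>
    rw [sum_insert ha, sum_insert ha]
    exact (hP a (mem_insert_self _ _)).add (ih fun i hi => hP i (mem_insert_of_mem hi)) hh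

theorem mul (hP : WeightedNormLE P h C) (hQ : WeightedNormLE Q h D) (hh : 0 ≤ h) :
    WeightedNormLE (P * Q) h (C * D) := by
  intro n
  have hcoeff : ∀ l, ‖coeff l (P * Q)‖ * h ^ l ≤ ∑ i ∈ range (l + 1),
      (‖coeff i P‖ * h ^ i) * (‖coeff (l - i) Q‖ * h ^ (l - i)) := by
    intro l
    rw [coeff_mul, Nat.sum_antidiagonal_eq_sum_range_succ_mk]
    refine (mul_le_mul_of_nonneg_right (norm_sum_le _ _) (by positivity)).trans ?_
    rw [sum_mul]
    refine sum_le_sum fun i hi => ?_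
    rw [mul_mul_mul_comm, ← pow_add, Nat.add_sub_cancel' (mem_range_succ_iff.1 hi)]
    gcongr
    exact norm_mul_le _ _
  calc ∑ l ∈ range n, ‖coeff l (P * Q)‖ * h ^ l
      ≤ ∑ l ∈ range n, ∑ i ∈ range (l + 1),
          (‖coeff i P‖ * h ^ i) * (‖coeff (l - i) Q‖ * h ^ (l - i)) :=
        sum_le_sum fun l _ => hcoeff l
    _ = ∑ i ∈ range n, ∑ j ∈ range (n - i),
          (‖coeff i P‖ * h ^ i) * (‖coeff j Q‖ * h ^ j) :=
        sum_range_diag_flip n fun i j => (‖coeff i P‖ * h ^ i) * (‖coeff j Q‖ * h ^ j)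
    _ ≤ ∑ i ∈ range n, (‖coeff i P‖ * h ^ i) * D := by
        refine sum_le_sum fun i _ => ?_
        rw [← mul_sum]
        exact mul_le_mul_of_nonneg_left (hQ _) (by positivity)
    _ ≤ C * D := by
        rw [← sum_mul]
        exact mul_le_mul_of_nonneg_right (hP n) hQ.nonneg

theorem pow (hP : WeightedNormLE P h C) (h1 : ‖(1 : E)‖ ≤ 1) (hh : 0 ≤ h) (p : ℕ) :
    WeightedNormLE (P ^ p) h (C ^ p) := by
  induction p with
  | zero => simpa using one h1 hh
  | succ p ih => rw [pow_succ, pow_succ]; exact ih.mul hP hh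

theorem exp (hC : 0 ≤ C) : WeightedNormLE (PowerSeries.exp ℝ) C (Real.exp C) := by
  intro n
  refine le_trans (le_of_eq ?_) (Real.sum_le_exp_of_nonneg hC n)
  refine sum_congr rfl fun i _ => ?_
  simp [coeff_exp, div_eq_inv_mul]

theorem exp_sub_one (hC : 0 ≤ C) :
    WeightedNormLE (PowerSeries.exp ℝ - 1) C (Real.exp C - 1) := by
  rintro (_ | n)
  · simpa using hC
  · have hexp := exp hC (n + 1)
    rw [sum_range_succ'] at hexp ⊢
    simp [coeff_one] at hexp ⊢
    linarith

end WeightedNormLE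

/-- The power series `P` converges to `x` at the real number `h`. -/
def HasValueAt [NormedAlgebra ℝ E] (P : E⟦X⟧) (h : ℝ) (x : E) : Prop :=
  HasSum (fun n => h ^ n • coeff n P) x

namespace HasValueAt

variable [NormedAlgebra ℝ E] {P Q : E⟦X⟧} {h C D : ℝ} {x y : E}

theorem one (h : ℝ) : HasValueAt (1 : E⟦X⟧) h 1 := by
  have hsum := hasSum_single (f := fun n => h ^ n • coeff n (1 : E⟦X⟧)) 0
    (fun n hn => by simp [coeff_one, hn])
  simpa [HasValueAt] using hsum

theorem mul [CompleteSpace E] (hx : HasValueAt P h x) (hy : HasValueAt Q h y) (hh : 0 ≤ h)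
    (hP : WeightedNormLE P h C) (hQ : WeightedNormLE Q h D) : HasValueAt (P * Q) h (x * y) := by
  have hP' := hP.summable_norm_smul hh
  have hQ' := hQ.summable_norm_smul hh
  have hprod := (summable_norm_sum_mul_antidiagonal_of_summable_norm hP' hQ').of_norm.hasSum
  rw [← tsum_mul_tsum_eq_tsum_sum_antidiagonal_of_summable_norm hP' hQ', hx.tsum_eq,
    hy.tsum_eq] at hprod
  refine hprod.congr_fun fun n => ?_
  rw [coeff_mul, smul_sum]
  refine sum_congr rfl fun ij hij => ?_
  rw [smul_mul_smul_comm, ← pow_add, mem_antidiagonal.1 hij]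

theorem pow [CompleteSpace E] (hx : HasValueAt P h x) (h1 : ‖(1 : E)‖ ≤ 1) (hh : 0 ≤ h)
    (hP : WeightedNormLE P h C) (p : ℕ) : HasValueAt (P ^ p) h (x ^ p) := by
  induction p with
  | zero => simpa using one h
  | succ p ih => rw [pow_succ, pow_succ]; exact ih.mul hx hh (hP.pow h1 hh p) hP

end HasValueAt

end PowerSeriesNorm

section SeriesComp

open Finset PowerSeries

theorem coeff_pow_eq_zero_of_lt {R : Type*} [Semiring R] {Z : R⟦X⟧} (hZ : constantCoeff Z = 0)
    {l p : ℕ} (h : l < p) : coeff l (Z ^ p) = 0 :=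
  coeff_of_lt_order _ ((Nat.cast_lt.2 h).trans_le (le_order_pow_of_constantCoeff_eq_zero p hZ))

section Algebra

variable {R E : Type*} [CommRing R] [Ring E] [Algebra R E]

/-- The composition `f(Z) = ∑ fₚ Z ^ p` of a power series `f` with scalar coefficients and a power
series `Z` over a possibly noncommutative algebra. The sums are truncated at `p = l`, which is
legitimate when `Z` has no constant term; Mathlib's `PowerSeries.subst` asks for a commutative
target. -/
def seriesComp (f : R⟦X⟧) (Z : E⟦X⟧) : E⟦X⟧ :=
  PowerSeries.mk fun l => ∑ p ∈ range (l + 1), coeff p f • coeff l (Z ^ p)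

theorem coeff_seriesComp (f : R⟦X⟧) (Z : E⟦X⟧) (l : ℕ) :
    coeff l (seriesComp f Z) = ∑ p ∈ range (l + 1), coeff p f • coeff l (Z ^ p) :=
  coeff_mk _ _

theorem constantCoeff_seriesComp (f : R⟦X⟧) (Z : E⟦X⟧) :
    constantCoeff (seriesComp f Z) = algebraMap R E (constantCoeff f) := by
  rw [← coeff_zero_eq_constantCoeff_apply, coeff_seriesComp]
  simp [Algebra.algebraMap_eq_smul_one]

theorem coeff_seriesComp_eq_coeff_aeval {f : R⟦X⟧} {Z : E⟦X⟧} (hZ : constantCoeff Z = 0) {l : ℕ}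
    {p : Polynomial R} (hp : ∀ i ≤ l, p.coeff i = coeff i f) :
    coeff l (seriesComp f Z) = coeff l (Polynomial.aeval Z p) := by
  have hdeg : p.natDegree < l + 1 + (p.natDegree + 1) := by omega
  rw [coeff_seriesComp, Polynomial.aeval_eq_sum_range' hdeg, map_sum]
  refine (sum_congr rfl fun i hi => ?_).trans
    (sum_subset (range_subset_range.2 (Nat.le_add_right _ _)) fun i _ hi => ?_)
  · rw [coeff_smul, hp i (mem_range_succ_iff.1 hi)]
  · rw [coeff_smul, coeff_pow_eq_zero_of_lt hZ (by simpa using hi), smul_zero]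

theorem seriesComp_mul (f g : R⟦X⟧) {Z : E⟦X⟧} (hZ : constantCoeff Z = 0) :
    seriesComp (f * g) Z = seriesComp f Z * seriesComp g Z := by
  ext l
  have hcoeff : ∀ f : R⟦X⟧, ∀ i ≤ l,
      coeff i (seriesComp f Z) = coeff i (Polynomial.aeval Z (trunc (l + 1) f)) := fun f i hi =>
    coeff_seriesComp_eq_coeff_aeval hZ fun j hj => by
      rw [coeff_trunc, if_pos (by omega)]
  have hprod : ∀ i ≤ l,
      (trunc (l + 1) f * trunc (l + 1) g).coeff i = coeff i (f * g) := fun i hi => by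
    rw [coeff_mul_eq_coeff_trunc_mul_trunc f g (Nat.lt_succ_of_le hi), ← Polynomial.coe_mul,
      Polynomial.coeff_coe]
  rw [coeff_seriesComp_eq_coeff_aeval hZ hprod, map_mul, coeff_mul, coeff_mul]
  refine sum_congr rfl fun ij hij => ?_
  have hij := mem_antidiagonal.1 hij
  rw [hcoeff f _ (by omega), hcoeff g _ (by omega)]

theorem seriesComp_one (Z : E⟦X⟧) : seriesComp (1 : R⟦X⟧) Z = 1 := by
  ext l
  rw [coeff_seriesComp, sum_eq_single 0 (fun p _ hp => by simp [coeff_one, hp]) (by simp)]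
  simp

end Algebra

variable {E : Type*} [NormedRing E] {f : ℝ⟦X⟧} {Z : E⟦X⟧} {h C D : ℝ}

/-- The majorant `∑ₚ |fₚ| ‖coeff l (Z ^ p)‖` of the coefficient of order `l` of `seriesComp f Z`. -/
def compMajorant (f : ℝ⟦X⟧) (Z : E⟦X⟧) (l : ℕ) : ℝ :=
  ∑ p ∈ range (l + 1), ‖coeff p f‖ * ‖coeff l (Z ^ p)‖

theorem sum_compMajorant_le (h1 : ‖(1 : E)‖ ≤ 1) (hh : 0 ≤ h) (hZ : WeightedNormLE Z h C)
    (hf : WeightedNormLE f C D) (n : ℕ) : ∑ l ∈ range n, compMajorant f Z l * h ^ l ≤ D := by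
  calc ∑ l ∈ range n, compMajorant f Z l * h ^ l
      ≤ ∑ l ∈ range n, ∑ p ∈ range n, ‖coeff p f‖ * (‖coeff l (Z ^ p)‖ * h ^ l) := by
        refine sum_le_sum fun l hl => ?_
        simp only [compMajorant, sum_mul, mul_assoc]
        exact sum_le_sum_of_subset_of_nonneg (range_subset_range.2 (mem_range.1 hl))
          fun _ _ _ => by positivity
    _ = ∑ p ∈ range n, ‖coeff p f‖ * ∑ l ∈ range n, ‖coeff l (Z ^ p)‖ * h ^ l := by
        rw [sum_comm]; simp_rw [mul_sum]
    _ ≤ ∑ p ∈ range n, ‖coeff p f‖ * C ^ p :=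
        sum_le_sum fun p _ => mul_le_mul_of_nonneg_left (hZ.pow h1 hh p n) (norm_nonneg _)
    _ ≤ D := hf n

theorem sum_compMajorant_exp_sub_one_succ_le (h1 : ‖(1 : E)‖ ≤ 1) (hh : 0 ≤ h)
    (hZ : WeightedNormLE Z h C) (n : ℕ) :
    ∑ l ∈ range n, compMajorant (PowerSeries.exp ℝ - 1) Z (l + 1) * h ^ (l + 1) ≤
      Real.exp C - 1 := by
  have hsum := sum_compMajorant_le h1 hh hZ (WeightedNormLE.exp_sub_one hZ.nonneg) (n + 1)
  rw [sum_range_succ'] at hsum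
  refine le_trans (le_add_of_nonneg_right ?_) hsum
  rw [pow_zero, mul_one]
  exact sum_nonneg fun p _ => by positivity

variable [NormedAlgebra ℝ E]

theorem norm_coeff_seriesComp_le (f : ℝ⟦X⟧) (Z : E⟦X⟧) (l : ℕ) :
    ‖coeff l (seriesComp f Z)‖ ≤ compMajorant f Z l := by
  rw [coeff_seriesComp]
  exact norm_sum_le_of_le _ fun p _ => (norm_smul _ _).le

theorem WeightedNormLE.seriesComp (hf : WeightedNormLE f C D) (hZ : WeightedNormLE Z h C)
    (h1 : ‖(1 : E)‖ ≤ 1) (hh : 0 ≤ h) : WeightedNormLE (seriesComp f Z) h D := fun n =>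
  (sum_le_sum fun l _ => mul_le_mul_of_nonneg_right (norm_coeff_seriesComp_le f Z l)
    (by positivity)).trans (sum_compMajorant_le h1 hh hZ hf n)

theorem summable_norm_smul_coeff_pow (h1 : ‖(1 : E)‖ ≤ 1) (hh : 0 ≤ h)
    (hZ : WeightedNormLE Z h C) (hf : WeightedNormLE f C D) :
    Summable fun q : ℕ × ℕ => ‖coeff q.1 f • h ^ q.2 • coeff q.2 (Z ^ q.1)‖ := by
  have hnorm : ∀ p l, ‖coeff p f • h ^ l • coeff l (Z ^ p)‖ =
      ‖coeff p f‖ * (‖coeff l (Z ^ p)‖ * h ^ l) := fun p l => by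
    rw [norm_smul, norm_smul, norm_pow, Real.norm_of_nonneg hh, mul_comm (h ^ _)]
  refine (summable_prod_of_nonneg fun q => norm_nonneg _).2 ⟨fun p => ?_, ?_⟩
  · simp_rw [hnorm]
    exact (summable_of_sum_range_le (fun n => by positivity) (hZ.pow h1 hh p)).mul_left _
  · refine Summable.of_nonneg_of_le (fun p => tsum_nonneg fun l => norm_nonneg _) (fun p => ?_)
      (summable_of_sum_range_le (fun n => mul_nonneg (norm_nonneg _) (pow_nonneg hZ.nonneg n)) hf)
    simp_rw [hnorm]
    rw [tsum_mul_left]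
    exact mul_le_mul_of_nonneg_left
      (Real.tsum_le_of_sum_range_le (fun n => by positivity) (hZ.pow h1 hh p)) (norm_nonneg _)

theorem HasValueAt.seriesComp [CompleteSpace E] {z w : E} (hz : HasValueAt Z h z)
    (hw : HasSum (fun p => coeff p f • z ^ p) w) (h1 : ‖(1 : E)‖ ≤ 1) (hh : 0 ≤ h)
    (hZ0 : constantCoeff Z = 0) (hZ : WeightedNormLE Z h C) (hf : WeightedNormLE f C D) :
    HasValueAt (seriesComp f Z) h w := by
  set G : ℕ × ℕ → E := fun q => coeff q.1 f • h ^ q.2 • coeff q.2 (Z ^ q.1) with hG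
  have hS : Summable G := (summable_norm_smul_coeff_pow h1 hh hZ hf).of_norm
  have hval : ∑' q, G q = w :=
    (hS.hasSum.prod_fiberwise fun p => (hz.pow h1 hh hZ p).const_smul (coeff p f)).unique hw
  have hswap : HasSum (fun q : ℕ × ℕ => G q.swap) w := by
    rw [← hval]
    exact ((Equiv.prodComm ℕ ℕ).hasSum_iff (f := G)).2 hS.hasSum
  refine hswap.prod_fiberwise fun l => ?_
  have hl : h ^ l • coeff l (_root_.seriesComp f Z) = ∑ p ∈ range (l + 1), G (p, l) := by
    rw [coeff_seriesComp, smul_sum]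
    exact sum_congr rfl fun p _ => smul_comm _ _ _
  rw [hl]
  refine hasSum_sum_of_ne_finset_zero fun p hp => ?_
  simp only [hG, Prod.swap]
  rw [coeff_pow_eq_zero_of_lt hZ0 (by simpa using hp), smul_zero, smul_zero]

end SeriesComp

section CentralDifference

open Finset

theorem add_half_pow_le {N : ℝ} {i : ℕ} (hN : 0 < N) (hi : (i : ℝ) ≤ N) :
    (N + 1 / 2) ^ i ≤ 1.65 * N ^ i := by
  have hfactor : N + 1 / 2 = (1 / (2 * N) + 1) * N := by field_simp; ring
  have hexp : Real.exp (1 / 2) ≤ 1.65 := by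
    have hsq : Real.exp (1 / 2) ^ 2 = Real.exp 1 := by rw [← Real.exp_nat_mul]; norm_num
    nlinarith [Real.exp_one_lt_d9, Real.exp_pos (1 / 2)]
  rw [hfactor, mul_pow]
  refine mul_le_mul_of_nonneg_right ?_ (by positivity)
  calc (1 / (2 * N) + 1) ^ i ≤ (Real.exp (1 / (2 * N))) ^ i := by
        gcongr; exact Real.add_one_le_exp _
    _ = Real.exp (i * (1 / (2 * N))) := by rw [← Real.exp_nat_mul]
    _ ≤ Real.exp (1 / 2) := by
        rw [Real.exp_le_exp, mul_one_div, div_le_div_iff₀ (by positivity) two_pos]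
        linarith
    _ ≤ 1.65 := hexp

theorem one_add_pow_sub_one_sub_pow_le {u : ℝ} (hu : 0 ≤ u) (m : ℕ) (hm : m * u ≤ 1 / 2) :
    (1 + u) ^ m - (1 - u) ^ m ≤ 2 * (m * u) * (1 + 0.174 * (m * u) ^ 2) ∧
      (1 + u) ^ m + (1 - u) ^ m ≤ 2 + 1.0437 * (m * u) ^ 2 := by
  induction m with
  | zero => norm_num
  | succ m ih =>
    push_cast at hm ⊢
    obtain ⟨hdiff, hsum⟩ := ih (by nlinarith)
    set D := (1 + u) ^ m - (1 - u) ^ m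
    set S := (1 + u) ^ m + (1 - u) ^ m
    have hdiff_succ : (1 + u) ^ (m + 1) - (1 - u) ^ (m + 1) = D + u * S := by
      simp only [D, S]; ring
    have hsum_succ : (1 + u) ^ (m + 1) + (1 - u) ^ (m + 1) = S + u * D := by
      simp only [D, S]; ring
    rw [hdiff_succ, hsum_succ, show ((m : ℝ) + 1) * u = m * u + u by ring]
    set y := (m : ℝ) * u
    have hy0 : 0 ≤ y := by positivity
    have hy_sq : y ^ 2 ≤ 1 / 4 := by nlinarith
    have hdiff_mul := mul_le_mul_of_nonneg_left hdiff hu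
    have hsum_mul := mul_le_mul_of_nonneg_left hsum hu
    have huy : 0 ≤ u * y ^ 2 := by positivity
    have huuy : 0 ≤ u ^ 2 * y := by positivity
    have huuu : 0 ≤ u ^ 3 := by positivity
    have hcubic : u * y * y ^ 2 ≤ u * y * (1 / 4) :=
      mul_le_mul_of_nonneg_left hy_sq (by positivity)
    constructor
    · nlinarith
    · nlinarith [mul_nonneg hu hy0]

/-- The coefficient of `x ^ i` in the central difference of `x ^ (j + 1) / (j + 1)`. -/
def centralCoeff (j i : ℕ) : ℝ :=
  (j + 1).choose i * (1 / 2) ^ (j + 1 - i) * (1 - (-1) ^ (j + 1 - i)) / (j + 1)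

theorem centralCoeff_nonneg (j i : ℕ) : 0 ≤ centralCoeff j i := by
  unfold centralCoeff
  have hsign : (0 : ℝ) ≤ 1 - (-1) ^ (j + 1 - i) := by
    rcases neg_one_pow_eq_or ℝ (j + 1 - i) with h | h <;> rw [h] <;> norm_num
  positivity

theorem central_difference_pow (j : ℕ) (x : ℝ) :
    (x + 1 / 2) ^ (j + 1) / (j + 1) - (x - 1 / 2) ^ (j + 1) / (j + 1) =
      x ^ j + ∑ i ∈ range j, centralCoeff j i * x ^ i := by
  have hexpand : (x + 1 / 2) ^ (j + 1) / (j + 1) - (x - 1 / 2) ^ (j + 1) / (j + 1) =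
      ∑ i ∈ range (j + 2), centralCoeff j i * x ^ i := by
    rw [add_pow, sub_eq_add_neg x, add_pow, ← sub_div, ← sum_sub_distrib, sum_div]
    refine sum_congr rfl fun i _ => ?_
    rw [centralCoeff, show (-(1 / 2) : ℝ) = (-1) * (1 / 2) by ring, mul_pow]
    ring
  have htop : centralCoeff j j = 1 := by
    have hj : (j : ℝ) + 1 ≠ 0 := by positivity
    rw [centralCoeff, Nat.choose_succ_self_right, Nat.add_sub_cancel_left]
    push_cast
    field_simp
    norm_num
  have hvanish : centralCoeff j (j + 1) = 0 := by simp [centralCoeff]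
  rw [hexpand, sum_range_succ, sum_range_succ, htop, hvanish]
  ring

theorem sum_centralCoeff_le {N : ℝ} {j : ℕ} (hj : (j : ℝ) + 1 ≤ N) :
    ∑ i ∈ range j, centralCoeff j i * N ^ i ≤ 0.0435 * N ^ j := by
  have hj1 : (0 : ℝ) < j + 1 := by positivity
  have hN : 0 < N := hj1.trans_le hj
  set y := ((j + 1 : ℕ) : ℝ) * (1 / (2 * N)) with hy
  have hy0 : 0 ≤ y := by positivity
  have hy_le : y ≤ 1 / 2 := by
    rw [hy, mul_one_div, div_le_div_iff₀ (by positivity) two_pos]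
    push_cast
    linarith
  have hscaled : (1 + 1 / (2 * N)) ^ (j + 1) - (1 - 1 / (2 * N)) ^ (j + 1) ≤ 2 * y * 1.0435 := by
    refine (one_add_pow_sub_one_sub_pow_le (by positivity) (j + 1) hy_le).1.trans
      (mul_le_mul_of_nonneg_left ?_ (by positivity))
    nlinarith
  have hdiff : (N + 1 / 2) ^ (j + 1) / (j + 1) - (N - 1 / 2) ^ (j + 1) / (j + 1) ≤
      1.0435 * N ^ j := by
    rw [show N + 1 / 2 = N * (1 + 1 / (2 * N)) by field_simp,
      show N - 1 / 2 = N * (1 - 1 / (2 * N)) by field_simp, mul_pow, mul_pow, ← sub_div, ← mul_sub,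
      div_le_iff₀ hj1]
    refine (mul_le_mul_of_nonneg_left hscaled (by positivity)).trans (le_of_eq ?_)
    rw [hy, pow_succ]
    push_cast
    field_simp
  linarith [central_difference_pow j N]

end CentralDifference

section PolynomialValues

open Finset Polynomial

variable {E : Type*} [NormedRing E] {N : ℝ}

theorem WeightedNormLE.coe_sum {ι : Type*} {s : Finset ι} {p : ι → E[X]} {D : ι → ℝ} (hN : 0 ≤ N)
    (hp : ∀ i ∈ s, WeightedNormLE (p i : PowerSeries E) N (D i)) :
    WeightedNormLE ((∑ i ∈ s, p i : E[X]) : PowerSeries E) N (∑ i ∈ s, D i) := by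
  have hcoe : ((∑ i ∈ s, p i : E[X]) : PowerSeries E) = ∑ i ∈ s, (p i : PowerSeries E) :=
    map_sum coeToPowerSeries.ringHom p s
  exact hcoe ▸ WeightedNormLE.sum hN hp

variable [NormedAlgebra ℝ E] {p : E[X]}

theorem eval_algebraMap_eq_sum (p : E[X]) (x : ℝ) :
    p.eval (algebraMap ℝ E x) = p.sum fun i c => x ^ i • c := by
  rw [eval_eq_sum]
  refine sum_congr rfl fun i _ => ?_
  dsimp only
  rw [← map_pow, ← Algebra.commutes, ← Algebra.smul_def]

theorem eval_mul_algebraMap (p q : E[X]) (x : ℝ) :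
    (p * q).eval (algebraMap ℝ E x) = p.eval (algebraMap ℝ E x) * q.eval (algebraMap ℝ E x) :=
  eval₂_mul_noncomm (RingHom.id E) _ fun _ => (Algebra.commutes x _).symm

/-- The polynomial obtained from `p` by replacing each monomial `X ^ i` by the real polynomial
`Q i`. -/
def substMonomials (Q : ℕ → ℝ[X]) (p : E[X]) : E[X] :=
  p.sum fun i c => C c * (Q i).map (algebraMap ℝ E)

theorem coeff_substMonomials (Q : ℕ → ℝ[X]) (p : E[X]) (n : ℕ) :
    (substMonomials Q p).coeff n = p.sum fun i c => (Q i).coeff n • c := by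
  rw [substMonomials, Polynomial.sum, finsetSum_coeff]
  refine sum_congr rfl fun i _ => ?_
  rw [coeff_C_mul, coeff_map, ← Algebra.commutes, ← Algebra.smul_def]

theorem eval_substMonomials (Q : ℕ → ℝ[X]) (p : E[X]) (x : ℝ) :
    (substMonomials Q p).eval (algebraMap ℝ E x) = p.sum fun i c => (Q i).eval x • c := by
  rw [substMonomials, Polynomial.sum, eval_finsetSum]
  refine sum_congr rfl fun i _ => ?_
  rw [eval_C_mul, eval_map_algebraMap, aeval_algebraMap_apply_eq_algebraMap_eval,
    ← Algebra.commutes, ← Algebra.smul_def]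

theorem natDegree_substMonomials_le {Q : ℕ → ℝ[X]} {d s : ℕ} (hp : p.natDegree ≤ d)
    (hQ : ∀ i ≤ d, (Q i).natDegree ≤ i + s) : (substMonomials Q p).natDegree ≤ d + s := by
  refine natDegree_sum_le_of_forall_le _ _ fun i hi => ?_
  have hid : i ≤ d := (le_natDegree_of_mem_supp i hi).trans hp
  exact (natDegree_C_mul_le _ _).trans (natDegree_map_le.trans ((hQ i hid).trans (by omega)))

theorem coeff_substMonomials_top {Q : ℕ → ℝ[X]} {d s : ℕ} (hp : p.natDegree ≤ d)
    (hQ : ∀ i ≤ d, (Q i).natDegree ≤ i + s) :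
    (substMonomials Q p).coeff (d + s) = (Q d).coeff (d + s) • p.coeff d := by
  rw [coeff_substMonomials, sum_over_range' p (fun _ => smul_zero _) (d + 1) (by omega),
    sum_eq_single d (fun i hi hne => ?_) (by simp)]
  rw [coeff_eq_zero_of_natDegree_lt, zero_smul]
  have := mem_range_succ_iff.1 hi
  exact (hQ i this).trans_lt (by omega)

theorem WeightedNormLE.substMonomials {Q : ℕ → ℝ[X]} {d : ℕ} {K D : ℝ} (hN : 0 ≤ N) (hK : 0 ≤ K)
    (hp : p.natDegree ≤ d) (hpD : WeightedNormLE (p : PowerSeries E) N D)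
    (hQ : ∀ i ≤ d, WeightedNormLE (Q i : PowerSeries ℝ) N (K * N ^ i)) :
    WeightedNormLE (substMonomials Q p : PowerSeries E) N (K * D) := by
  intro n
  simp only [WeightedNormLE, coeff_coe] at hpD hQ ⊢
  calc ∑ l ∈ range n, ‖(_root_.substMonomials Q p).coeff l‖ * N ^ l
      ≤ ∑ l ∈ range n, ∑ i ∈ range (d + 1), ‖p.coeff i‖ * (‖(Q i).coeff l‖ * N ^ l) := by
        refine sum_le_sum fun l _ => ?_
        rw [coeff_substMonomials, sum_over_range' p (fun _ => smul_zero _) (d + 1) (by omega)]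
        refine (mul_le_mul_of_nonneg_right (norm_sum_le _ _) (by positivity)).trans_eq ?_
        rw [sum_mul]
        exact sum_congr rfl fun i _ => by rw [norm_smul]; ring
    _ = ∑ i ∈ range (d + 1), ‖p.coeff i‖ * ∑ l ∈ range n, ‖(Q i).coeff l‖ * N ^ l := by
        rw [sum_comm]; simp_rw [mul_sum]
    _ ≤ ∑ i ∈ range (d + 1), ‖p.coeff i‖ * (K * N ^ i) :=
        sum_le_sum fun i hi => mul_le_mul_of_nonneg_left
          (hQ i (mem_range_succ_iff.1 hi) n) (norm_nonneg _)
    _ = K * ∑ i ∈ range (d + 1), ‖p.coeff i‖ * N ^ i := by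
        rw [mul_sum]; exact sum_congr rfl fun i _ => by ring
    _ ≤ K * D := mul_le_mul_of_nonneg_left (hpD _) hK

end PolynomialValues

section HalfShift

open Finset Polynomial

variable {E : Type*} [NormedRing E] [NormedAlgebra ℝ E] {p : E[X]} {N : ℝ}

/-- The polynomial `p(x - 1/2)`. -/
def halfShift (p : E[X]) : E[X] :=
  substMonomials (fun i => (X + C (-(1 / 2) : ℝ)) ^ i) p

theorem eval_halfShift (p : E[X]) (x : ℝ) :
    (halfShift p).eval (algebraMap ℝ E x) = p.eval (algebraMap ℝ E (x - 1 / 2)) := by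
  rw [halfShift, eval_substMonomials, eval_algebraMap_eq_sum]
  simp only [eval_pow, eval_add, eval_X, eval_C, sub_eq_add_neg]

theorem natDegree_halfShift_le {d : ℕ} (hp : p.natDegree ≤ d) : (halfShift p).natDegree ≤ d :=
  natDegree_substMonomials_le (s := 0) hp fun i _ => (natDegree_pow_X_add_C i _).le

theorem coeff_halfShift_top {d : ℕ} (hp : p.natDegree ≤ d) :
    (halfShift p).coeff d = p.coeff d := by
  have htop : ((X + C (-(1 / 2) : ℝ)) ^ d).coeff d = 1 := by
    simpa only [natDegree_pow_X_add_C] using ((monic_X_add_C (-(1 / 2) : ℝ)).pow d).coeff_natDegree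
  have := coeff_substMonomials_top (s := 0) hp
    fun i _ => (natDegree_pow_X_add_C i (-(1 / 2) : ℝ)).le
  rwa [add_zero, htop, one_smul] at this

theorem WeightedNormLE.halfShift {d : ℕ} {D : ℝ} (hN : 0 < N) (hd : (d : ℝ) ≤ N)
    (hp : p.natDegree ≤ d) (hpD : WeightedNormLE (p : PowerSeries E) N D) :
    WeightedNormLE (halfShift p : PowerSeries E) N (1.65 * D) := by
  have hX : WeightedNormLE ((X + C (-(1 / 2)) : ℝ[X]) : PowerSeries ℝ) N (N + 1 / 2) := by
    have hlinear := (WeightedNormLE.monomial hN.le 1 (1 : ℝ)).add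
      (WeightedNormLE.const hN.le (-(1 / 2) : ℝ)) hN.le
    rw [Polynomial.coe_add, coe_X, coe_C, PowerSeries.X_eq]
    exact hlinear.mono (by norm_num)
  refine WeightedNormLE.substMonomials hN.le (by norm_num) hp hpD fun i hi => ?_
  rw [Polynomial.coe_pow]
  exact (hX.pow (by simp) hN.le i).mono
    (add_half_pow_le hN (le_trans (by exact_mod_cast hi) hd))

end HalfShift

section CentralAntidifference

open Finset Polynomial

/-- The polynomial vanishing at `0` whose central difference is `X ^ j`, obtained from
`X ^ (j + 1) / (j + 1)` by correcting the lower order terms of `central_difference_pow`. -/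
def centralAntidiffPow (j : ℕ) : ℝ[X] :=
  monomial (j + 1) (1 / ((j : ℝ) + 1)) - ∑ i : Fin j, C (centralCoeff j i) * centralAntidiffPow i

theorem centralAntidiffPow_eq (j : ℕ) : centralAntidiffPow j =
    monomial (j + 1) (1 / ((j : ℝ) + 1)) -
      ∑ i ∈ range j, C (centralCoeff j i) * centralAntidiffPow i := by
  rw [centralAntidiffPow, ← Fin.sum_univ_eq_sum_range
    (fun i => C (centralCoeff j i) * centralAntidiffPow i)]

theorem eval_zero_centralAntidiffPow (j : ℕ) : (centralAntidiffPow j).eval 0 = 0 := by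
  induction j using Nat.strong_induction_on with
  | _ j ih =>
    rw [centralAntidiffPow_eq, eval_sub, eval_finsetSum, eval_monomial,
      sum_eq_zero fun i hi => by rw [eval_C_mul, ih i (mem_range.1 hi), mul_zero]]
    simp

theorem eval_add_half_sub_eval_sub_half_centralAntidiffPow (j : ℕ) (x : ℝ) :
    (centralAntidiffPow j).eval (x + 1 / 2) - (centralAntidiffPow j).eval (x - 1 / 2) = x ^ j := by
  induction j using Nat.strong_induction_on with
  | _ j ih =>
    have hlower : ∑ i ∈ range j, centralCoeff j i * (centralAntidiffPow i).eval (x + 1 / 2) -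
        ∑ i ∈ range j, centralCoeff j i * (centralAntidiffPow i).eval (x - 1 / 2) =
        ∑ i ∈ range j, centralCoeff j i * x ^ i := by
      rw [← sum_sub_distrib]
      exact sum_congr rfl fun i hi => by rw [← mul_sub, ih i (mem_range.1 hi)]
    rw [centralAntidiffPow_eq]
    simp only [eval_sub, eval_finsetSum, eval_monomial, eval_C_mul]
    linear_combination central_difference_pow j x - hlower

theorem natDegree_centralAntidiffPow_le (j : ℕ) : (centralAntidiffPow j).natDegree ≤ j + 1 := by
  induction j using Nat.strong_induction_on with
  | _ j ih =>
    rw [centralAntidiffPow_eq]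
    refine (natDegree_sub_le _ _).trans (max_le (natDegree_monomial_le _)
      (natDegree_sum_le_of_forall_le _ _ fun i hi => (natDegree_C_mul_le _ _).trans ?_))
    have := mem_range.1 hi
    exact (ih i this).trans (by omega)

theorem coeff_centralAntidiffPow_top (j : ℕ) :
    (centralAntidiffPow j).coeff (j + 1) = 1 / ((j : ℝ) + 1) := by
  rw [centralAntidiffPow_eq, coeff_sub, finsetSum_coeff, coeff_monomial_same,
    sum_eq_zero fun i hi => ?_, sub_zero]
  have := mem_range.1 hi
  rw [coeff_C_mul, coeff_eq_zero_of_natDegree_lt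
    ((natDegree_centralAntidiffPow_le i).trans_lt (by omega)), mul_zero]

theorem weightedNormLE_centralAntidiffPow {N : ℝ} {j : ℕ} (hj : (j : ℝ) + 1 ≤ N) :
    WeightedNormLE (centralAntidiffPow j : PowerSeries ℝ) N (1.05 * N * N ^ j) := by
  induction j using Nat.strong_induction_on with
  | _ j ih =>
    have hj1 : (0 : ℝ) < j + 1 := by positivity
    have hN : 0 < N := hj1.trans_le hj
    have hlower : ∀ i ∈ range j, WeightedNormLE
        ((C (-centralCoeff j i) * centralAntidiffPow i : ℝ[X]) : PowerSeries ℝ) N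
        (centralCoeff j i * (1.05 * N * N ^ i)) := fun i hi => by
      have hi' : (i : ℝ) < j := by exact_mod_cast mem_range.1 hi
      have hmon := (WeightedNormLE.const hN.le (-centralCoeff j i)).mul
        (ih i (mem_range.1 hi) (by linarith)) hN.le
      rw [norm_neg, Real.norm_of_nonneg (centralCoeff_nonneg j i)] at hmon
      rwa [Polynomial.coe_mul, coe_C]
    have hsum := (WeightedNormLE.monomial hN.le (j + 1) (1 / ((j : ℝ) + 1))).add
      (WeightedNormLE.coe_sum hN.le hlower) hN.le
    rw [centralAntidiffPow_eq, sub_eq_add_neg, ← sum_neg_distrib, Polynomial.coe_add, coe_monomial]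
    simp only [← neg_mul, ← C_neg]
    refine hsum.mono ?_
    have hfactor : ∑ i ∈ range j, centralCoeff j i * (1.05 * N * N ^ i) =
        1.05 * N * ∑ i ∈ range j, centralCoeff j i * N ^ i := by
      rw [mul_sum]
      exact sum_congr rfl fun i _ => by ring
    have hlead : 1 / ((j : ℝ) + 1) ≤ 1 := by
      rw [div_le_one hj1]; linarith [(Nat.cast_nonneg j : (0 : ℝ) ≤ j)]
    have hbound := mul_le_mul_of_nonneg_left (sum_centralCoeff_le hj)
      (show 0 ≤ 1.05 * N by positivity)
    have hpow : 0 ≤ N * N ^ j := by positivity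
    have hleadpow := mul_le_mul_of_nonneg_right hlead hpow
    rw [hfactor, Real.norm_of_nonneg (by positivity), pow_succ']
    nlinarith

variable {E : Type*} [NormedRing E] [NormedAlgebra ℝ E] {p : E[X]} {N : ℝ}

/-- The polynomial vanishing at `0` whose central difference is `p`. -/
def centralAntidiff (p : E[X]) : E[X] :=
  substMonomials centralAntidiffPow p

theorem eval_zero_centralAntidiff (p : E[X]) : (centralAntidiff p).eval 0 = 0 := by
  have heval := eval_substMonomials centralAntidiffPow p 0
  rw [map_zero] at heval
  refine heval.trans (sum_eq_zero fun i _ => by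
    simp only [eval_zero_centralAntidiffPow, zero_smul])

theorem eval_add_half_sub_eval_sub_half_centralAntidiff (p : E[X]) (x : ℝ) :
    (centralAntidiff p).eval (algebraMap ℝ E (x + 1 / 2)) -
      (centralAntidiff p).eval (algebraMap ℝ E (x - 1 / 2)) = p.eval (algebraMap ℝ E x) := by
  rw [centralAntidiff, eval_substMonomials, eval_substMonomials, eval_algebraMap_eq_sum,
    Polynomial.sum, Polynomial.sum, Polynomial.sum, ← sum_sub_distrib]
  exact sum_congr rfl fun i _ => by
    rw [← sub_smul, eval_add_half_sub_eval_sub_half_centralAntidiffPow]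

theorem natDegree_centralAntidiff_le {d : ℕ} (hp : p.natDegree ≤ d) :
    (centralAntidiff p).natDegree ≤ d + 1 :=
  natDegree_substMonomials_le hp fun i _ => natDegree_centralAntidiffPow_le i

theorem coeff_centralAntidiff_top {d : ℕ} (hp : p.natDegree ≤ d) :
    (centralAntidiff p).coeff (d + 1) = (1 / ((d : ℝ) + 1)) • p.coeff d := by
  rw [centralAntidiff, coeff_substMonomials_top hp fun i _ => natDegree_centralAntidiffPow_le i,
    coeff_centralAntidiffPow_top]

theorem WeightedNormLE.centralAntidiff {d : ℕ} {D : ℝ} (hd : (d : ℝ) + 1 ≤ N)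
    (hp : p.natDegree ≤ d) (hpD : WeightedNormLE (p : PowerSeries E) N D) :
    WeightedNormLE (centralAntidiff p : PowerSeries E) N (1.05 * N * D) := by
  have hN : 0 ≤ N := le_trans (by positivity) hd
  refine WeightedNormLE.substMonomials hN (by positivity) hp hpD fun i hi => ?_
  have hi' : (i : ℝ) ≤ d := by exact_mod_cast hi
  exact weightedNormLE_centralAntidiffPow (by linarith)

end CentralAntidifference

section StepSeries

open Finset PowerSeries

variable {E : Type*} [NormedRing E] [NormedAlgebra ℝ E]

/-- The exponent `∑ A j x ^ j h ^ (j + 1)` as a power series in the step size `h`: the midpoint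
exponent at `x h` of the generator with Taylor coefficients `A`. -/
def genSeries (A : ℕ → E) (x : ℝ) : E⟦X⟧ :=
  PowerSeries.mk fun l => Nat.casesOn l 0 fun j => x ^ j • A j

theorem constantCoeff_genSeries (A : ℕ → E) (x : ℝ) : constantCoeff (genSeries A x) = 0 := by
  rw [← coeff_zero_eq_constantCoeff_apply, genSeries, coeff_mk]; rfl

theorem coeff_succ_genSeries (A : ℕ → E) (x : ℝ) (j : ℕ) :
    coeff (j + 1) (genSeries A x) = x ^ j • A j := by
  rw [genSeries, coeff_mk]

theorem coeff_genSeries_pow (A : ℕ → E) (x : ℝ) (p l : ℕ) :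
    coeff l (genSeries A x ^ p) = x ^ (l - p) • coeff l (genSeries A 1 ^ p) := by
  induction p generalizing l with
  | zero => rcases eq_or_ne l 0 with rfl | h <;> simp [coeff_one, *]
  | succ p ih =>
    rw [pow_succ, pow_succ, coeff_mul, coeff_mul, smul_sum]
    refine sum_congr rfl fun ⟨i, j⟩ hij => ?_
    have hij : i + j = l := HasAntidiagonal.mem_antidiagonal.1 hij
    rcases j with _ | j
    · simp [constantCoeff_genSeries]
    rcases lt_or_ge i p with hip | hip
    · simp [coeff_pow_eq_zero_of_lt (constantCoeff_genSeries A _) hip]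
    · rw [ih, coeff_succ_genSeries, coeff_succ_genSeries, one_pow, one_smul,
        smul_mul_smul_comm, ← pow_add, show i - p + j = l - (p + 1) by omega]

/-- The power series `exp (∑ A j x ^ j h ^ (j + 1))` in the step size `h`. -/
def stepSeries (A : ℕ → E) (x : ℝ) : E⟦X⟧ :=
  seriesComp (PowerSeries.exp ℝ) (genSeries A x)

theorem coeff_seriesComp_genSeries (f : ℝ⟦X⟧) (A : ℕ → E) (x : ℝ) (l : ℕ) :
    coeff l (seriesComp f (genSeries A x)) =
      ∑ p ∈ range (l + 1), (coeff p f * x ^ (l - p)) • coeff l (genSeries A 1 ^ p) := by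
  rw [coeff_seriesComp]
  exact sum_congr rfl fun p _ => by rw [coeff_genSeries_pow, smul_smul]

theorem coeff_zero_stepSeries (A : ℕ → E) (x : ℝ) : coeff 0 (stepSeries A x) = 1 := by
  rw [stepSeries, coeff_zero_eq_constantCoeff_apply, constantCoeff_seriesComp, constantCoeff_exp,
    map_one]

theorem coeff_stepSeries_neg (A : ℕ → E) (x : ℝ) (l : ℕ) :
    coeff l (stepSeries A (-x)) =
      (-1 : ℝ) ^ l • coeff l (seriesComp (evalNegHom (PowerSeries.exp ℝ)) (genSeries A x)) := by
  rw [stepSeries, coeff_seriesComp_genSeries, coeff_seriesComp_genSeries, smul_sum]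
  refine sum_congr rfl fun p hp => ?_
  obtain ⟨m, rfl⟩ := Nat.exists_eq_add_of_le (mem_range_succ_iff.1 hp)
  have hsign : (-1 : ℝ) ^ p * (-1) ^ p = 1 := by rw [← mul_pow]; norm_num
  rw [smul_smul, evalNegHom, coeff_rescale, neg_pow x, Nat.add_sub_cancel_left, pow_add]
  congr 1
  linear_combination (-(coeff p (PowerSeries.exp ℝ)) * (-1) ^ m * x ^ m) * hsign

theorem seriesComp_evalNegHom_exp_mul_stepSeries (A : ℕ → E) (x : ℝ) :
    seriesComp (evalNegHom (PowerSeries.exp ℝ)) (genSeries A x) * stepSeries A x = 1 := by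
  rw [stepSeries, ← seriesComp_mul _ _ (constantCoeff_genSeries A x), mul_comm,
    exp_mul_exp_neg_eq_one, seriesComp_one]

/-- The product of `k` consecutive midpoint exponentials of step size `h` starting at `0`, as a
power series in `h`. -/
def prodSeries (A : ℕ → E) : ℕ → E⟦X⟧
  | 0 => 1
  | k + 1 => stepSeries A (k + 1 / 2) * prodSeries A k

theorem coeff_zero_prodSeries (A : ℕ → E) (k : ℕ) : coeff 0 (prodSeries A k) = 1 := by
  induction k with
  | zero => simp [prodSeries]
  | succ k ih =>
    rw [prodSeries, coeff_mul, Nat.antidiagonal_zero, sum_singleton, coeff_zero_stepSeries, ih,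
      one_mul]

/-- The coefficient of order `n` of `prodSeries A k`, extended to a negative number of steps by
time reversal. -/
def intCoeff (A : ℕ → E) (n : ℕ) : ℤ → E
  | Int.ofNat k => coeff n (prodSeries A k)
  | Int.negSucc k => (-1 : ℝ) ^ n • coeff n (prodSeries A (k + 1))

theorem intCoeff_natCast (A : ℕ → E) (n k : ℕ) :
    intCoeff A n (k : ℤ) = coeff n (prodSeries A k) := rfl

theorem intCoeff_zero_right (A : ℕ → E) {n : ℕ} (hn : n ≠ 0) : intCoeff A n 0 = 0 :=
  (coeff_one n).trans (if_neg hn)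

theorem intCoeff_neg_natCast (A : ℕ → E) (n k : ℕ) :
    intCoeff A n (-(k : ℤ)) = (-1 : ℝ) ^ n • coeff n (prodSeries A k) := by
  rcases k with _ | k
  · change coeff n (prodSeries A 0) = _
    rw [prodSeries, coeff_one]
    split_ifs with h <;> simp [h]
  · rfl

theorem intCoeff_zero_left (A : ℕ → E) (k : ℤ) : intCoeff A 0 k = 1 := by
  obtain ⟨k, rfl | rfl⟩ := k.eq_nat_or_neg
  · rw [intCoeff_natCast, coeff_zero_prodSeries]
  · rw [intCoeff_neg_natCast, coeff_zero_prodSeries, pow_zero, one_smul]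

theorem intCoeff_add_one (A : ℕ → E) (n : ℕ) (k : ℤ) :
    intCoeff A n (k + 1) = ∑ ij ∈ antidiagonal n,
      coeff ij.1 (stepSeries A (k + 1 / 2)) * intCoeff A ij.2 k := by
  rcases k with k | k
  · change coeff n (prodSeries A (k + 1)) = _
    rw [prodSeries, coeff_mul]
    rfl
  · have hsucc : Int.negSucc k + 1 = -(k : ℤ) := by rw [Int.negSucc_eq]; ring
    have hmid : ((Int.negSucc k : ℤ) : ℝ) + 1 / 2 = -((k : ℝ) + 1 / 2) := by
      rw [Int.negSucc_eq]; push_cast; ring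
    have hback : prodSeries A k = seriesComp (evalNegHom (PowerSeries.exp ℝ))
        (genSeries A (k + 1 / 2)) * prodSeries A (k + 1) := by
      rw [prodSeries, ← mul_assoc, seriesComp_evalNegHom_exp_mul_stepSeries, one_mul]
    rw [hsucc, intCoeff_neg_natCast, hmid, hback, coeff_mul, smul_sum]
    refine sum_congr rfl fun ij hij => ?_
    rw [coeff_stepSeries_neg]
    change _ = _ * ((-1 : ℝ) ^ ij.2 • coeff ij.2 (prodSeries A (k + 1)))
    rw [smul_mul_smul_comm, ← pow_add, HasAntidiagonal.mem_antidiagonal.1 hij]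

theorem intCoeff_succ_add_one_sub (A : ℕ → E) (n : ℕ) (k : ℤ) :
    intCoeff A (n + 1) (k + 1) - intCoeff A (n + 1) k =
      ∑ l ∈ range (n + 1), coeff (l + 1) (stepSeries A (k + 1 / 2)) * intCoeff A (n - l) k := by
  rw [intCoeff_add_one, Nat.sum_antidiagonal_eq_sum_range_succ_mk, sum_range_succ']
  simp only [coeff_zero_stepSeries, one_mul, Nat.sub_zero, add_sub_cancel_right,
    Nat.add_sub_add_right]

/-- The Taylor coefficients of the solution of `U' = (∑ A j y ^ j) U`, `U 0 = 1`. -/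
def solCoeff (A : ℕ → E) : ℕ → E
  | 0 => 1
  | n + 1 => (1 / ((n : ℝ) + 1)) • ∑ l : Fin (n + 1), A l * solCoeff A (n - l)
  decreasing_by omega

theorem solCoeff_succ (A : ℕ → E) (n : ℕ) :
    solCoeff A (n + 1) = (1 / ((n : ℝ) + 1)) • ∑ l ∈ range (n + 1), A l * solCoeff A (n - l) := by
  rw [solCoeff, Finset.sum_range fun l => A l * solCoeff A (n - l)]

end StepSeries

section StepPolynomial

open Finset Polynomial

variable {E : Type*} [NormedRing E] [NormedAlgebra ℝ E]

/-- The coefficient of order `l + 1` of `stepSeries A x` as a polynomial in `x`. -/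
def stepPoly (A : ℕ → E) (l : ℕ) : E[X] :=
  ∑ p ∈ range (l + 1), monomial (l - p)
    (((p + 1).factorial : ℝ)⁻¹ • PowerSeries.coeff (l + 1) (genSeries A 1 ^ (p + 1)))

theorem eval_stepPoly (A : ℕ → E) (l : ℕ) (x : ℝ) :
    (stepPoly A l).eval (algebraMap ℝ E x) = PowerSeries.coeff (l + 1) (stepSeries A x) := by
  rw [stepPoly, eval_finsetSum, stepSeries, coeff_seriesComp_genSeries, sum_range_succ' _ (l + 1),
    pow_zero, PowerSeries.coeff_one, if_neg (Nat.succ_ne_zero l), smul_zero, add_zero]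
  refine sum_congr rfl fun p _ => ?_
  rw [eval_monomial, ← map_pow, ← Algebra.commutes, ← Algebra.smul_def, smul_smul,
    Nat.add_sub_add_right, PowerSeries.coeff_exp, one_div, map_inv₀, map_natCast, mul_comm]

theorem natDegree_stepPoly_le (A : ℕ → E) (l : ℕ) : (stepPoly A l).natDegree ≤ l :=
  natDegree_sum_le_of_forall_le _ _ fun _ _ =>
    (natDegree_monomial_le _).trans (Nat.sub_le _ _)

theorem coeff_stepPoly_top (A : ℕ → E) (l : ℕ) : (stepPoly A l).coeff l = A l := by
  rw [stepPoly, finsetSum_coeff, sum_eq_single 0 (fun p hp hp0 => ?_) (by simp), Nat.sub_zero,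
    coeff_monomial_same, zero_add, pow_one, coeff_succ_genSeries]
  · simp
  · have := mem_range_succ_iff.1 hp
    rw [coeff_monomial, if_neg (by omega)]

theorem weightedNormLE_stepPoly (A : ℕ → E) {N : ℝ} (hN : 1 ≤ N) (l : ℕ) :
    WeightedNormLE (stepPoly A l : PowerSeries E) N
      (N ^ l * compMajorant (PowerSeries.exp ℝ - 1) (genSeries A 1) (l + 1)) := by
  have hN0 : 0 ≤ N := zero_le_one.trans hN
  set B : ℕ → E := fun p =>
    ((p + 1).factorial : ℝ)⁻¹ • PowerSeries.coeff (l + 1) (genSeries A 1 ^ (p + 1))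
  have hmon : ∀ p ∈ range (l + 1), WeightedNormLE
      ((monomial (l - p) (B p) : E[X]) : PowerSeries E) N (N ^ l * ‖B p‖) := fun p _ => by
    rw [coe_monomial, mul_comm]
    exact (WeightedNormLE.monomial hN0 _ _).mono
      (mul_le_mul_of_nonneg_left (pow_le_pow_right₀ hN (Nat.sub_le l p)) (norm_nonneg _))
  refine (WeightedNormLE.coe_sum hN0 hmon).mono (le_of_eq ?_)
  rw [← mul_sum, compMajorant, sum_range_succ' _ (l + 1)]
  simp [B, norm_smul, PowerSeries.coeff_one, PowerSeries.coeff_exp]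

/-- The polynomial in the number of steps that interpolates the coefficient of order `n` of the
product of midpoint exponentials; see `eval_intCast_coeffPoly`. -/
def coeffPoly (A : ℕ → E) : ℕ → E[X]
  | 0 => 1
  | n + 1 => centralAntidiff (∑ l : Fin (n + 1), stepPoly A l * halfShift (coeffPoly A (n - l)))
  decreasing_by omega

theorem coeffPoly_succ (A : ℕ → E) (n : ℕ) : coeffPoly A (n + 1) =
    centralAntidiff (∑ l ∈ range (n + 1), stepPoly A l * halfShift (coeffPoly A (n - l))) := by
  rw [coeffPoly, Finset.sum_range fun l => stepPoly A l * halfShift (coeffPoly A (n - l))]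

theorem natDegree_coeffPoly_le (A : ℕ → E) (n : ℕ) : (coeffPoly A n).natDegree ≤ n := by
  induction n using Nat.strong_induction_on with
  | _ n ih =>
    rcases n with _ | n
    · rw [coeffPoly, natDegree_one]
    rw [coeffPoly_succ]
    refine natDegree_centralAntidiff_le (natDegree_sum_le_of_forall_le _ _ fun l hl => ?_)
    have hl := mem_range_succ_iff.1 hl
    refine (natDegree_mul_le_of_le (natDegree_stepPoly_le A l)
      (natDegree_halfShift_le (ih (n - l) (by omega)))).trans (by omega)

theorem natDegree_stepPoly_mul_halfShift_le (A : ℕ → E) {n l : ℕ} (hl : l ≤ n) :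
    (stepPoly A l * halfShift (coeffPoly A (n - l))).natDegree ≤ n :=
  (natDegree_mul_le_of_le (natDegree_stepPoly_le A l)
    (natDegree_halfShift_le (natDegree_coeffPoly_le A (n - l)))).trans (by omega)

theorem coeff_coeffPoly_top (A : ℕ → E) (n : ℕ) : (coeffPoly A n).coeff n = solCoeff A n := by
  induction n using Nat.strong_induction_on with
  | _ n ih =>
    rcases n with _ | n
    · rw [coeffPoly, solCoeff, coeff_one_zero]
    rw [coeffPoly_succ, solCoeff_succ, coeff_centralAntidiff_top (natDegree_sum_le_of_forall_le _ _
      fun l hl => natDegree_stepPoly_mul_halfShift_le A (mem_range_succ_iff.1 hl)), finsetSum_coeff]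
    congr 1
    refine sum_congr rfl fun l hl => ?_
    have hl := mem_range_succ_iff.1 hl
    have htop := coeff_mul_add_eq_of_natDegree_le (natDegree_stepPoly_le A l)
      (natDegree_halfShift_le (natDegree_coeffPoly_le A (n - l)))
    rwa [Nat.add_sub_cancel' hl, coeff_stepPoly_top,
      coeff_halfShift_top (natDegree_coeffPoly_le A _), ih _ (by omega)] at htop

theorem eval_intCast_coeffPoly (A : ℕ → E) (n : ℕ) (k : ℤ) :
    (coeffPoly A n).eval (algebraMap ℝ E k) = intCoeff A n k := by
  induction n using Nat.strong_induction_on generalizing k with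
  | _ n ih =>
    rcases n with _ | n
    · rw [coeffPoly, eval_one, intCoeff_zero_left]
    have hstep : ∀ k : ℤ, (coeffPoly A (n + 1)).eval (algebraMap ℝ E (k + 1 : ℤ)) -
        (coeffPoly A (n + 1)).eval (algebraMap ℝ E k) =
        intCoeff A (n + 1) (k + 1) - intCoeff A (n + 1) k := fun k => by
      have hdiff := eval_add_half_sub_eval_sub_half_centralAntidiff
        (∑ l ∈ range (n + 1), stepPoly A l * halfShift (coeffPoly A (n - l))) ((k : ℝ) + 1 / 2)
      rw [← coeffPoly_succ, show (k : ℝ) + 1 / 2 + 1 / 2 = ((k + 1 : ℤ) : ℝ) by push_cast; ring,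
        add_sub_cancel_right, eval_finsetSum] at hdiff
      rw [hdiff, intCoeff_succ_add_one_sub]
      refine sum_congr rfl fun l _ => ?_
      rw [eval_mul_algebraMap, eval_stepPoly, eval_halfShift, add_sub_cancel_right,
        ih (n - l) (by omega)]
    induction k using Int.induction_on with
    | zero =>
      rw [Int.cast_zero, map_zero, coeffPoly_succ, eval_zero_centralAntidiff,
        intCoeff_zero_right A (Nat.succ_ne_zero n)]
    | succ i hi => exact sub_left_injective (hi ▸ hstep i)
    | pred i hi =>
      have hpred := hstep (-(i : ℤ) - 1)
      rw [sub_add_cancel, hi] at hpred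
      exact sub_right_injective hpred

theorem weightedNormLE_coeffPoly (h1 : ‖(1 : E)‖ ≤ 1) {A : ℕ → E} {ρ C : ℝ} (hρ : 0 < ρ)
    (hC : WeightedNormLE (genSeries A 1) ρ C) (hexp : 1.7325 * (Real.exp C - 1) ≤ 1)
    {N : ℝ} (hN : 1 ≤ N) {n : ℕ} (hn : (n : ℝ) ≤ N) :
    WeightedNormLE (coeffPoly A n : PowerSeries E) N (N ^ n * (1 / ρ) ^ n) := by
  have hN0 : 0 < N := zero_lt_one.trans_le hN
  set maj := compMajorant (PowerSeries.exp ℝ - 1) (genSeries A 1)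
  induction n using Nat.strong_induction_on with
  | _ n ih =>
    rcases n with _ | n
    · simpa [coeffPoly] using WeightedNormLE.one h1 hN0.le
    push_cast at hn
    have hterm : ∀ l ∈ range (n + 1), WeightedNormLE
        ((stepPoly A l * halfShift (coeffPoly A (n - l)) : E[X]) : PowerSeries E) N
        (1.65 * N ^ n * (1 / ρ) ^ (n + 1) * (maj (l + 1) * ρ ^ (l + 1))) := fun l hl => by
      obtain ⟨m, rfl⟩ := Nat.exists_eq_add_of_le (mem_range_succ_iff.1 hl)
      push_cast at hn
      have hm : (m : ℝ) ≤ N := by linarith [(Nat.cast_nonneg l : (0 : ℝ) ≤ l)]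
      have hmul := (weightedNormLE_stepPoly A hN l).mul (WeightedNormLE.halfShift hN0 hm
        (natDegree_coeffPoly_le A m) (ih m (by omega) hm)) hN0.le
      have hcancel : (1 / ρ) ^ (l + m + 1) * ρ ^ (l + 1) = (1 / ρ) ^ m := by
        rw [show l + m + 1 = m + (l + 1) by ring, pow_add, mul_assoc, ← mul_pow,
          one_div_mul_cancel hρ.ne', one_pow, mul_one]
      rw [Nat.add_sub_cancel_left, Polynomial.coe_mul]
      refine hmul.mono (le_of_eq ?_)
      rw [← hcancel]; ring
    have hdiff := (WeightedNormLE.coe_sum hN0.le hterm).centralAntidiff hn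
      (natDegree_sum_le_of_forall_le _ _ fun l hl =>
        natDegree_stepPoly_mul_halfShift_le A (mem_range_succ_iff.1 hl))
    rw [← coeffPoly_succ, ← mul_sum] at hdiff
    refine hdiff.mono ?_
    calc 1.05 * N * (1.65 * N ^ n * (1 / ρ) ^ (n + 1) *
          ∑ l ∈ range (n + 1), maj (l + 1) * ρ ^ (l + 1))
        ≤ 1.05 * N * (1.65 * N ^ n * (1 / ρ) ^ (n + 1) * (Real.exp C - 1)) := by
          gcongr; exact sum_compMajorant_exp_sub_one_succ_le h1 hρ.le hC _
      _ = N ^ (n + 1) * (1 / ρ) ^ (n + 1) * (1.7325 * (Real.exp C - 1)) := by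
          rw [pow_succ N]; ring
      _ ≤ N ^ (n + 1) * (1 / ρ) ^ (n + 1) := mul_le_of_le_one_right (by positivity) hexp

end StepPolynomial

section EvenExpansion

open Finset Polynomial

variable {E : Type*} [NormedRing E] [NormedAlgebra ℝ E]

theorem eval_eq_sum_of_eval_neg_eq {p : E[X]} {n : ℕ} (hp : p.natDegree ≤ n) (hp0 : p.coeff 0 = 0)
    {x : ℝ} (hneg : p.eval (algebraMap ℝ E (-x)) = (-1 : ℝ) ^ n • p.eval (algebraMap ℝ E x)) :
    p.eval (algebraMap ℝ E x) =
      ∑ m ∈ range ((n + 1) / 2), x ^ (n - 2 * m) • p.coeff (n - 2 * m) := by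
  have hsign : ∀ i, (-1 : ℝ) ^ i * (-1) ^ i = 1 := fun i => by rw [← mul_pow]; norm_num
  have hsum : ∀ y : ℝ, p.eval (algebraMap ℝ E y) = ∑ i ∈ range (n + 1), y ^ i • p.coeff i :=
    fun y => (eval_algebraMap_eq_sum p y).trans
      (sum_over_range' p (fun _ => smul_zero _) (n + 1) (by omega))
  have hsym : p.eval (algebraMap ℝ E x) = (1 / 2 : ℝ) • (p.eval (algebraMap ℝ E x) +
      (-1 : ℝ) ^ n • p.eval (algebraMap ℝ E (-x))) := by
    rw [hneg, smul_smul, hsign, one_smul, ← two_smul ℝ, smul_smul]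
    norm_num
  have heven : p.eval (algebraMap ℝ E x) = ∑ m ∈ range (n + 1),
      if Even m then x ^ (n - m) • p.coeff (n - m) else 0 := by
    rw [hsym, hsum, hsum, smul_sum, ← sum_add_distrib, smul_sum, ← sum_range_reflect]
    refine sum_congr rfl fun m hm => ?_
    obtain ⟨i, rfl⟩ := Nat.exists_eq_add_of_le (mem_range_succ_iff.1 hm)
    rw [show m + i + 1 - 1 - m = i by omega, Nat.add_sub_cancel_left, smul_smul, ← add_smul,
      smul_smul]
    have hhalf : (1 / 2 : ℝ) * (x ^ i + (-1) ^ (m + i) * (-x) ^ i) =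
        (1 / 2) * (1 + (-1) ^ m) * x ^ i := by
      rw [neg_pow, pow_add]
      linear_combination ((1 / 2) * (-1) ^ m * x ^ i) * hsign i
    rw [hhalf]
    split_ifs with hm_even
    · rw [hm_even.neg_one_pow]; norm_num
    · rw [(Nat.not_even_iff_odd.1 hm_even).neg_one_pow]; norm_num
  rw [heven, sum_range_succ, Nat.sub_self, hp0, smul_zero, ite_self, add_zero, ← sum_filter]
  refine sum_nbij' (fun m => m / 2) (fun m => 2 * m) (fun m hm => ?_) (fun m hm => ?_)
    (fun m hm => Nat.two_mul_div_two_of_even (mem_filter.1 hm).2) (fun m _ => by simp)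
    (fun m hm => by rw [Nat.two_mul_div_two_of_even (mem_filter.1 hm).2])
  · have := mem_range.1 (mem_filter.1 hm).1
    have := Nat.two_mul_div_two_of_even (mem_filter.1 hm).2
    exact mem_range.2 (by omega)
  · have := mem_range.1 hm
    exact mem_filter.2 ⟨mem_range.2 (by omega), even_two_mul m⟩

theorem coeff_prodSeries_eq_sum (A : ℕ → E) {n k : ℕ} (hn : n ≠ 0) (hk : k ≠ 0) :
    (1 / (k : ℝ)) ^ n • PowerSeries.coeff n (prodSeries A k) =
      ∑ m ∈ range ((n + 1) / 2), (1 / (k : ℝ) ^ 2) ^ m • (coeffPoly A n).coeff (n - 2 * m) := by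
  have hk0 : (k : ℝ) ≠ 0 := Nat.cast_ne_zero.2 hk
  have hnat := eval_intCast_coeffPoly A n k
  have hneg := eval_intCast_coeffPoly A n (-k)
  rw [intCoeff_natCast, Int.cast_natCast] at hnat
  rw [intCoeff_neg_natCast, Int.cast_neg, Int.cast_natCast, ← hnat] at hneg
  have hcoeff0 : (coeffPoly A n).coeff 0 = 0 := by
    have hzero := eval_intCast_coeffPoly A n 0
    rwa [intCoeff_zero_right A hn, Int.cast_zero, map_zero, ← coeff_zero_eq_eval_zero] at hzero
  rw [← hnat, eval_eq_sum_of_eval_neg_eq (natDegree_coeffPoly_le A n) hcoeff0 hneg, smul_sum]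
  refine sum_congr rfl fun m hm => ?_
  have hm := mem_range.1 hm
  obtain ⟨i, hi⟩ := Nat.exists_eq_add_of_le (show 2 * m ≤ n by omega)
  rw [smul_smul, hi, Nat.add_sub_cancel_left, pow_add, pow_mul, mul_assoc, ← mul_pow,
    one_div_mul_cancel hk0, one_pow, mul_one, one_div_pow (k : ℝ) 2]

theorem norm_coeff_coeffPoly_le (h1 : ‖(1 : E)‖ ≤ 1) {A : ℕ → E} {ρ C : ℝ} (hρ : 0 < ρ)
    (hC : WeightedNormLE (genSeries A 1) ρ C) (hexp : 1.7325 * (Real.exp C - 1) ≤ 1)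
    {n m : ℕ} (hm : 2 * m ≤ n) :
    ‖(coeffPoly A n).coeff (n - 2 * m)‖ ≤ (1 / ρ) ^ n * ((n : ℝ) ^ 2) ^ m := by
  rcases n.eq_zero_or_pos with rfl | hn
  · obtain rfl : m = 0 := by omega
    simpa [coeffPoly] using h1
  have hn0 : (0 : ℝ) < n := Nat.cast_pos.2 hn
  have hbound := (weightedNormLE_coeffPoly h1 hρ hC hexp (Nat.one_le_cast.2 hn)
    le_rfl).norm_coeff_mul_pow_le hn0.le (n - 2 * m)
  have hsplit : (n : ℝ) ^ n = ((n : ℝ) ^ 2) ^ m * (n : ℝ) ^ (n - 2 * m) := by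
    rw [← pow_mul, ← pow_add, Nat.add_sub_cancel' hm]
  rw [coeff_coe, hsplit] at hbound
  exact le_of_mul_le_mul_right (hbound.trans_eq (by ring))
    (show 0 < (n : ℝ) ^ (n - 2 * m) by positivity)

end EvenExpansion

section FactorialBounds

open Finset

theorem factorial_card_le_prod (s : Finset ℕ) (hs : ∀ x ∈ s, 0 < x) :
    s.card.factorial ≤ ∏ x ∈ s, x := by
  induction s using Finset.induction_on_max with
  | empty => simp
  | insert a s ha ih =>
    have hna : a ∉ s := fun h => lt_irrefl _ (ha a h)
    have hsub : insert a s ⊆ Finset.Icc 1 a := fun x hx => Finset.mem_Icc.2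
      ⟨hs x hx, (mem_insert.1 hx).elim le_of_eq fun h => (ha x h).le⟩
    have hcard : s.card + 1 ≤ a := by
      simpa only [card_insert_of_notMem hna, Nat.card_Icc, Nat.add_sub_cancel] using
        Finset.card_le_card hsub
    rw [card_insert_of_notMem hna, prod_insert hna, Nat.factorial_succ]
    exact Nat.mul_le_mul hcard (ih fun x hx => hs x (mem_insert_of_mem hx))

theorem factorial_card_le_prod_natAbs {s : Finset ℤ} (hs : ∀ z ∈ s, z ≠ 0)
    (hinj : Set.InjOn Int.natAbs (s : Set ℤ)) : s.card.factorial ≤ ∏ z ∈ s, z.natAbs := by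
  rw [← card_image_of_injOn hinj, ← prod_image (f := fun x : ℕ => x) hinj]
  exact factorial_card_le_prod _ (forall_mem_image.2 fun z hz => Int.natAbs_pos.2 (hs z hz))

theorem factorial_two_mul (M : ℕ) :
    (2 * M).factorial = M.centralBinom * M.factorial ^ 2 := by
  have h := Nat.choose_mul_factorial_mul_factorial (show M ≤ 2 * M by omega)
  rw [← h, Nat.centralBinom_eq_two_mul_choose, show 2 * M - M = M by omega, mul_assoc, sq]

theorem sq_factorial_le_factorial_mul {a b M : ℕ} (h : a + b = 2 * M) :
    M.factorial ^ 2 ≤ a.factorial * b.factorial := by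
  refine Nat.le_of_mul_le_mul_left ?_ (Nat.centralBinom_pos M)
  calc M.centralBinom * M.factorial ^ 2
      = (2 * M).choose a * (a.factorial * b.factorial) := by
        rw [← factorial_two_mul, ← Nat.choose_mul_factorial_mul_factorial
          (show a ≤ 2 * M by omega), show 2 * M - a = b by omega, mul_assoc]
    _ ≤ _ := Nat.mul_le_mul_right _ (Nat.choose_le_centralBinom a M)

theorem sq_factorial_le_prod_natAbs {s : Finset ℤ} (hs : ∀ z ∈ s, z ≠ 0) {M : ℕ}
    (hM : s.card = 2 * M) : M.factorial ^ 2 ≤ ∏ z ∈ s, z.natAbs := by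
  have hcard := card_filter_add_card_filter_not (s := s) fun z => 0 < z
  rw [← prod_filter_mul_prod_filter_not s (fun z => 0 < z)]
  refine (sq_factorial_le_factorial_mul (hcard.trans hM)).trans (Nat.mul_le_mul ?_ ?_)
  all_goals
    refine factorial_card_le_prod_natAbs (fun z hz => hs z (mem_filter.1 hz).1)
      fun x hx y hy hxy => ?_
    have hxsign := (mem_filter.1 (mem_coe.1 hx)).2
    have hysign := (mem_filter.1 (mem_coe.1 hy)).2
    omega

theorem pow_div_sq_factorial_le (M n : ℕ) :
    ((n : ℝ) ^ 2) ^ M / (M.factorial : ℝ) ^ 2 ≤ 4 ^ M * Real.exp n := by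
  have hfact : ((2 * M).factorial : ℝ) ≤ 4 ^ M * (M.factorial : ℝ) ^ 2 := by
    exact_mod_cast (factorial_two_mul M).trans_le
      (Nat.mul_le_mul_right _ (Nat.centralBinom_le_four_pow M))
  have hexp := Real.pow_div_factorial_le_exp (n : ℝ) n.cast_nonneg (2 * M)
  rw [div_le_iff₀ (by positivity)] at hexp ⊢
  calc ((n : ℝ) ^ 2) ^ M ≤ Real.exp n * (2 * M).factorial := by rwa [← pow_mul]
    _ ≤ Real.exp n * (4 ^ M * (M.factorial : ℝ) ^ 2) := by gcongr
    _ = _ := by ring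

variable {ι : Type*} [DecidableEq ι]

/-- The family of the integers `k j`, `k j - k i` for `i ≠ j`, and `k j + k i`. -/
def nodeGap (k : ι → ℕ) (j : ι) : ι ⊕ ι → ℤ :=
  Sum.elim (fun i => if i = j then k j else k j - k i) fun i => k j + k i

variable {k : ι → ℕ}

theorem nodeGap_ne_zero (hk : ∀ j, 0 < k j) (hinj : Function.Injective k) (j : ι) (x : ι ⊕ ι) :
    nodeGap k j x ≠ 0 := by
  have hj := hk j
  rcases x with i | i <;> simp only [nodeGap, Sum.elim_inl, Sum.elim_inr]
  · split_ifs with h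
    · omega
    · have := hinj.ne h
      omega
  · omega

theorem nodeGap_injective (hk : ∀ j, 0 < k j) (hinj : Function.Injective k) (j : ι) :
    Function.Injective (nodeGap k j) := by
  rintro (x | x) (y | y) h <;> have hx := hk x <;> have hy := hk y <;>
    simp only [nodeGap, Sum.elim_inl, Sum.elim_inr] at h
  · congr 1
    split_ifs at h with hxj hyj hyj
    · rw [hxj, hyj]
    · omega
    · omega
    · exact hinj (by omega)
  · split_ifs at h <;> omega
  · split_ifs at h <;> omega
  · exact congrArg _ (hinj (by omega))

theorem sq_factorial_card_le_prod_sq_sub [Fintype ι] (hk : ∀ j, 0 < k j)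
    (hinj : Function.Injective k) (j : ι) :
    ((Fintype.card ι).factorial : ℝ) ^ 2 ≤
      2 * (k j : ℝ) ^ 2 * ∏ i ∈ univ.erase j, |(k j : ℝ) ^ 2 - (k i : ℝ) ^ 2| := by
  have hφ := nodeGap_injective hk hinj j
  have hnat := sq_factorial_le_prod_natAbs (s := univ.image (nodeGap k j))
    (forall_mem_image.2 fun x _ => nodeGap_ne_zero hk hinj j x)
    (by rw [card_image_of_injective _ hφ, card_univ, Fintype.card_sum, two_mul])
  rw [prod_image hφ.injOn, Fintype.prod_sum_type] at hnat
  have hreal := Nat.cast_le (α := ℝ) |>.2 hnat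
  push_cast [Nat.cast_natAbs] at hreal
  refine hreal.trans_eq ?_
  rw [← prod_mul_distrib, ← mul_prod_erase univ _ (mem_univ j)]
  simp only [nodeGap, Sum.elim_inl, Sum.elim_inr]
  congr 1
  · rw [if_pos trivial]
    push_cast
    rw [Nat.abs_cast, abs_of_nonneg (by positivity)]
    ring
  · refine prod_congr rfl fun i hi => ?_
    rw [if_neg (ne_of_mem_erase hi), ← abs_mul]
    push_cast
    rw [mul_comm, ← sq_sub_sq]

end FactorialBounds

section MultiproductCoeff

open Finset

variable {M : ℕ} {a : Fin M → ℝ} {k : Fin M → ℕ}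

namespace IsMultiproductCoeff

theorem sum_mul_pow (h : IsMultiproductCoeff a k) {m : ℕ} (hm : m < M) :
    ∑ j, a j * (1 / (k j : ℝ) ^ 2) ^ m = if m = 0 then 1 else 0 := by
  rw [← h.2 ⟨m, hm⟩]
  refine sum_congr rfl fun j _ => ?_
  rw [one_div_pow, ← pow_mul, mul_one_div]

theorem sum_eq_one (h : IsMultiproductCoeff a k) (hM : 0 < M) : ∑ j, a j = 1 := by
  simpa only [pow_zero, mul_one, if_true] using h.sum_mul_pow hM

theorem sum_smul_sum_range {E : Type*} [AddCommGroup E] [Module ℝ E]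
    (h : IsMultiproductCoeff a k) (c : ℕ → E) {D : ℕ} (hD : 0 < D) (hDM : D ≤ M) :
    ∑ j, a j • ∑ m ∈ range D, (1 / (k j : ℝ) ^ 2) ^ m • c m = c 0 := by
  simp_rw [smul_sum, smul_smul]
  rw [sum_comm]
  simp_rw [← sum_smul]
  rw [sum_eq_single_of_mem 0 (mem_range.2 hD) fun m hm hm0 => ?_,
    h.sum_mul_pow (hD.trans_le hDM), if_pos rfl, one_smul]
  rw [h.sum_mul_pow ((mem_range.1 hm).trans_le hDM), if_neg hm0, zero_smul]

theorem sum_mul_eval (h : IsMultiproductCoeff a k) (hM : 0 < M) {Q : Polynomial ℝ}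
    (hQ : Q.natDegree < M) : ∑ j, a j * Q.eval (1 / (k j : ℝ) ^ 2) = Q.eval 0 := by
  rw [← Polynomial.coeff_zero_eq_eval_zero, ← h.sum_smul_sum_range Q.coeff hM le_rfl]
  simp_rw [Polynomial.eval_eq_sum_range' hQ, smul_eq_mul, mul_comm]

/-- The polynomial `∏ i ≠ j, (1 - (k i) ^ 2 X)` isolates the `j`-th coefficient. -/
theorem mul_prod_eq (h : IsMultiproductCoeff a k) (j : Fin M) :
    a j * ∏ i ∈ univ.erase j, ((k j : ℝ) ^ 2 - (k i : ℝ) ^ 2) = ((k j : ℝ) ^ 2) ^ (M - 1) := by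
  have hk : ∀ i, (k i : ℝ) ≠ 0 := fun i => Nat.cast_ne_zero.2 (h.1 i).ne'
  set Q : Polynomial ℝ := ∏ i ∈ univ.erase j,
    (Polynomial.C (-(k i : ℝ) ^ 2) * Polynomial.X + Polynomial.C 1)
  have hcard : (univ.erase j).card = M - 1 := by
    rw [card_erase_of_mem (mem_univ j), card_univ, Fintype.card_fin]
  have hdeg : Q.natDegree < M := by
    refine ((Polynomial.natDegree_prod_le _ _).trans
      (sum_le_card_nsmul _ _ 1 fun i _ => Polynomial.natDegree_linear_le)).trans_lt ?_
    rw [hcard, smul_eq_mul, mul_one]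
    exact Nat.sub_one_lt j.pos.ne'
  have heval : ∀ x, Q.eval x = ∏ i ∈ univ.erase j, (-(k i : ℝ) ^ 2 * x + 1) := fun x => by
    simp only [Q, Polynomial.eval_prod, Polynomial.eval_add, Polynomial.eval_mul,
      Polynomial.eval_C, Polynomial.eval_X]
  have hroot : ∀ i ∈ Finset.univ, i ≠ j → a i * Q.eval (1 / (k i : ℝ) ^ 2) = 0 := fun i _ hij => by
    rw [heval, prod_eq_zero (mem_erase.2 ⟨hij, mem_univ i⟩), mul_zero]
    have := hk i
    field_simp
    ring
  have hzero : Q.eval 0 = 1 := by simp only [heval, mul_zero, zero_add, prod_const_one]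
  have hval : a j * Q.eval (1 / (k j : ℝ) ^ 2) = 1 := by
    rw [← sum_eq_single_of_mem j (mem_univ j) hroot, h.sum_mul_eval j.pos hdeg, hzero]
  have hprod : ∏ i ∈ univ.erase j, ((k j : ℝ) ^ 2 - (k i : ℝ) ^ 2) =
      ((k j : ℝ) ^ 2) ^ (M - 1) * Q.eval (1 / (k j : ℝ) ^ 2) := by
    rw [heval, ← hcard, ← prod_const, ← prod_mul_distrib]
    refine prod_congr rfl fun i _ => ?_
    have := hk j
    field_simp
    ring
  rw [hprod, mul_left_comm, hval, mul_one]

theorem injective (h : IsMultiproductCoeff a k) : Function.Injective k := by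
  intro i j hij
  by_contra hne
  have hprod := h.mul_prod_eq j
  rw [prod_eq_zero (mem_erase.2 ⟨hne, mem_univ i⟩) (by rw [hij, sub_self]), mul_zero] at hprod
  have : (k j : ℝ) ≠ 0 := Nat.cast_ne_zero.2 (h.1 j).ne'
  exact (pow_ne_zero _ (pow_ne_zero _ this)) hprod.symm

theorem abs_mul_pow_le (h : IsMultiproductCoeff a k) (j : Fin M) :
    |a j| * (1 / (k j : ℝ) ^ 2) ^ M ≤ 2 / (M.factorial : ℝ) ^ 2 := by
  have hk : (0 : ℝ) < k j := Nat.cast_pos.2 (h.1 j)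
  have hprod : |a j| * ∏ i ∈ univ.erase j, |(k j : ℝ) ^ 2 - (k i : ℝ) ^ 2| =
      ((k j : ℝ) ^ 2) ^ (M - 1) := by
    rw [← abs_prod, ← abs_mul, h.mul_prod_eq j, abs_of_nonneg (by positivity)]
  have hfact := sq_factorial_card_le_prod_sq_sub h.1 h.injective j
  rw [Fintype.card_fin] at hfact
  rw [one_div_pow, mul_one_div, div_le_div_iff₀ (by positivity) (by positivity)]
  calc |a j| * (M.factorial : ℝ) ^ 2
      ≤ |a j| * (2 * (k j : ℝ) ^ 2 *
          ∏ i ∈ univ.erase j, |(k j : ℝ) ^ 2 - (k i : ℝ) ^ 2|) := by gcongr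
    _ = 2 * ((k j : ℝ) ^ 2 * ((k j : ℝ) ^ 2) ^ (M - 1)) := by rw [← hprod]; ring
    _ = 2 * ((k j : ℝ) ^ 2) ^ M := by rw [← pow_succ', Nat.sub_add_cancel j.pos]

theorem sum_abs_mul_pow_le (h : IsMultiproductCoeff a k) :
    ∑ j, |a j| * (1 / (k j : ℝ) ^ 2) ^ M ≤ 2 * M / (M.factorial : ℝ) ^ 2 := by
  refine (sum_le_card_nsmul _ _ _ fun j _ => h.abs_mul_pow_le j).trans_eq ?_
  rw [card_univ, Fintype.card_fin, nsmul_eq_mul]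
  ring

theorem one_le_l1Norm (h : IsMultiproductCoeff a k) (hM : 0 < M) : 1 ≤ l1Norm a :=
  (h.sum_eq_one hM).symm.trans_le (sum_le_sum fun _ _ => le_abs_self _)

end IsMultiproductCoeff

end MultiproductCoeff

section SeriesBounds

open Finset PowerSeries

variable {E : Type*} [NormedRing E] [NormedAlgebra ℝ E] {A : ℕ → E}

theorem weightedNormLE_genSeries (hA : ∀ j, ‖A j‖ ≤ 1 / j.factorial) {x h : ℝ}
    (hx : 0 ≤ x) (hh : 0 ≤ h) : WeightedNormLE (genSeries A x) h (h * Real.exp (x * h)) := by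
  rintro (_ | n)
  · simpa only [range_zero, sum_empty] using mul_nonneg hh (Real.exp_nonneg _)
  rw [sum_range_succ', coeff_zero_eq_constantCoeff_apply, constantCoeff_genSeries, norm_zero,
    zero_mul, add_zero]
  refine le_trans ?_ (mul_le_mul_of_nonneg_left
    (Real.sum_le_exp_of_nonneg (mul_nonneg hx hh) n) hh)
  rw [mul_sum]
  refine sum_le_sum fun j _ => ?_
  rw [coeff_succ_genSeries, norm_smul, norm_pow, Real.norm_of_nonneg hx]
  calc x ^ j * ‖A j‖ * h ^ (j + 1) ≤ x ^ j * (1 / j.factorial) * h ^ (j + 1) := by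
        gcongr; exact hA j
    _ = h * ((x * h) ^ j / j.factorial) := by rw [mul_pow]; ring

theorem weightedNormLE_stepSeries (h1 : ‖(1 : E)‖ ≤ 1) (hA : ∀ j, ‖A j‖ ≤ 1 / j.factorial)
    {x h : ℝ} (hx : 0 ≤ x) (hh : 0 ≤ h) :
    WeightedNormLE (stepSeries A x) h (Real.exp (h * Real.exp (x * h))) :=
  (WeightedNormLE.exp (by positivity)).seriesComp (weightedNormLE_genSeries hA hx hh) h1 hh

theorem weightedNormLE_prodSeries (h1 : ‖(1 : E)‖ ≤ 1) (hA : ∀ j, ‖A j‖ ≤ 1 / j.factorial)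
    {h y : ℝ} (hh : 0 ≤ h) (k : ℕ) (hy : k * h ≤ y) :
    WeightedNormLE (prodSeries A k) h (Real.exp (k * (h * Real.exp y))) := by
  induction k with
  | zero => simpa [prodSeries] using WeightedNormLE.one h1 hh
  | succ k ih =>
    push_cast at hy ⊢
    have hexp : Real.exp (h * Real.exp ((k + 1 / 2) * h)) ≤ Real.exp (h * Real.exp y) :=
      Real.exp_le_exp.2 (mul_le_mul_of_nonneg_left (Real.exp_le_exp.2 (by linarith)) hh)
    have hstep := (weightedNormLE_stepSeries h1 hA (x := k + 1 / 2) (by positivity) hh).mono hexp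
    rw [prodSeries, add_one_mul, add_comm (_ * _), Real.exp_add]
    exact hstep.mul (ih (by linarith)) hh

theorem norm_coeff_prodSeries_le (h1 : ‖(1 : E)‖ ≤ 1) (hA : ∀ j, ‖A j‖ ≤ 1 / j.factorial)
    {ρ : ℝ} (hρ : 0 < ρ) {k : ℕ} (hk : k ≠ 0) (n : ℕ) :
    ‖(1 / (k : ℝ)) ^ n • coeff n (prodSeries A k)‖ ≤
      Real.exp (ρ * Real.exp ρ) * (1 / ρ) ^ n := by
  have hk0 : (0 : ℝ) < k := by exact_mod_cast hk.bot_lt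
  have hbound := (weightedNormLE_prodSeries h1 hA (h := ρ / k) (y := ρ) (by positivity) k
    (mul_div_cancel₀ ρ hk0.ne').le).norm_coeff_mul_pow_le (by positivity) n
  rw [← mul_assoc, mul_div_cancel₀ ρ hk0.ne'] at hbound
  rw [norm_smul, norm_pow, Real.norm_of_nonneg (by positivity)]
  calc (1 / (k : ℝ)) ^ n * ‖coeff n (prodSeries A k)‖
      = ‖coeff n (prodSeries A k)‖ * (ρ / k) ^ n * (1 / ρ) ^ n := by
        rw [mul_assoc, ← mul_pow, show ρ / k * (1 / ρ) = 1 / k by field_simp, mul_comm]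
    _ ≤ _ := mul_le_mul_of_nonneg_right hbound (by positivity)

theorem one_div_factorial_le_one (j : ℕ) : 1 / (j.factorial : ℝ) ≤ 1 :=
  div_le_one_of_le₀ (Nat.one_le_cast.2 j.factorial_pos) (Nat.cast_nonneg _)

theorem norm_sum_mul_solCoeff_le {n : ℕ} (hA : ∀ j, ‖A j‖ ≤ 1)
    (hsol : ∀ i ≤ n, ‖solCoeff A i‖ ≤ 1) :
    ‖∑ l ∈ range (n + 1), A l * solCoeff A (n - l)‖ ≤ n + 1 := by
  refine (norm_sum_le_of_le _ fun l _ => (norm_mul_le _ _).trans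
    (mul_le_one₀ (hA l) (norm_nonneg _) (hsol _ (Nat.sub_le n l)))).trans_eq ?_
  simp

theorem norm_solCoeff_le_one (h1 : ‖(1 : E)‖ ≤ 1) (hA : ∀ j, ‖A j‖ ≤ 1) (n : ℕ) :
    ‖solCoeff A n‖ ≤ 1 := by
  induction n using Nat.strong_induction_on with
  | _ n ih =>
  rcases n with _ | n
  · simpa [solCoeff] using h1
  rw [solCoeff_succ, norm_smul, Real.norm_of_nonneg (by positivity), one_div,
    inv_mul_le_iff₀ (by positivity), mul_one]
  exact norm_sum_mul_solCoeff_le hA fun i hi => ih i (Nat.lt_succ_of_le hi)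

theorem exp_mul_exp_le_of_eq_032 : Real.exp (0.32 * Real.exp 0.32) ≤ 1.577 := by
  have hinner : Real.exp 0.32 ≤ 1.38 := by
    refine (Real.exp_bound' (n := 4) (by norm_num) (by norm_num) (by norm_num)).trans ?_
    norm_num [sum_range_succ, Nat.factorial]
  have houter : Real.exp 0.4416 ≤ 1.577 := by
    refine (Real.exp_bound' (n := 4) (by norm_num) (by norm_num) (by norm_num)).trans ?_
    norm_num [sum_range_succ, Nat.factorial]
  exact (Real.exp_le_exp.2 (by linarith)).trans houter

theorem exp_half_mul_exp_half_le : Real.exp (1 / 2 * Real.exp (1 / 2)) ≤ 2.29 := by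
  have hinner : Real.exp (1 / 2) ≤ 1.65 := by
    refine (Real.exp_bound' (n := 5) (by norm_num) (by norm_num) (by norm_num)).trans ?_
    norm_num [sum_range_succ, Nat.factorial]
  have houter : Real.exp 0.825 ≤ 2.29 := by
    refine (Real.exp_bound' (n := 6) (by norm_num) (by norm_num) (by norm_num)).trans ?_
    norm_num [sum_range_succ, Nat.factorial]
  exact (Real.exp_le_exp.2 (by linarith)).trans houter

end SeriesBounds

section TruncationBound

open Finset

variable {E : Type*} [SeminormedAddCommGroup E] {w : ℕ → E} {b t q : ℝ} {D M : ℕ}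

theorem geom_sum_le_inv_one_sub (hq0 : 0 ≤ q) (hq1 : q < 1) (n : ℕ) :
    ∑ i ∈ range n, q ^ i ≤ (1 - q)⁻¹ :=
  sum_le_hasSum _ (fun _ _ => by positivity) (hasSum_geometric_of_lt_one hq0 hq1)

theorem norm_sum_Ico_le_of_le (hb : 0 ≤ b) (ht : 0 ≤ t) (htq : t ≤ q) (hq1 : q < 1)
    (hw : ∀ m < D, ‖w m‖ ≤ b * t ^ m) :
    ‖∑ m ∈ Ico M D, w m‖ ≤ b * t ^ M * (1 - q)⁻¹ := by
  rw [sum_Ico_eq_sum_range]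
  refine (norm_sum_le_of_le (n := fun i => b * t ^ M * q ^ i) _ fun i hi => ?_).trans ?_
  · refine (hw (M + i) (by have := mem_range.1 hi; omega)).trans ?_
    rw [pow_add, ← mul_assoc]
    gcongr
  · rw [← mul_sum]
    gcongr
    exact geom_sum_le_inv_one_sub (ht.trans htq) hq1 _

theorem norm_sum_range_le_of_le (hb : 0 ≤ b) (hq0 : 0 < q) (hqt : q ≤ t) (hq1 : q < 1)
    (hw : ∀ m < M, ‖w m‖ ≤ b * t ^ m) :
    ‖∑ m ∈ range M, w m‖ ≤ b * (t / q) ^ M * (1 - q)⁻¹ := by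
  have htq : 1 ≤ t / q := (one_le_div₀ hq0).2 hqt
  refine (norm_sum_le_of_le (n := fun m => b * (t / q) ^ M * q ^ m) _ fun m hm => ?_).trans ?_
  · have hm := mem_range.1 hm
    calc ‖w m‖ ≤ b * t ^ m := hw m hm
      _ = b * (t / q) ^ m * q ^ m := by rw [mul_assoc, ← mul_pow, div_mul_cancel₀ t hq0.ne']
      _ ≤ b * (t / q) ^ M * q ^ m := by gcongr
  · rw [← mul_sum]
    gcongr
    exact geom_sum_le_inv_one_sub hq0.le hq1 _

/-- For `t ≤ q` the tail is geometric; for `t > q` the full sum and the head are bounded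
separately. -/
theorem norm_sum_sub_sum_le {K : ℝ} (hb : 0 ≤ b) (ht : 0 ≤ t) (hq0 : 0 < q) (hq1 : q < 1)
    (hMD : M ≤ D) (hw : ∀ m < D, ‖w m‖ ≤ b * t ^ m) (hK : 0 ≤ K)
    (hsum : ‖∑ m ∈ range D, w m‖ ≤ K * b) :
    ‖∑ m ∈ range D, w m - ∑ m ∈ range M, w m‖ ≤ (K + (1 - q)⁻¹) * b * (t / q) ^ M := by
  have : 0 ≤ (1 - q)⁻¹ := inv_nonneg.2 (by linarith)
  rcases le_total t q with htq | hqt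
  · rw [← sum_Ico_eq_sub _ hMD]
    calc ‖∑ m ∈ Ico M D, w m‖ ≤ b * t ^ M * (1 - q)⁻¹ := norm_sum_Ico_le_of_le hb ht htq hq1 hw
      _ ≤ b * (t / q) ^ M * (K + (1 - q)⁻¹) := by
          gcongr
          · exact le_div_self ht hq0 hq1.le
          · linarith
      _ = _ := by ring
  · have hhead := norm_sum_range_le_of_le hb hq0 hqt hq1 fun m hm => hw m (hm.trans_le hMD)
    have hone : 1 ≤ (t / q) ^ M := one_le_pow₀ ((one_le_div₀ hq0).2 hqt)
    calc _ ≤ K * b * 1 + b * (t / q) ^ M * (1 - q)⁻¹ := by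
          rw [mul_one]; exact (norm_sub_le _ _).trans (add_le_add hsum hhead)
      _ ≤ K * b * (t / q) ^ M + b * (t / q) ^ M * (1 - q)⁻¹ := by gcongr
      _ = _ := by ring

end TruncationBound

section ErrorCoefficients

open Finset PowerSeries

variable {E : Type*} [NormedRing E] [NormedAlgebra ℝ E]
  {M : ℕ} {a : Fin M → ℝ} {k : Fin M → ℕ} {A : ℕ → E}

/-- The `n`-th Taylor coefficient in the step size of the error of one multiproduct step. -/
def errCoeff (A : ℕ → E) (a : Fin M → ℝ) (k : Fin M → ℕ) (n : ℕ) : E :=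
  ∑ j, a j • (1 / (k j : ℝ)) ^ n • coeff n (prodSeries A (k j)) - solCoeff A n

theorem IsMultiproductCoeff.errCoeff_eq_sum (hak : IsMultiproductCoeff a k) (A : ℕ → E) (n : ℕ)
    {D : ℕ} (hD : 0 < D) (hDM : D ≤ M) :
    errCoeff A a k n = ∑ j, a j • ((1 / (k j : ℝ)) ^ n • coeff n (prodSeries A (k j)) -
      ∑ m ∈ range D, (1 / (k j : ℝ) ^ 2) ^ m • (coeffPoly A n).coeff (n - 2 * m)) := by
  simp_rw [smul_sub, sum_sub_distrib]
  rw [hak.sum_smul_sum_range (fun m => (coeffPoly A n).coeff (n - 2 * m)) hD hDM, mul_zero,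
    Nat.sub_zero, coeff_coeffPoly_top, errCoeff]

theorem IsMultiproductCoeff.errCoeff_eq_zero (hak : IsMultiproductCoeff a k) (hM : 0 < M)
    (A : ℕ → E) {n : ℕ} (hn : n ≤ 2 * M) : errCoeff A a k n = 0 := by
  rcases eq_or_ne n 0 with rfl | hn0
  · simp_rw [errCoeff, coeff_zero_prodSeries, pow_zero, one_smul, ← sum_smul,
      hak.sum_eq_one hM, one_smul]
    rw [solCoeff, sub_self]
  · rw [hak.errCoeff_eq_sum A n (D := (n + 1) / 2) (by omega) (by omega)]
    refine sum_eq_zero fun j _ => ?_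
    rw [coeff_prodSeries_eq_sum A hn0 (hak.1 j).ne', sub_self, smul_zero]

theorem IsMultiproductCoeff.norm_errCoeff_le (hak : IsMultiproductCoeff a k) (hM : 0 < M)
    (h1 : ‖(1 : E)‖ ≤ 1) (hA : ∀ j, ‖A j‖ ≤ 1 / j.factorial) {n : ℕ} (hn : 3 ≤ n) :
    ‖errCoeff A a k n‖ ≤ 2.5 * l1Norm a * 2 ^ n := by
  have hcoeff : ∀ j, ‖(1 / (k j : ℝ)) ^ n • coeff n (prodSeries A (k j))‖ ≤ 2.29 * 2 ^ n :=
    fun j => by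
      refine (norm_coeff_prodSeries_le h1 hA (ρ := 1 / 2) (by norm_num) (hak.1 j).ne' n).trans ?_
      rw [one_div_one_div]
      exact mul_le_mul_of_nonneg_right exp_half_mul_exp_half_le (by positivity)
  have hsum : ‖∑ j, a j • (1 / (k j : ℝ)) ^ n • coeff n (prodSeries A (k j))‖ ≤
      l1Norm a * (2.29 * 2 ^ n) := by
    rw [l1Norm, sum_mul]
    refine norm_sum_le_of_le _ fun j _ => ?_
    rw [norm_smul, Real.norm_eq_abs]
    exact mul_le_mul_of_nonneg_left (hcoeff j) (abs_nonneg _)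
  have hsol := norm_solCoeff_le_one h1 (fun j => (hA j).trans (one_div_factorial_le_one j)) n
  have hl1 := hak.one_le_l1Norm hM
  have hpow : (8 : ℝ) ≤ 2 ^ n := by
    calc (8 : ℝ) = 2 ^ 3 := by norm_num
      _ ≤ 2 ^ n := pow_le_pow_right₀ (by norm_num) hn
  refine (norm_sub_le _ _).trans ?_
  nlinarith

theorem norm_coeff_prodSeries_sub_sum_le (h1 : ‖(1 : E)‖ ≤ 1)
    (hA : ∀ j, ‖A j‖ ≤ 1 / j.factorial) {k n : ℕ} (hk : k ≠ 0) (hn : 2 * M + 1 ≤ n) :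
    ‖(1 / (k : ℝ)) ^ n • coeff n (prodSeries A k) -
        ∑ m ∈ range M, (1 / (k : ℝ) ^ 2) ^ m • (coeffPoly A n).coeff (n - 2 * m)‖ ≤
      7 * (1 / 0.32) ^ n * (1.25 * (n : ℝ) ^ 2) ^ M * (1 / (k : ℝ) ^ 2) ^ M := by
  have hgen := weightedNormLE_genSeries hA (x := 1) (h := 0.32) (by norm_num) (by norm_num)
  rw [one_mul] at hgen
  have hexp := exp_mul_exp_le_of_eq_032
  have hterm : ∀ m < (n + 1) / 2,
      ‖(1 / (k : ℝ) ^ 2) ^ m • (coeffPoly A n).coeff (n - 2 * m)‖ ≤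
        (1 / 0.32) ^ n * ((n : ℝ) ^ 2 * (1 / (k : ℝ) ^ 2)) ^ m := fun m hm => by
    rw [norm_smul, norm_pow, Real.norm_of_nonneg (by positivity), mul_pow, ← mul_assoc, mul_comm]
    gcongr
    exact norm_coeff_coeffPoly_le h1 (by norm_num) hgen (by linarith) (by omega)
  have hfull : ‖∑ m ∈ range ((n + 1) / 2),
      (1 / (k : ℝ) ^ 2) ^ m • (coeffPoly A n).coeff (n - 2 * m)‖ ≤ 2 * (1 / 0.32) ^ n := by
    rw [← coeff_prodSeries_eq_sum A (by omega) hk]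
    refine (norm_coeff_prodSeries_le h1 hA (ρ := 0.32) (by norm_num) hk n).trans ?_
    gcongr
    linarith
  rw [coeff_prodSeries_eq_sum A (by omega) hk]
  refine (norm_sum_sub_sum_le (by positivity) (by positivity) (q := 0.8) (by norm_num)
    (by norm_num) (by omega) hterm zero_le_two hfull).trans_eq ?_
  rw [mul_assoc (7 * (1 / 0.32) ^ n : ℝ), ← mul_pow,
    show (n : ℝ) ^ 2 * (1 / (k : ℝ) ^ 2) / 0.8 = 1.25 * (n : ℝ) ^ 2 * (1 / (k : ℝ) ^ 2) by ring]
  norm_num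

theorem IsMultiproductCoeff.norm_errCoeff_le_pow (hak : IsMultiproductCoeff a k) (hM : 0 < M)
    (h1 : ‖(1 : E)‖ ≤ 1) (hA : ∀ j, ‖A j‖ ≤ 1 / j.factorial) {n : ℕ} (hn : 2 * M + 1 ≤ n) :
    ‖errCoeff A a k n‖ ≤ 14 * M * 5 ^ M * 8.5 ^ n := by
  have hexp : (1 / 0.32) ^ n * Real.exp n ≤ 8.5 ^ n := by
    rw [← mul_one (n : ℝ), Real.exp_nat_mul, ← mul_pow]
    have := Real.exp_one_lt_d9
    gcongr
    linarith
  rw [hak.errCoeff_eq_sum A n hM le_rfl]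
  calc _ ≤ ∑ j, 7 * (1 / 0.32) ^ n * (1.25 * (n : ℝ) ^ 2) ^ M *
          (|a j| * (1 / (k j : ℝ) ^ 2) ^ M) := by
        refine norm_sum_le_of_le _ fun j _ => ?_
        rw [norm_smul, Real.norm_eq_abs, mul_left_comm]
        exact mul_le_mul_of_nonneg_left
          (norm_coeff_prodSeries_sub_sum_le h1 hA (hak.1 j).ne' hn) (abs_nonneg _)
    _ ≤ 7 * (1 / 0.32) ^ n * (1.25 * (n : ℝ) ^ 2) ^ M * (2 * M / (M.factorial : ℝ) ^ 2) := by
        rw [← mul_sum]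
        exact mul_le_mul_of_nonneg_left hak.sum_abs_mul_pow_le (by positivity)
    _ = 14 * M * 1.25 ^ M * (1 / 0.32) ^ n * (((n : ℝ) ^ 2) ^ M / (M.factorial : ℝ) ^ 2) := by
        rw [mul_pow]; ring
    _ ≤ 14 * M * 1.25 ^ M * (1 / 0.32) ^ n * (4 ^ M * Real.exp n) :=
        mul_le_mul_of_nonneg_left (pow_div_sq_factorial_le M n) (by positivity)
    _ = 14 * M * 5 ^ M * ((1 / 0.32) ^ n * Real.exp n) := by
        rw [show (5 : ℝ) = 1.25 * 4 by norm_num, mul_pow]; ring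
    _ ≤ _ := mul_le_mul_of_nonneg_left hexp (by positivity)

end ErrorCoefficients

section ErrorSeries

open Finset PowerSeries

variable {E : Type*} [NormedRing E] [NormedAlgebra ℝ E]

theorem norm_le_of_hasSum_pow_smul {e : ℕ → E} {x : E} {θ D κ : ℝ} {m : ℕ} (hθ : 0 ≤ θ)
    (hκ : 0 ≤ κ) (hκθ : κ * θ < 1) (hlow : ∀ n < m, e n = 0)
    (hhigh : ∀ n, m ≤ n → ‖e n‖ ≤ D * κ ^ n) (hx : HasSum (fun n => θ ^ n • e n) x) :
    ‖x‖ ≤ D * (κ * θ) ^ m / (1 - κ * θ) := by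
  have htail : HasSum (fun n => θ ^ (n + m) • e (n + m)) x := by
    have hshift := (hasSum_nat_add_iff' (f := fun n => θ ^ n • e n) m).2 hx
    rwa [sum_eq_zero fun n hn => by rw [hlow n (mem_range.1 hn), smul_zero], sub_zero] at hshift
  have hgeom : HasSum (fun n => D * (κ * θ) ^ m * (κ * θ) ^ n) (D * (κ * θ) ^ m * (1 - κ * θ)⁻¹) :=
    (hasSum_geometric_of_lt_one (mul_nonneg hκ hθ) hκθ).mul_left _
  rw [div_eq_mul_inv, ← htail.tsum_eq]
  refine tsum_of_norm_bounded hgeom fun n => ?_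
  rw [norm_smul, norm_pow, Real.norm_of_nonneg hθ]
  calc θ ^ (n + m) * ‖e (n + m)‖ ≤ θ ^ (n + m) * (D * κ ^ (n + m)) := by
        gcongr; exact hhigh _ (Nat.le_add_left m n)
    _ = _ := by rw [mul_pow, mul_pow, pow_add, pow_add]; ring

/-- The product of the `k` consecutive midpoint exponentials of step size `h` with generator `f`,
starting at time `0`. -/
def stepProd (f : ℝ → E) (h : ℝ) : ℕ → E
  | 0 => 1
  | k + 1 => NormedSpace.exp (h • f ((k + 1 / 2) * h)) * stepProd f h k

theorem hasValueAt_genSeries {A : ℕ → E} {x h : ℝ} {z : E}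
    (hz : HasSum (fun j => (x * h) ^ j • A j) z) : HasValueAt (genSeries A x) h (h • z) := by
  have hsucc : HasSum (fun j => h ^ (j + 1) • coeff (j + 1) (genSeries A x)) (h • z) := by
    refine (hz.const_smul h).congr_fun fun j => ?_
    rw [coeff_succ_genSeries, smul_smul, smul_smul, mul_pow]
    congr 1
    ring
  have hall := (hasSum_nat_add_iff (f := fun j => h ^ j • coeff j (genSeries A x)) 1).1 hsucc
  rwa [sum_range_one, coeff_zero_eq_constantCoeff_apply, constantCoeff_genSeries, smul_zero,
    add_zero] at hall

variable [CompleteSpace E] {A : ℕ → E} {f : ℝ → E}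

theorem hasValueAt_stepSeries (h1 : ‖(1 : E)‖ ≤ 1) (hA : ∀ j, ‖A j‖ ≤ 1 / j.factorial)
    {x h : ℝ} (hx : 0 ≤ x) (hh : 0 ≤ h) {z : E} (hz : HasSum (fun j => (x * h) ^ j • A j) z) :
    HasValueAt (stepSeries A x) h (NormedSpace.exp (h • z)) := by
  refine (hasValueAt_genSeries hz).seriesComp ?_ h1 hh (constantCoeff_genSeries A x)
    (weightedNormLE_genSeries hA hx hh) (WeightedNormLE.exp (by positivity))
  simpa [coeff_exp] using NormedSpace.exp_series_hasSum_exp' (𝕂 := ℝ) (h • z)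

theorem hasValueAt_prodSeries (h1 : ‖(1 : E)‖ ≤ 1) (hA : ∀ j, ‖A j‖ ≤ 1 / j.factorial)
    {h : ℝ} (hh : 0 ≤ h) (k : ℕ)
    (hf : ∀ q < k, HasSum (fun j => (((q : ℝ) + 1 / 2) * h) ^ j • A j) (f ((q + 1 / 2) * h))) :
    HasValueAt (prodSeries A k) h (stepProd f h k) := by
  induction k with
  | zero => exact HasValueAt.one h
  | succ k ih =>
    have hx : (0 : ℝ) ≤ k + 1 / 2 := by positivity
    exact (hasValueAt_stepSeries h1 hA hx hh (hf k k.lt_succ_self)).mul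
      (ih fun q hq => hf q (hq.trans k.lt_succ_self)) hh
      (weightedNormLE_stepSeries h1 hA hx hh) (weightedNormLE_prodSeries h1 hA hh k le_rfl)

variable {M : ℕ} {a : Fin M → ℝ} {k : Fin M → ℕ}

theorem hasSum_errCoeff (h1 : ‖(1 : E)‖ ≤ 1) (hA : ∀ j, ‖A j‖ ≤ 1 / j.factorial)
    (hk : ∀ j, 0 < k j) {θ : ℝ} (hθ : 0 ≤ θ) {u : E}
    (hf : ∀ y ∈ Set.Icc 0 θ, HasSum (fun j => y ^ j • A j) (f y))
    (hu : HasSum (fun n => θ ^ n • solCoeff A n) u) :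
    HasSum (fun n => θ ^ n • errCoeff A a k n)
      (∑ j, a j • stepProd f (θ / k j) (k j) - u) := by
  have hprod : ∀ j, HasSum
      (fun n => a j • θ ^ n • (1 / (k j : ℝ)) ^ n • coeff n (prodSeries A (k j)))
      (a j • stepProd f (θ / k j) (k j)) := fun j => by
    have hk0 : (0 : ℝ) < k j := Nat.cast_pos.2 (hk j)
    have hvalue := hasValueAt_prodSeries h1 hA (h := θ / k j) (by positivity) (k j) (f := f)
      fun q hq => by
        have hq' : (q : ℝ) + 1 ≤ k j := by exact_mod_cast hq
        refine hf _ ⟨by positivity, ?_⟩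
        calc ((q : ℝ) + 1 / 2) * (θ / k j) ≤ k j * (θ / k j) := by gcongr; linarith
          _ = θ := mul_div_cancel₀ θ hk0.ne'
    refine HasSum.const_smul _ (hvalue.congr_fun fun n => ?_)
    rw [smul_smul, ← mul_pow, mul_one_div]
  refine ((hasSum_sum fun j (_ : j ∈ Finset.univ) => hprod j).sub hu).congr_fun fun n => ?_
  rw [errCoeff, smul_sub, smul_sum]
  simp_rw [smul_comm (θ ^ n) (a _)]

end ErrorSeries

section PowerSeriesSolution

open Finset

variable {E : Type*} [NormedRing E] [NormedAlgebra ℝ E]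

theorem summable_norm_pow_smul {A : ℕ → E} (hA : ∀ j, ‖A j‖ ≤ 1) {x : ℝ} (hx : |x| < 1) :
    Summable fun j => ‖x ^ j • A j‖ := by
  refine Summable.of_nonneg_of_le (fun _ => norm_nonneg _) (fun j => ?_)
    (summable_geometric_of_lt_one (abs_nonneg x) hx)
  rw [norm_smul, norm_pow, Real.norm_eq_abs]
  exact mul_le_of_le_one_right (by positivity) (hA j)

theorem hasDerivAt_pow_smul_solCoeff (A : ℕ → E) (n : ℕ) (y : ℝ) :
    HasDerivAt (fun y : ℝ => y ^ (n + 1) • solCoeff A (n + 1))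
      (y ^ n • ∑ l ∈ range (n + 1), A l * solCoeff A (n - l)) y := by
  refine ((hasDerivAt_pow (n + 1) y).smul_const (solCoeff A (n + 1))).congr_deriv ?_
  rw [solCoeff_succ, smul_smul, Nat.add_sub_cancel]
  congr 1
  push_cast
  field_simp

theorem summable_succ_mul_pow {r : ℝ} (hr0 : 0 ≤ r) (hr1 : r < 1) :
    Summable fun n : ℕ => ((n : ℝ) + 1) * r ^ n := by
  have hpow := summable_pow_mul_geometric_of_norm_lt_one (R := ℝ) 1
    (r := r) (by rwa [Real.norm_of_nonneg hr0])
  simpa only [pow_one, add_one_mul] using hpow.add (summable_geometric_of_lt_one hr0 hr1)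

variable [CompleteSpace E]

theorem tsum_mul_tsum_pow_smul {A B : ℕ → E} {x : ℝ} (hA : Summable fun j => ‖x ^ j • A j‖)
    (hB : Summable fun j => ‖x ^ j • B j‖) :
    (∑' j, x ^ j • A j) * ∑' j, x ^ j • B j =
      ∑' n, x ^ n • ∑ l ∈ range (n + 1), A l * B (n - l) := by
  rw [tsum_mul_tsum_eq_tsum_sum_range_of_summable_norm hA hB]
  refine tsum_congr fun n => ?_
  rw [smul_sum]
  refine sum_congr rfl fun l hl => ?_
  rw [smul_mul_smul_comm, ← pow_add, Nat.add_sub_cancel' (mem_range_succ_iff.1 hl)]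

theorem hasDerivAt_tsum_solCoeff (h1 : ‖(1 : E)‖ ≤ 1) {A : ℕ → E} (hA : ∀ j, ‖A j‖ ≤ 1)
    {x : ℝ} (hx : |x| < 1) :
    HasDerivAt (fun y : ℝ => ∑' n, y ^ n • solCoeff A n)
      ((∑' j, x ^ j • A j) * ∑' n, x ^ n • solCoeff A n) x := by
  obtain ⟨r, hxr, hr1⟩ := exists_between hx
  have hball : ∀ {y : ℝ}, y ∈ Metric.ball (0 : ℝ) r ↔ |y| < r := by simp
  have hsol := norm_solCoeff_le_one h1 hA
  have hsummable : ∀ y : ℝ, |y| < 1 → Summable fun n => y ^ n • solCoeff A n := fun y hy =>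
    (summable_norm_pow_smul hsol hy).of_norm
  have htail : HasDerivAt (fun y : ℝ => ∑' n, y ^ (n + 1) • solCoeff A (n + 1))
      (∑' n, x ^ n • ∑ l ∈ range (n + 1), A l * solCoeff A (n - l)) x := by
    refine hasDerivAt_tsum_of_isPreconnected
      (summable_succ_mul_pow ((abs_nonneg x).trans hxr.le) hr1) Metric.isOpen_ball
      (convex_ball (0 : ℝ) r).isPreconnected
      (fun n y _ => hasDerivAt_pow_smul_solCoeff A n y) (fun n y hy => ?_) (hball.2 hxr)
      ((summable_nat_add_iff 1).2 (hsummable x hx)) (hball.2 hxr)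
    rw [norm_smul, norm_pow, Real.norm_eq_abs, mul_comm]
    gcongr
    · exact norm_sum_mul_solCoeff_le hA fun i _ => hsol i
    · exact (hball.1 hy).le
  rw [tsum_mul_tsum_pow_smul (summable_norm_pow_smul hA hx) (summable_norm_pow_smul hsol hx)]
  refine (htail.const_add (solCoeff A 0)).congr_of_eventuallyEq ?_
  filter_upwards [continuous_abs.continuousAt.eventually_lt_const hx] with y hy
  rw [(hsummable y hy).tsum_eq_zero_add, pow_zero, one_smul]

end PowerSeriesSolution

section Taylor

open Finset Filter

variable {F : Type*} [NormedAddCommGroup F] [NormedSpace ℝ F] {f : ℝ → F} {a b C x : ℝ}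

theorem tendsto_taylorWithinEval_of_norm_le (hab : a ≤ b) (hf : ContDiffOn ℝ ∞ f (Set.Icc a b))
    (hC : ∀ j, ∀ y ∈ Set.Icc a b, ‖iteratedDerivWithin j f (Set.Icc a b) y‖ ≤ C ^ (j + 1))
    (hx : x ∈ Set.Icc a b) :
    Tendsto (fun n => taylorWithinEval f n (Set.Icc a b) a x) atTop (nhds (f x)) := by
  have hzero : Tendsto (fun n : ℕ => C ^ 2 * (x - a) * ((C * (x - a)) ^ n / n.factorial))
      atTop (nhds 0) := by
    simpa only [mul_zero] using
      (FloorSemiring.tendsto_pow_div_factorial_atTop (C * (x - a))).const_mul (C ^ 2 * (x - a))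
  rw [tendsto_iff_norm_sub_tendsto_zero]
  refine squeeze_zero (fun _ => norm_nonneg _) (fun n => ?_) hzero
  rw [norm_sub_rev]
  refine (taylor_mean_remainder_bound hab (hf.of_le (by exact_mod_cast le_top)) hx
    (hC (n + 1))).trans_eq ?_
  rw [mul_pow]
  ring

theorem hasSum_taylor_of_norm_le [CompleteSpace F] (hab : a ≤ b)
    (hf : ContDiffOn ℝ ∞ f (Set.Icc a b))
    (hC : ∀ j, ∀ y ∈ Set.Icc a b, ‖iteratedDerivWithin j f (Set.Icc a b) y‖ ≤ C ^ (j + 1))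
    (hx : x ∈ Set.Icc a b) :
    HasSum (fun j => ((j.factorial : ℝ)⁻¹ * (x - a) ^ j) •
      iteratedDerivWithin j f (Set.Icc a b) a) (f x) := by
  have hxa : 0 ≤ x - a := sub_nonneg.2 hx.1
  have hsummable : Summable fun j => ((j.factorial : ℝ)⁻¹ * (x - a) ^ j) •
      iteratedDerivWithin j f (Set.Icc a b) a := by
    refine Summable.of_norm_bounded
      ((Real.summable_pow_div_factorial (C * (x - a))).mul_left C) fun j => ?_
    rw [norm_smul, Real.norm_of_nonneg (by positivity)]
    refine (mul_le_mul_of_nonneg_left (hC j a (left_mem_Icc.2 hab)) (by positivity)).trans_eq ?_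
    rw [mul_pow]
    ring
  refine hsummable.hasSum_iff_tendsto_nat.2 ((tendsto_add_atTop_iff_nat 1).1 ?_)
  simpa only [taylor_within_apply] using tendsto_taylorWithinEval_of_norm_le hab hf hC hx

end Taylor

section Propagators

variable {d : ℕ}

theorem CMat.norm_one_le : ‖(1 : CMat d)‖ ≤ 1 := by
  rcases isEmpty_or_nonempty (Fin d) with h | h
  · exact (norm_of_subsingleton (1 : CMat d)).trans_le zero_le_one
  · exact (CStarRing.norm_one (E := CMat d)).le

theorem CMat.norm_le_one_of_star_mul_self {U : CMat d} (hU : star U * U = 1) : ‖U‖ ≤ 1 := by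
  have hsq := CStarRing.norm_star_mul_self (x := U)
  rw [hU] at hsq
  have hone := CMat.norm_one_le (d := d)
  nlinarith [norm_nonneg U]

theorem star_mul_eq_of_schrodinger {H P V : ℝ → CMat d} {s s' : ℝ} (hs : s ≤ s')
    (hH : ∀ τ ∈ Icc s s', (H τ).IsHermitian)
    (hP : ∀ τ ∈ Icc s s', HasDerivWithinAt P ((-Complex.I) • (H τ * P τ)) (Icc s s') τ)
    (hV : ∀ τ ∈ Icc s s', HasDerivWithinAt V ((-Complex.I) • (H τ * V τ)) (Icc s s') τ) :
    star (P s') * V s' = star (P s) * V s := by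
  have hderiv : ∀ τ ∈ Icc s s', HasDerivWithinAt (fun τ => star (P τ) * V τ) 0 (Icc s s') τ := by
    intro τ hτ
    have hstar : star (H τ) = H τ := hH τ hτ
    refine ((hP τ hτ).star.mul (hV τ hτ)).congr_deriv ?_
    rw [star_smul, star_mul, hstar, smul_mul_assoc, mul_smul_comm, mul_assoc, ← add_smul]
    simp
  refine constant_of_derivWithin_zero (fun τ hτ => (hderiv τ hτ).differentiableWithinAt)
    (fun τ hτ => ?_) s' (right_mem_Icc.2 hs)
  exact (hderiv τ (Ico_subset_Icc_self hτ)).derivWithin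
    (uniqueDiffOn_Icc (hτ.1.trans_lt hτ.2) τ (Ico_subset_Icc_self hτ))

theorem IsPropagator.star_mul_self {H P : ℝ → CMat d} {s s' : ℝ} (hs : s ≤ s')
    (hH : ∀ τ ∈ Icc s s', (H τ).IsHermitian) (hP : IsPropagator H s s' P) :
    star (P s') * P s' = 1 := by
  rw [star_mul_eq_of_schrodinger hs hH hP.2 hP.2, hP.1, star_one, one_mul]

theorem norm_propagator_le_one {H : ℝ → CMat d} {s s' : ℝ} (hs : s ≤ s')
    (hH : ∀ τ ∈ Icc s s', (H τ).IsHermitian) (hc : ContinuousOn H (Icc s s')) :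
    ‖propagator H s s'‖ ≤ 1 := by
  obtain ⟨P, hP⟩ := exists_isPropagator hs hc
  rw [← hP.eq_propagator hs hc]
  exact CMat.norm_le_one_of_star_mul_self (hP.star_mul_self hs hH)

theorem IsPropagator.eq_propagator_mul {H V : ℝ → CMat d} {t₀ t s s' : ℝ} (hs0 : t₀ ≤ s)
    (hs : s ≤ s') (hst : s' ≤ t) (hH : ∀ τ ∈ Icc t₀ t, (H τ).IsHermitian)
    (hc : ContinuousOn H (Icc t₀ t)) (hV : IsPropagator H t₀ t V) :
    V s' = propagator H s s' * V s := by
  have hsub : Icc s s' ⊆ Icc t₀ t := Icc_subset_Icc hs0 hst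
  have hH' : ∀ τ ∈ Icc s s', (H τ).IsHermitian := fun τ hτ => hH τ (hsub hτ)
  obtain ⟨P, hP⟩ := exists_isPropagator hs (hc.mono hsub)
  have hconst := star_mul_eq_of_schrodinger hs hH' hP.2 fun τ hτ => (hV.2 τ (hsub hτ)).mono hsub
  rw [hP.1, star_one, one_mul] at hconst
  rw [← hP.eq_propagator hs (hc.mono hsub), ← hconst, ← mul_assoc,
    mul_eq_one_comm.1 (hP.star_mul_self hs hH'), one_mul]

theorem timeOrderedProd_succ {n : ℕ} (F : Fin (n + 1) → CMat d) :
    timeOrderedProd F = F (Fin.last n) * timeOrderedProd fun i => F i.castSucc := by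
  simp only [timeOrderedProd, List.ofFn_succ', List.concat_eq_append, List.reverse_append,
    List.reverse_cons, List.reverse_nil, List.nil_append, List.singleton_append, List.prod_cons]

theorem IsPropagator.eq_timeOrderedProd_mul {H V : ℝ → CMat d} {t₀ t : ℝ}
    (hH : ∀ τ ∈ Icc t₀ t, (H τ).IsHermitian) (hc : ContinuousOn H (Icc t₀ t))
    (hV : IsPropagator H t₀ t V) {r : ℕ} {mesh : Fin (r + 1) → ℝ} (hmono : Monotone mesh)
    (h0 : t₀ ≤ mesh 0) (hr : mesh (Fin.last r) ≤ t) :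
    V (mesh (Fin.last r)) =
      (timeOrderedProd fun i : Fin r => propagator H (mesh i.castSucc) (mesh i.succ)) *
        V (mesh 0) := by
  induction r with
  | zero => simp [timeOrderedProd]
  | succ r ih =>
    have hstep : mesh (Fin.last r).castSucc ≤ mesh (Fin.last r).succ :=
      hmono Fin.castSucc_lt_succ.le
    have hinit := ih (hmono.comp Fin.strictMono_castSucc.monotone) h0 (hstep.trans hr)
    have hlast := hV.eq_propagator_mul (h0.trans (hmono (Fin.zero_le _))) hstep hr hH hc
    rw [timeOrderedProd_succ, mul_assoc]
    exact hlast.trans (congrArg _ hinit)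

theorem propagator_eq_timeOrderedProd {H : ℝ → CMat d} {r : ℕ} {mesh : Fin (r + 1) → ℝ}
    (hmono : Monotone mesh) (hH : ∀ τ ∈ Icc (mesh 0) (mesh (Fin.last r)), (H τ).IsHermitian)
    (hc : ContinuousOn H (Icc (mesh 0) (mesh (Fin.last r)))) :
    propagator H (mesh 0) (mesh (Fin.last r)) =
      timeOrderedProd fun i : Fin r => propagator H (mesh i.castSucc) (mesh i.succ) := by
  have hle : mesh 0 ≤ mesh (Fin.last r) := hmono (Fin.zero_le _)
  obtain ⟨V, hV⟩ := exists_isPropagator hle hc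
  rw [← hV.eq_propagator hle hc, hV.eq_timeOrderedProd_mul hH hc hmono le_rfl le_rfl, hV.1, mul_one]

theorem norm_timeOrderedProd_le_pow {n : ℕ} {F : Fin n → CMat d} {C : ℝ}
    (hF : ∀ i, ‖F i‖ ≤ C) : ‖timeOrderedProd F‖ ≤ C ^ n := by
  induction n with
  | zero => simpa [timeOrderedProd] using CMat.norm_one_le (d := d)
  | succ n ih =>
    rw [timeOrderedProd_succ, pow_succ']
    have hC : 0 ≤ C := (norm_nonneg _).trans (hF (Fin.last n))
    exact (norm_mul_le _ _).trans (mul_le_mul (hF _) (ih fun i => hF _) (norm_nonneg _) hC)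

theorem norm_timeOrderedProd_sub_le {n : ℕ} {F G : Fin n → CMat d} {δ : ℝ}
    (hF : ∀ i, ‖F i‖ ≤ 1) (hFG : ∀ i, ‖G i - F i‖ ≤ δ) :
    ‖timeOrderedProd F - timeOrderedProd G‖ ≤ (1 + δ) ^ n - 1 := by
  induction n with
  | zero => simp [timeOrderedProd]
  | succ n ih =>
    have hδ : 0 ≤ δ := (norm_nonneg _).trans (hFG (Fin.last n))
    rw [timeOrderedProd_succ, timeOrderedProd_succ G]
    set A := F (Fin.last n)
    set B := G (Fin.last n)
    set P := timeOrderedProd fun i : Fin n => F i.castSucc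
    set Q := timeOrderedProd fun i : Fin n => G i.castSucc
    have hP : ‖P‖ ≤ 1 := (norm_timeOrderedProd_le_pow fun i => hF i.castSucc).trans_eq (one_pow n)
    have hB : ‖B‖ ≤ 1 + δ :=
      (norm_le_norm_add_norm_sub' B A).trans (add_le_add (hF _) (hFG _))
    calc ‖A * P - B * Q‖ = ‖B * (P - Q) - (B - A) * P‖ := by congr 1; noncomm_ring
      _ ≤ ‖B‖ * ‖P - Q‖ + ‖B - A‖ * ‖P‖ :=
          (norm_sub_le _ _).trans (add_le_add (norm_mul_le _ _) (norm_mul_le _ _))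
      _ ≤ (1 + δ) * ((1 + δ) ^ n - 1) + δ * 1 := by
          gcongr
          · exact ih (fun i => hF _) fun i => hFG _
          · exact hFG _
      _ = (1 + δ) ^ (n + 1) - 1 := by ring

end Propagators

section Midpoint

variable {d : ℕ} {H : ℝ → CMat d} {s s' : ℝ}

theorem midpointPower_eq_timeOrderedProd (H : ℝ → CMat d) (k : ℕ) (s' s : ℝ) :
    midpointPower H k s' s = timeOrderedProd fun q : Fin k =>
      NormedSpace.exp ((-Complex.I * (((s' - s) / k : ℝ) : ℂ)) •
        H (s + (s' - s) * ((q : ℝ) + 1 / 2) / k)) := by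
  refine congrArg timeOrderedProd (funext fun q => ?_)
  rw [midpointFormula,
    show s + (s' - s) * (q : ℝ) / k +
      (s + (s' - s) * ((q : ℝ) + 1) / k - (s + (s' - s) * (q : ℝ) / k)) / 2 =
        s + (s' - s) * ((q : ℝ) + 1 / 2) / k by ring,
    show s + (s' - s) * ((q : ℝ) + 1) / k - (s + (s' - s) * (q : ℝ) / k) = (s' - s) / k by ring]

theorem midpoint_mem_Icc (hs : s ≤ s') {q k : ℕ} (hq : q < k) :
    s + (s' - s) * ((q : ℝ) + 1 / 2) / k ∈ Icc s s' := by
  have hlen : 0 ≤ s' - s := sub_nonneg.2 hs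
  have hqk : (q : ℝ) + 1 ≤ k := by exact_mod_cast hq
  have hk : (0 : ℝ) < k := by exact_mod_cast q.zero_le.trans_lt hq
  refine ⟨le_add_of_nonneg_right (by positivity), ?_⟩
  rw [← le_sub_iff_add_le', div_le_iff₀ hk]
  exact mul_le_mul_of_nonneg_left (by linarith) hlen

theorem norm_exp_neg_I_mul_smul_le_one {A : CMat d} (hA : A.IsHermitian) (x : ℝ) :
    ‖NormedSpace.exp ((-Complex.I * (x : ℂ)) • A)‖ ≤ 1 := by
  have : CompleteSpace (CMat d) := FiniteDimensional.complete ℂ _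
  let : NormedAlgebra ℚ (CMat d) := NormedAlgebra.restrictScalars ℚ ℂ _
  have hskew : (-Complex.I * (x : ℂ)) • A ∈ skewAdjoint (CMat d) := by
    rw [skewAdjoint.mem_iff, star_smul, show star A = A from hA, ← neg_smul]
    congr 1
    simp
  exact CMat.norm_le_one_of_star_mul_self
    (Unitary.star_mul_self_of_mem (NormedSpace.exp_mem_unitary_of_mem_skewAdjoint hskew))

theorem norm_multiproductFormula_le (hs : s ≤ s') (hH : ∀ τ ∈ Icc s s', (H τ).IsHermitian)
    {M : ℕ} (a : Fin M → ℝ) (k : Fin M → ℕ) : ‖multiproductFormula H a k s' s‖ ≤ l1Norm a := by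
  refine norm_sum_le_of_le _ fun j _ => ?_
  rw [norm_smul, Complex.norm_real, Real.norm_eq_abs, midpointPower_eq_timeOrderedProd]
  refine mul_le_of_le_one_right (abs_nonneg _) ((norm_timeOrderedProd_le_pow fun q =>
    norm_exp_neg_I_mul_smul_le_one (hH _ ?_) _).trans_eq (one_pow _))
  exact midpoint_mem_Icc hs q.2

theorem stepProd_eq_timeOrderedProd (f : ℝ → CMat d) (h : ℝ) (n : ℕ) :
    stepProd f h n =
      timeOrderedProd fun q : Fin n => NormedSpace.exp (h • f (((q : ℝ) + 1 / 2) * h)) := by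
  induction n with
  | zero => rfl
  | succ n ih =>
    rw [timeOrderedProd_succ, stepProd, ih]
    rfl

theorem midpointPower_eq_stepProd (hs : s ≤ s') {f : ℝ → CMat d} {l : ℝ}
    (hf : ∀ τ ∈ Icc s s', l • f (l * (τ - s)) = (-Complex.I) • H τ) (k : ℕ) :
    midpointPower H k s' s = stepProd f (l * (s' - s) / k) k := by
  rw [midpointPower_eq_timeOrderedProd, stepProd_eq_timeOrderedProd]
  refine congrArg timeOrderedProd (funext fun q => ?_)
  have hmid := hf _ (midpoint_mem_Icc hs q.2)
  rw [show ((q : ℝ) + 1 / 2) * (l * (s' - s) / k) =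
      l * (s + (s' - s) * ((q : ℝ) + 1 / 2) / k - s) by ring,
    show l * (s' - s) / k = (s' - s) / k * l by ring, mul_smul ((s' - s) / k) l, hmid,
    mul_comm (-Complex.I), mul_smul, Complex.coe_smul]

end Midpoint

section LambdaBound

variable {d : ℕ} {H : ℝ → CMat d} {Λ : ℝ → ℝ} {t₀ t s s' τ : ℝ}

theorem IsLambdaBound.nonneg (hΛ : IsLambdaBound H Λ t₀ t) (hτ : τ ∈ Icc t₀ t) : 0 ≤ Λ τ :=
  (Real.rpow_nonneg (norm_nonneg _) _).trans (hΛ.2 τ hτ 0)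

theorem IsLambdaBound.norm_iteratedDerivWithin_le (hΛ : IsLambdaBound H Λ t₀ t)
    (hτ : τ ∈ Icc t₀ t) (j : ℕ) :
    ‖iteratedDerivWithin j H (Icc t₀ t) τ‖ ≤ Λ τ ^ (j + 1) := by
  have hroot := hΛ.2 τ hτ j
  rw [one_div, ← Nat.cast_succ] at hroot
  rw [← Real.rpow_inv_natCast_pow (norm_nonneg _) j.succ_ne_zero]
  exact pow_le_pow_left₀ (by positivity) hroot _

theorem iteratedDerivWithin_Icc_of_subset {F : Type*} [NormedAddCommGroup F] [NormedSpace ℝ F]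
    {f : ℝ → F} (hf : ContDiffOn ℝ ∞ f (Icc t₀ t)) (hs0 : t₀ ≤ s) (hs : s < s') (hst : s' ≤ t)
    (j : ℕ) (hτ : τ ∈ Icc s s') :
    iteratedDerivWithin j f (Icc s s') τ = iteratedDerivWithin j f (Icc t₀ t) τ := by
  rw [iteratedDerivWithin, iteratedDerivWithin, iteratedFDerivWithin_subset
    (Icc_subset_Icc hs0 hst) (uniqueDiffOn_Icc hs)
    (uniqueDiffOn_Icc ((hs0.trans_lt hs).trans_le hst)) (hf.of_le (by exact_mod_cast le_top)) hτ]

theorem IsLambdaBound.mono (hΛ : IsLambdaBound H Λ t₀ t) (hSmooth : ContDiffOn ℝ ∞ H (Icc t₀ t))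
    (hs0 : t₀ ≤ s) (hs : s < s') (hst : s' ≤ t) : IsLambdaBound H Λ s s' := by
  have hsub : Icc s s' ⊆ Icc t₀ t := Icc_subset_Icc hs0 hst
  refine ⟨hΛ.1.mono hsub, fun τ hτ j => ?_⟩
  rw [iteratedDerivWithin_Icc_of_subset hSmooth hs0 hs hst j hτ]
  exact hΛ.2 τ (hsub hτ) j

theorem IsLambdaBound.hasSum_taylor (hΛ : IsLambdaBound H Λ s s')
    (hSmooth : ContDiffOn ℝ ∞ H (Icc s s')) (hτ : τ ∈ Icc s s') :
    HasSum (fun j => ((j.factorial : ℝ)⁻¹ * (τ - s) ^ j) •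
      iteratedDerivWithin j H (Icc s s') s) (H τ) := by
  have : CompleteSpace (CMat d) := FiniteDimensional.complete ℂ _
  obtain ⟨C, hC⟩ := isCompact_Icc.exists_bound_of_continuousOn hΛ.1
  refine hasSum_taylor_of_norm_le (hτ.1.trans hτ.2) hSmooth (C := C) (fun j y hy => ?_) hτ
  exact (hΛ.norm_iteratedDerivWithin_le hy j).trans
    (pow_le_pow_left₀ (hΛ.nonneg hy) ((le_abs_self _).trans (hC y hy)) _)

end LambdaBound

section RescaledStep

variable {d : ℕ} {H : ℝ → CMat d} {Λ : ℝ → ℝ} {l s s' : ℝ}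

/-- The Taylor coefficients of the generator in the rescaled time `x = l * (τ - s)`: the equation
`i V' = H V` becomes `dV/dx = (∑ j, x ^ j • A j) V`, with `‖A j‖ ≤ 1 / j!` for `l = Λ s`. -/
def rescaledCoeff (H : ℝ → CMat d) (l s s' : ℝ) (j : ℕ) : CMat d :=
  ((l ^ (j + 1))⁻¹ * (j.factorial : ℝ)⁻¹) • (-Complex.I) • iteratedDerivWithin j H (Icc s s') s

theorem norm_neg_I_smul (X : CMat d) : ‖(-Complex.I) • X‖ = ‖X‖ := by
  rw [norm_smul, norm_neg, Complex.norm_I, one_mul]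

theorem IsLambdaBound.norm_rescaledCoeff_le (hΛ : IsLambdaBound H Λ s s') (hs : s ≤ s') (j : ℕ) :
    ‖rescaledCoeff H (Λ s) s s' j‖ ≤ 1 / j.factorial := by
  have hmem : s ∈ Icc s s' := left_mem_Icc.2 hs
  have hΛ0 : 0 ≤ Λ s := hΛ.nonneg hmem
  rw [rescaledCoeff, norm_smul, norm_neg_I_smul, Real.norm_of_nonneg (by positivity)]
  calc (Λ s ^ (j + 1))⁻¹ * (j.factorial : ℝ)⁻¹ * ‖iteratedDerivWithin j H (Icc s s') s‖
      ≤ (Λ s ^ (j + 1))⁻¹ * (j.factorial : ℝ)⁻¹ * Λ s ^ (j + 1) := by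
        gcongr; exact hΛ.norm_iteratedDerivWithin_le hmem j
    _ = (Λ s ^ (j + 1))⁻¹ * Λ s ^ (j + 1) * (1 / j.factorial) := by ring
    _ ≤ 1 / j.factorial := mul_le_of_le_one_left (by positivity) inv_mul_le_one

/-- This includes the junk case `Λ s = 0`, where all derivatives of `H` at `s` vanish. -/
theorem IsLambdaBound.pow_smul_rescaledCoeff (hΛ : IsLambdaBound H Λ s s') (hs : s ≤ s') (j : ℕ) :
    Λ s ^ (j + 1) • rescaledCoeff H (Λ s) s s' j =
      (j.factorial : ℝ)⁻¹ • (-Complex.I) • iteratedDerivWithin j H (Icc s s') s := by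
  rcases eq_or_ne (Λ s ^ (j + 1)) 0 with h0 | h0
  · have hderiv := hΛ.norm_iteratedDerivWithin_le (left_mem_Icc.2 hs) j
    rw [h0] at hderiv
    rw [h0, zero_smul, norm_le_zero_iff.1 hderiv, smul_zero, smul_zero]
  · rw [rescaledCoeff, smul_smul, mul_inv_cancel_left₀ h0]

theorem IsLambdaBound.norm_rescaledCoeff_le_one (hΛ : IsLambdaBound H Λ s s') (hs : s ≤ s')
    (j : ℕ) : ‖rescaledCoeff H (Λ s) s s' j‖ ≤ 1 :=
  (hΛ.norm_rescaledCoeff_le hs j).trans (one_div_factorial_le_one j)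

theorem IsLambdaBound.smul_tsum_rescaledCoeff (hΛ : IsLambdaBound H Λ s s')
    (hSmooth : ContDiffOn ℝ ∞ H (Icc s s')) {τ : ℝ} (hτ : τ ∈ Icc s s')
    (hlt : |Λ s * (τ - s)| < 1) :
    Λ s • ∑' j, (Λ s * (τ - s)) ^ j • rescaledCoeff H (Λ s) s s' j = (-Complex.I) • H τ := by
  have : CompleteSpace (CMat d) := FiniteDimensional.complete ℂ _
  have hs : s ≤ s' := hτ.1.trans hτ.2
  have hgen := (summable_norm_pow_smul (hΛ.norm_rescaledCoeff_le_one hs) hlt).of_norm.hasSum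
  refine (hgen.const_smul (Λ s)).unique
    (((hΛ.hasSum_taylor hSmooth hτ).const_smul (-Complex.I)).congr_fun fun j => ?_)
  calc Λ s • (Λ s * (τ - s)) ^ j • rescaledCoeff H (Λ s) s s' j
      = (τ - s) ^ j • Λ s ^ (j + 1) • rescaledCoeff H (Λ s) s s' j := by
        rw [smul_smul, smul_smul, mul_pow]; congr 1; ring
    _ = (τ - s) ^ j • (j.factorial : ℝ)⁻¹ • (-Complex.I) •
          iteratedDerivWithin j H (Icc s s') s := by rw [hΛ.pow_smul_rescaledCoeff hs]
    _ = _ := by rw [smul_smul, mul_comm, smul_comm]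

theorem isPropagator_tsum_solCoeff {A : ℕ → CMat d} (hA : ∀ j, ‖A j‖ ≤ 1)
    (hlt : ∀ τ ∈ Icc s s', |l * (τ - s)| < 1)
    (hf : ∀ τ ∈ Icc s s', l • ∑' j, (l * (τ - s)) ^ j • A j = (-Complex.I) • H τ) :
    IsPropagator H s s' fun τ => ∑' n, (l * (τ - s)) ^ n • solCoeff A n := by
  have : CompleteSpace (CMat d) := FiniteDimensional.complete ℂ _
  refine ⟨?_, fun τ hτ => ?_⟩
  · beta_reduce
    rw [sub_self, mul_zero, tsum_eq_single 0 fun n hn => by rw [zero_pow hn, zero_smul], pow_zero,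
      one_smul, solCoeff]
  · have houter := hasDerivAt_tsum_solCoeff CMat.norm_one_le hA (hlt τ hτ)
    have hinner : HasDerivAt (fun τ => l * (τ - s)) l τ := by
      simpa using ((hasDerivAt_id τ).sub_const s).const_mul l
    refine (houter.scomp τ hinner).hasDerivWithinAt.congr_deriv ?_
    rw [← smul_mul_assoc, hf τ hτ, smul_mul_assoc]

variable {M : ℕ} {a : Fin M → ℝ} {k : Fin M → ℕ}

theorem IsLambdaBound.hasSum_errCoeff_rescaledCoeff (hΛ : IsLambdaBound H Λ s s')
    (hSmooth : ContDiffOn ℝ ∞ H (Icc s s')) (hs : s ≤ s') (hk : ∀ j, 0 < k j)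
    (hlt : Λ s * (s' - s) < 1) :
    HasSum (fun n => (Λ s * (s' - s)) ^ n • errCoeff (rescaledCoeff H (Λ s) s s') a k n)
      (multiproductFormula H a k s' s - propagator H s s') := by
  have : CompleteSpace (CMat d) := FiniteDimensional.complete ℂ _
  have hΛ0 : 0 ≤ Λ s := hΛ.nonneg (left_mem_Icc.2 hs)
  have hA := hΛ.norm_rescaledCoeff_le_one hs
  have hτ : ∀ τ ∈ Icc s s', |Λ s * (τ - s)| < 1 := fun τ hτ => by
    rw [abs_of_nonneg (mul_nonneg hΛ0 (sub_nonneg.2 hτ.1))]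
    exact (mul_le_mul_of_nonneg_left (sub_le_sub_right hτ.2 s) hΛ0).trans_lt hlt
  have hgen := fun τ hτs => hΛ.smul_tsum_rescaledCoeff hSmooth hτs (hτ τ hτs)
  have hprop := (isPropagator_tsum_solCoeff hA hτ hgen).eq_propagator hs hSmooth.continuousOn
  have hformula : multiproductFormula H a k s' s = ∑ j, a j • stepProd
      (fun x => ∑' i, x ^ i • rescaledCoeff H (Λ s) s s' i) (Λ s * (s' - s) / k j) (k j) :=
    Finset.sum_congr rfl fun j _ => by
      rw [Complex.coe_smul, midpointPower_eq_stepProd hs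
        (f := fun x => ∑' i, x ^ i • rescaledCoeff H (Λ s) s s' i) hgen]
  rw [hformula, ← hprop]
  refine hasSum_errCoeff CMat.norm_one_le (hΛ.norm_rescaledCoeff_le hs) hk
    (mul_nonneg hΛ0 (sub_nonneg.2 hs))
    (fun y hy => (summable_norm_pow_smul hA ?_).of_norm.hasSum)
    (summable_norm_pow_smul (norm_solCoeff_le_one CMat.norm_one_le hA)
      (hτ s' (right_mem_Icc.2 hs))).of_norm.hasSum
  rw [abs_of_nonneg hy.1]
  exact hy.2.trans_lt hlt

theorem IsLambdaBound.norm_multiproductFormula_sub_le (hΛ : IsLambdaBound H Λ s s')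
    (hSmooth : ContDiffOn ℝ ∞ H (Icc s s')) (hs : s ≤ s') (hM : 0 < M)
    (hak : IsMultiproductCoeff a k) {θ D κ : ℝ} (hD : 0 ≤ D) (hκ : 1 ≤ κ)
    (hθ : Λ s * (s' - s) ≤ θ) (hκθ : κ * θ < 1)
    (herr : ∀ n, 2 * M + 1 ≤ n → ‖errCoeff (rescaledCoeff H (Λ s) s s') a k n‖ ≤ D * κ ^ n) :
    ‖multiproductFormula H a k s' s - propagator H s s'‖ ≤
      D * (κ * θ) ^ (2 * M + 1) / (1 - κ * θ) := by
  have hnonneg : 0 ≤ Λ s * (s' - s) :=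
    mul_nonneg (hΛ.nonneg (left_mem_Icc.2 hs)) (sub_nonneg.2 hs)
  have hκ0 : 0 ≤ κ := zero_le_one.trans hκ
  have hmul : κ * (Λ s * (s' - s)) ≤ κ * θ := mul_le_mul_of_nonneg_left hθ hκ0
  have hsum := hΛ.hasSum_errCoeff_rescaledCoeff (a := a) hSmooth hs hak.1
    ((le_mul_of_one_le_left hnonneg hκ).trans_lt (hmul.trans_lt hκθ))
  refine (norm_le_of_hasSum_pow_smul hnonneg hκ0 (hmul.trans_lt hκθ)
    (fun n hn => hak.errCoeff_eq_zero hM _ (Nat.lt_succ_iff.1 hn)) herr hsum).trans ?_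
  have : 0 < 1 - κ * θ := sub_pos.2 hκθ
  have hκθ0 : 0 ≤ κ * θ := mul_nonneg hκ0 (hnonneg.trans hθ)
  gcongr

theorem IsLambdaBound.norm_multiproductFormula_sub_le_l1Norm_mul (hΛ : IsLambdaBound H Λ s s')
    (hSmooth : ContDiffOn ℝ ∞ H (Icc s s')) (hs : s ≤ s') (hM : 0 < M)
    (hak : IsMultiproductCoeff a k) {θ : ℝ} (hle : Λ s * (s' - s) ≤ θ) (hθ : θ ≤ 5 / 41) :
    ‖multiproductFormula H a k s' s - propagator H s s'‖ ≤
      3.31 * l1Norm a * (2 * θ) ^ (2 * M + 1) := by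
  have hθ0 : 0 ≤ θ := hle.trans' (mul_nonneg (hΛ.nonneg (left_mem_Icc.2 hs)) (sub_nonneg.2 hs))
  have hl1 := hak.one_le_l1Norm hM
  refine (hΛ.norm_multiproductFormula_sub_le hSmooth hs hM hak (by positivity) one_le_two hle
    (by linarith) fun n hn => hak.norm_errCoeff_le hM CMat.norm_one_le
      (hΛ.norm_rescaledCoeff_le hs) (by omega)).trans ?_
  have hpos : 0 ≤ l1Norm a * (2 * θ) ^ (2 * M + 1) := by positivity
  rw [div_le_iff₀ (by linarith)]
  nlinarith

theorem IsLambdaBound.norm_multiproductFormula_sub_le_pow_mul (hΛ : IsLambdaBound H Λ s s')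
    (hSmooth : ContDiffOn ℝ ∞ H (Icc s s')) (hs : s ≤ s') (hM : 0 < M)
    (hak : IsMultiproductCoeff a k) {θ : ℝ} (hle : Λ s * (s' - s) ≤ θ) (hθ : θ ≤ 1.6 / 41) :
    ‖multiproductFormula H a k s' s - propagator H s s'‖ ≤
      21 * M * 5 ^ M * (8.5 * θ) ^ (2 * M + 1) := by
  have hθ0 : 0 ≤ θ := hle.trans' (mul_nonneg (hΛ.nonneg (left_mem_Icc.2 hs)) (sub_nonneg.2 hs))
  refine (hΛ.norm_multiproductFormula_sub_le hSmooth hs hM hak (by positivity) (by norm_num) hle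
    (by linarith) fun n hn => hak.norm_errCoeff_le_pow hM CMat.norm_one_le
      (hΛ.norm_rescaledCoeff_le hs) hn).trans ?_
  have hpos : 0 ≤ M * 5 ^ M * (8.5 * θ) ^ (2 * M + 1) := by positivity
  rw [div_le_iff₀ (by linarith)]
  nlinarith

end RescaledStep

section Mesh

variable {Λ : ℝ → ℝ} {s s' K : ℝ}

theorem continuousOn_integral_right (hs : s ≤ s') (hc : ContinuousOn Λ (Icc s s')) :
    ContinuousOn (fun τ => ∫ x in s..τ, Λ x) (Icc s s') := by
  rw [← uIcc_of_le hs] at hc ⊢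
  exact intervalIntegral.continuousOn_primitive_interval' hc.intervalIntegrable left_mem_uIcc

theorem integral_sub_integral_right (hc : ContinuousOn Λ (Icc s s')) {x y : ℝ}
    (hx : x ∈ Icc s s') (hy : y ∈ Icc s s') :
    (∫ τ in s..y, Λ τ) - ∫ τ in s..x, Λ τ = ∫ τ in x..y, Λ τ := by
  have hs : s ∈ Icc s s' := left_mem_Icc.2 (hx.1.trans hx.2)
  exact intervalIntegral.integral_interval_sub_left
    (hc.mono (uIcc_subset_Icc hs hy)).intervalIntegrable
    (hc.mono (uIcc_subset_Icc hs hx)).intervalIntegrable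

theorem monotoneOn_integral_right (hc : ContinuousOn Λ (Icc s s'))
    (h0 : ∀ τ ∈ Icc s s', 0 ≤ Λ τ) : MonotoneOn (fun τ => ∫ x in s..τ, Λ x) (Icc s s') := by
  intro x hx y hy hxy
  rw [← sub_nonneg, integral_sub_integral_right hc hx hy]
  exact intervalIntegral.integral_nonneg hxy fun τ hτ => h0 τ (Icc_subset_Icc hx.1 hy.2 hτ)

theorem hasDerivAt_integral_right (hc : ContinuousOn Λ (Icc s s')) {τ : ℝ} (hτ : τ ∈ Ioo s s') :
    HasDerivAt (fun τ => ∫ x in s..τ, Λ x) (Λ τ) τ := by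
  have hτ' := Ioo_subset_Icc_self hτ
  have hint : IntervalIntegrable Λ volume s τ :=
    (hc.mono (uIcc_subset_Icc (left_mem_Icc.2 (hτ'.1.trans hτ'.2)) hτ')).intervalIntegrable
  exact intervalIntegral.integral_hasDerivAt_right hint
    ((hc.mono Ioo_subset_Icc_self).stronglyMeasurableAtFilter isOpen_Ioo τ hτ)
    (hc.continuousAt (Icc_mem_nhds hτ.1 hτ.2))

theorem monotoneOn_mul_exp_integral (hs : s ≤ s') (hc : ContinuousOn Λ (Icc s s'))
    (hd : ∀ τ ∈ Ioo s s', DifferentiableAt ℝ Λ τ)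
    (hΛK : ∀ τ ∈ Ioo s s', -(K * Λ τ ^ 2) ≤ deriv Λ τ) :
    MonotoneOn (fun τ => Λ τ * Real.exp (K * ∫ x in s..τ, Λ x)) (Icc s s') := by
  have hder : ∀ τ ∈ Ioo s s', HasDerivAt (fun τ => Λ τ * Real.exp (K * ∫ x in s..τ, Λ x))
      ((deriv Λ τ + K * Λ τ ^ 2) * Real.exp (K * ∫ x in s..τ, Λ x)) τ := fun τ hτ =>
    ((hd τ hτ).hasDerivAt.mul ((hasDerivAt_integral_right hc hτ).const_mul K).exp).congr_deriv
      (by ring)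
  refine monotoneOn_of_deriv_nonneg (convex_Icc s s')
    (hc.mul ((continuousOn_integral_right hs hc).const_smul K).rexp) ?_ ?_ <;>
    rw [interior_Icc]
  · exact fun τ hτ => (hder τ hτ).differentiableAt.differentiableWithinAt
  · intro τ hτ
    rw [(hder τ hτ).deriv]
    exact mul_nonneg (by linarith [hΛK τ hτ]) (Real.exp_pos _).le

/-- By monotonicity, `Λ s` is at most `exp (K ∫ Λ)` times any later value of `Λ`; integrate. -/
theorem mul_sub_le_integral_mul_exp (hs : s ≤ s') (hc : ContinuousOn Λ (Icc s s'))
    (h0 : ∀ τ ∈ Icc s s', 0 ≤ Λ τ) (hd : ∀ τ ∈ Ioo s s', DifferentiableAt ℝ Λ τ) (hK : 0 ≤ K)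
    (hΛK : ∀ τ ∈ Ioo s s', -(K * Λ τ ^ 2) ≤ deriv Λ τ) :
    Λ s * (s' - s) ≤ (∫ τ in s..s', Λ τ) * Real.exp (K * ∫ τ in s..s', Λ τ) := by
  have hle : ∀ τ ∈ Icc s s', Λ s ≤ Λ τ * Real.exp (K * ∫ x in s..s', Λ x) := fun τ hτ => by
    have hmono := monotoneOn_mul_exp_integral hs hc hd hΛK (left_mem_Icc.2 hs) hτ hτ.1
    simp only [intervalIntegral.integral_same, mul_zero, Real.exp_zero, mul_one] at hmono
    have hint := monotoneOn_integral_right hc h0 hτ (right_mem_Icc.2 hs) hτ.2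
    refine hmono.trans (mul_le_mul_of_nonneg_left (Real.exp_le_exp.2 ?_) (h0 τ hτ))
    exact mul_le_mul_of_nonneg_left hint hK
  calc Λ s * (s' - s) = ∫ _ in s..s', Λ s := by
        rw [intervalIntegral.integral_const, smul_eq_mul, mul_comm]
    _ ≤ ∫ τ in s..s', Λ τ * Real.exp (K * ∫ x in s..s', Λ x) :=
        intervalIntegral.integral_mono_on hs intervalIntegrable_const
          ((hc.intervalIntegrable_of_Icc hs).mul_const _) hle
    _ = _ := intervalIntegral.integral_mul_const _ _

theorem exp_mul_le_of_mul_le {l : ℝ} (hK : 0 ≤ K) (hl : (1 + 3 / 2 * K) * l ≤ 3 / 2) :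
    Real.exp (K * l) ≤ 1 + 3 / 2 * K := by
  have hexp : Real.exp (K * l) * (1 - K * l) ≤ 1 := by
    calc Real.exp (K * l) * (1 - K * l) ≤ Real.exp (K * l) * Real.exp (-(K * l)) :=
          mul_le_mul_of_nonneg_left (Real.one_sub_le_exp_neg _) (Real.exp_pos _).le
      _ = 1 := by rw [← Real.exp_add, add_neg_cancel, Real.exp_zero]
  have hfactor : 1 ≤ (1 - K * l) * (1 + 3 / 2 * K) := by nlinarith
  calc Real.exp (K * l) ≤ Real.exp (K * l) * ((1 - K * l) * (1 + 3 / 2 * K)) :=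
        le_mul_of_one_le_right (Real.exp_pos _).le hfactor
    _ = Real.exp (K * l) * (1 - K * l) * (1 + 3 / 2 * K) := (mul_assoc _ _ _).symm
    _ ≤ 1 + 3 / 2 * K := mul_le_of_le_one_left (by positivity) hexp

theorem mul_sub_le_mul_integral (hs : s ≤ s') (hc : ContinuousOn Λ (Icc s s'))
    (h0 : ∀ τ ∈ Icc s s', 0 ≤ Λ τ) (hd : ∀ τ ∈ Ioo s s', DifferentiableAt ℝ Λ τ) (hK : 0 ≤ K)
    (hΛK : ∀ τ ∈ Ioo s s', -(K * Λ τ ^ 2) ≤ deriv Λ τ)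
    (hsmall : (1 + 3 / 2 * K) * ∫ τ in s..s', Λ τ ≤ 3 / 2) :
    Λ s * (s' - s) ≤ (1 + 3 / 2 * K) * ∫ τ in s..s', Λ τ := by
  rw [mul_comm (1 + 3 / 2 * K)]
  exact (mul_sub_le_integral_mul_exp hs hc h0 hd hK hΛK).trans
    (mul_le_mul_of_nonneg_left (exp_mul_le_of_mul_le hK hsmall)
      (intervalIntegral.integral_nonneg hs h0))

theorem exists_equidistributed_point {a b : ℝ} (hab : a ≤ b) {F : ℝ → ℝ}
    (hF : ContinuousOn F (Icc a b)) (hFab : F a ≤ F b) {r : ℕ} [NeZero r] (i : Fin (r + 1)) :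
    ∃ x ∈ Icc a b, F x = F a + i / r * (F b - F a) ∧ (i = 0 → x = a) ∧
      (i = Fin.last r → x = b) := by
  have hends : (0 : Fin (r + 1)) ≠ Fin.last r := Fin.last_pos'.ne
  have hr : (r : ℝ) ≠ 0 := NeZero.ne _
  rcases eq_or_ne i 0 with rfl | hi0
  · exact ⟨a, left_mem_Icc.2 hab, by simp, fun _ => rfl, fun h => absurd h hends⟩
  rcases eq_or_ne i (Fin.last r) with rfl | hir
  · exact ⟨b, right_mem_Icc.2 hab, by simp [hr], fun h => absurd h hi0, fun _ => rfl⟩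
  have hquot : (i : ℝ) / r ≤ 1 := div_le_one_of_le₀ (by exact_mod_cast i.is_le) r.cast_nonneg
  have : 0 ≤ F b - F a := sub_nonneg.2 hFab
  obtain ⟨x, hx, hFx⟩ := intermediate_value_Icc hab hF
    (show F a + i / r * (F b - F a) ∈ Icc (F a) (F b) from
      ⟨le_add_of_nonneg_right (by positivity), by nlinarith⟩)
  exact ⟨x, hx, hFx, fun h => absurd h hi0, fun h => absurd h hir⟩

theorem exists_strictMono_equidistributed {a b : ℝ} (hab : a < b) {F : ℝ → ℝ}
    (hF : ContinuousOn F (Icc a b)) (hmono : MonotoneOn F (Icc a b)) {r : ℕ} [NeZero r]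
    (hr : r = 1 ∨ F a < F b) :
    ∃ mesh : Fin (r + 1) → ℝ, StrictMono mesh ∧ mesh 0 = a ∧ mesh (Fin.last r) = b ∧
      ∀ i : Fin r, F (mesh i.succ) - F (mesh i.castSucc) = (F b - F a) / r := by
  have hFab := hmono (left_mem_Icc.2 hab.le) (right_mem_Icc.2 hab.le) hab.le
  choose mesh hmem hFmesh h0 hlast using
    exists_equidistributed_point (r := r) hab.le hF hFab
  have hstep (i : Fin r) : F (mesh i.succ) - F (mesh i.castSucc) = (F b - F a) / r := by
    rw [hFmesh, hFmesh, Fin.val_castSucc, Fin.val_succ, Nat.cast_succ]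
    ring
  refine ⟨mesh, Fin.strictMono_iff_lt_succ.2 fun i => ?_, h0 0 rfl, hlast _ rfl, hstep⟩
  rcases hr with rfl | hlt
  · obtain rfl := Subsingleton.elim i 0
    exact (h0 _ rfl).trans_lt (hab.trans_eq (hlast _ rfl).symm)
  · have hpos : 0 < (F b - F a) / r :=
      div_pos (sub_pos.2 hlt) (Nat.cast_pos.2 (Nat.pos_of_neZero r))
    exact hmono.reflect_lt (hmem _) (hmem _) (sub_pos.1 (hpos.trans_eq (hstep i).symm))

theorem exists_mesh_mul_sub_le {t₀ t : ℝ} (ht : t₀ < t) (hc : ContinuousOn Λ (Icc t₀ t))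
    (h0 : ∀ τ ∈ Icc t₀ t, 0 ≤ Λ τ) (hd : DifferentiableOn ℝ Λ (Icc t₀ t)) (hK : 0 ≤ K)
    (hΛK : ∀ τ ∈ Icc t₀ t, |derivWithin Λ (Icc t₀ t) τ| ≤ K * Λ τ ^ 2) {r : ℕ} [NeZero r]
    (hr : r = 1 ∨ 0 < ∫ τ in t₀..t, Λ τ)
    (hsmall : (1 + 3 / 2 * K) * ((∫ τ in t₀..t, Λ τ) / r) ≤ 3 / 2) :
    ∃ mesh : Fin (r + 1) → ℝ, StrictMono mesh ∧ mesh 0 = t₀ ∧ mesh (Fin.last r) = t ∧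
      ∀ i : Fin r, Λ (mesh i.castSucc) * (mesh i.succ - mesh i.castSucc) ≤
        (1 + 3 / 2 * K) * ((∫ τ in t₀..t, Λ τ) / r) := by
  obtain ⟨mesh, hmono, rfl, rfl, hstep⟩ := exists_strictMono_equidistributed ht
    (continuousOn_integral_right ht.le hc) (monotoneOn_integral_right hc h0) (r := r)
    (by rwa [intervalIntegral.integral_same])
  refine ⟨mesh, hmono, rfl, rfl, fun i => ?_⟩
  have hmem (j : Fin (r + 1)) : mesh j ∈ Icc (mesh 0) (mesh (Fin.last r)) :=
    ⟨hmono.monotone (Fin.zero_le j), hmono.monotone (Fin.le_last j)⟩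
  have hsub := Icc_subset_Icc (hmem i.castSucc).1 (hmem i.succ).2
  have hnhds : ∀ τ ∈ Ioo (mesh i.castSucc) (mesh i.succ),
      Icc (mesh 0) (mesh (Fin.last r)) ∈ nhds τ := fun τ hτ =>
    Filter.mem_of_superset (Icc_mem_nhds hτ.1 hτ.2) hsub
  have hint := hstep i
  rw [integral_sub_integral_right hc (hmem _) (hmem _), intervalIntegral.integral_same,
    sub_zero] at hint
  rw [← hint] at hsmall ⊢
  refine mul_sub_le_mul_integral (hmono Fin.castSucc_lt_succ).le (hc.mono hsub)
    (fun τ hτ => h0 τ (hsub hτ))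
    (fun τ hτ => (hd τ (hsub (Ioo_subset_Icc_self hτ))).differentiableAt (hnhds τ hτ)) hK
    (fun τ hτ => ?_) hsmall
  rw [← derivWithin_of_mem_nhds (hnhds τ hτ)]
  exact (abs_le.1 (hΛK τ (hsub (Ioo_subset_Icc_self hτ)))).1

end Mesh

section StepNumber

theorem rpow_mul_rpow_pow_two_mul {x y : ℝ} (hx : 0 ≤ x) (hy : 0 ≤ y) {M : ℕ} (hM : 0 < M) :
    (x ^ (1 + 1 / (2 * (M : ℝ))) * y ^ (1 / (2 * (M : ℝ)))) ^ (2 * M) = x ^ (2 * M + 1) * y := by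
  have hexp : 1 / (2 * (M : ℝ)) * ((2 * M : ℕ) : ℝ) = 1 := by push_cast; field_simp
  rw [mul_pow, ← Real.rpow_mul_natCast hx, ← Real.rpow_mul_natCast hy, add_mul, one_mul, hexp,
    Real.rpow_one, ← Nat.cast_succ, Real.rpow_natCast]

theorem exists_nat_le_max_one_le_mul {X : ℝ} (hX : 0 ≤ X) :
    ∃ (r : ℕ) (c : ℝ), (r : ℝ) ≤ max 1 X ∧ X ≤ c * r ∧ (r = 1 ∧ c = 2 ∨ 2 ≤ r ∧ c = 3 / 2) := by
  rcases lt_or_ge X 2 with h | h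
  · exact ⟨1, 2, by simp, by simpa using h.le, Or.inl ⟨rfl, rfl⟩⟩
  · have htwo : 2 ≤ ⌊X⌋₊ := Nat.le_floor h
    have htwo' : (2 : ℝ) ≤ ⌊X⌋₊ := by exact_mod_cast htwo
    refine ⟨⌊X⌋₊, 3 / 2, (Nat.floor_le hX).trans (le_max_right _ _), ?_, Or.inr ⟨htwo, rfl⟩⟩
    linarith [Nat.lt_floor_add_one X]

variable {M r : ℕ} {A c ε θ : ℝ}

theorem exists_stepNumber {x : ℝ} (hx : 0 ≤ x) (hM : 0 < M) (hA : 0 ≤ A) (hε : 0 < ε) :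
    ∃ (r : ℕ) (c : ℝ),
      (r : ℝ) ≤ max 1 ((41 * x) ^ (1 + 1 / (2 * (M : ℝ))) *
        (0.32 * A / ε) ^ (1 / (2 * (M : ℝ)))) ∧
      r * (41 * (x / r)) ^ (2 * M + 1) * (0.32 * A) ≤ c ^ (2 * M) * ε ∧
      (r = 1 ∧ c = 2 ∨ 2 ≤ r ∧ 0 < x ∧ c = 3 / 2) := by
  obtain ⟨r, c, hrX, hXc, hrc⟩ := exists_nat_le_max_one_le_mul
    (X := (41 * x) ^ (1 + 1 / (2 * (M : ℝ))) * (0.32 * A / ε) ^ (1 / (2 * (M : ℝ))))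
    (by positivity)
  have hxpos (htwo : 2 ≤ r) : 0 < x := by
    refine hx.lt_of_ne fun h0 => ?_
    rw [← h0, mul_zero, Real.zero_rpow (by positivity), zero_mul, max_eq_left zero_le_one] at hrX
    exact absurd hrX (not_le.2 (by exact_mod_cast htwo))
  refine ⟨r, c, hrX, ?_, hrc.imp_right fun ⟨htwo, hc⟩ => ⟨htwo, hxpos htwo, hc⟩⟩
  have hr : (0 : ℝ) < r := by exact_mod_cast (show 0 < r by omega)
  have hpow := pow_le_pow_left₀ (by positivity) hXc (2 * M)
  rw [rpow_mul_rpow_pow_two_mul (by positivity) (by positivity) hM, ← mul_div_assoc,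
    div_le_iff₀ hε] at hpow
  refine le_of_mul_le_mul_right ?_ (pow_pos hr (2 * M))
  calc r * (41 * (x / r)) ^ (2 * M + 1) * (0.32 * A) * (r : ℝ) ^ (2 * M)
      = (r * (41 * (x / r))) ^ (2 * M + 1) * (0.32 * A) := by rw [mul_pow _ _ (2 * M + 1)]; ring
    _ = (41 * x) ^ (2 * M + 1) * (0.32 * A) := by
        rw [mul_left_comm (r : ℝ), mul_div_cancel₀ x hr.ne']
    _ ≤ _ := hpow
    _ = _ := by ring

theorem stepSize_le_of_mul_pow_le (hr : 1 ≤ r) (hθ : 0 ≤ θ) (hM : 0 < M) (hA : 1 ≤ A)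
    (hεA : ε < 1 + A) (hc : 0 ≤ c) (hc2 : c ≤ 2)
    (h : r * (41 * θ) ^ (2 * M + 1) * (0.32 * A) ≤ c ^ (2 * M) * ε) : θ ≤ 5 / 41 := by
  have hr' : (1 : ℝ) ≤ r := by exact_mod_cast hr
  have hscaled : (41 * θ) ^ (2 * M + 1) * (0.32 * A) ≤ 2 ^ (2 * M) * 2.5 ^ 2 * (0.32 * A) := by
    calc (41 * θ) ^ (2 * M + 1) * (0.32 * A) ≤ r * (41 * θ) ^ (2 * M + 1) * (0.32 * A) := by
          gcongr; exact le_mul_of_one_le_left (by positivity) hr'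
      _ ≤ c ^ (2 * M) * ε := h
      _ ≤ c ^ (2 * M) * (2 * A) := by gcongr; linarith
      _ ≤ 2 ^ (2 * M) * (2 * A) := by gcongr
      _ = _ := by ring
  have hpow : (41 * θ) ^ (2 * M + 1) ≤ 5 ^ (2 * M + 1) := by
    calc (41 * θ) ^ (2 * M + 1) ≤ 2 ^ (2 * M) * 2.5 ^ 2 :=
          le_of_mul_le_mul_right hscaled (by positivity)
      _ ≤ 2 ^ (2 * M) * 2.5 ^ (2 * M) := by gcongr; exacts [by norm_num, by omega]
      _ = 5 ^ (2 * M) := by rw [← mul_pow]; norm_num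
      _ ≤ 5 ^ (2 * M + 1) := pow_le_pow_right₀ (by norm_num) (by omega)
  linarith [le_of_pow_le_pow_left₀ (by omega) (by norm_num) hpow]

theorem mul_l1Norm_error_le (hε : 0 ≤ ε)
    (h : r * (41 * θ) ^ (2 * M + 1) * (0.32 * A) ≤ c ^ (2 * M) * ε) :
    r * (3.31 * A * (2 * θ) ^ (2 * M + 1)) ≤ 0.505 * (2 / 41 * c) ^ (2 * M) * ε := by
  have heven : 0 ≤ c ^ (2 * M) := (even_two_mul M).pow_nonneg c
  calc r * (3.31 * A * (2 * θ) ^ (2 * M + 1))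
      = 3.31 / 0.32 * (2 / 41) ^ (2 * M + 1) * (r * (41 * θ) ^ (2 * M + 1) * (0.32 * A)) := by
        rw [show 2 * θ = 2 / 41 * (41 * θ) by ring, mul_pow]; ring
    _ ≤ 3.31 / 0.32 * (2 / 41) ^ (2 * M + 1) * (c ^ (2 * M) * ε) := by gcongr
    _ = 3.31 / 0.32 * (2 / 41) * ((2 / 41) ^ (2 * M) * c ^ (2 * M) * ε) := by ring
    _ ≤ 0.505 * ((2 / 41) ^ (2 * M) * c ^ (2 * M) * ε) := by gcongr; norm_num
    _ = 0.505 * (2 / 41 * c) ^ (2 * M) * ε := by rw [mul_pow]; ring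

theorem one_add_pow_le_exp_mul {δ : ℝ} (hδ : 0 ≤ δ) (r : ℕ) :
    (1 + δ) ^ r ≤ Real.exp (r * δ) := by
  rw [Real.exp_nat_mul, add_comm]
  exact pow_le_pow_left₀ (by positivity) (Real.add_one_le_exp δ) r

theorem one_add_pow_sub_one_le {δ : ℝ} (hδ : 0 ≤ δ) (hrδ : r * δ ≤ 1) :
    (1 + δ) ^ r - 1 ≤ 2 * (r * δ) := by
  have hrδ0 : 0 ≤ r * δ := by positivity
  have hexp := (abs_le.1 (Real.abs_exp_sub_one_sub_id_le ((abs_of_nonneg hrδ0).trans_le hrδ))).2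
  nlinarith [one_add_pow_le_exp_mul hδ r]

theorem single_l1Norm_error_le (hε : 0 ≤ ε)
    (h : (41 * θ) ^ (2 * M + 1) * (0.32 * A) ≤ 2 ^ (2 * M) * ε) :
    3.31 * A * (2 * θ) ^ (2 * M + 1) ≤ ε := by
  have hbound := mul_l1Norm_error_le (r := 1) hε (by rwa [Nat.cast_one, one_mul])
  have hpow : (2 / 41 * 2 : ℝ) ^ (2 * M) ≤ 1 := pow_le_one₀ (by norm_num) (by norm_num)
  rw [Nat.cast_one, one_mul] at hbound
  nlinarith

theorem one_add_l1Norm_error_pow_sub_one_le (hθ : 0 ≤ θ) (hM : 0 < M) (hA : 0 ≤ A) (hε : 0 ≤ ε)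
    (h : r * (41 * θ) ^ (2 * M + 1) * (0.32 * A) ≤ (3 / 2) ^ (2 * M) * ε)
    (hsmall : 0.505 * ε ≤ (41 / 3) ^ (2 * M)) :
    (1 + 3.31 * A * (2 * θ) ^ (2 * M + 1)) ^ r - 1 ≤ ε := by
  have hbound := mul_l1Norm_error_le hε h
  rw [show (2 / 41 * (3 / 2) : ℝ) = 3 / 41 by norm_num] at hbound
  have hpow : (3 / 41 : ℝ) ^ (2 * M) ≤ 3 / 41 :=
    pow_le_of_le_one (by norm_num) (by norm_num) (by omega)
  have hone : r * (3.31 * A * (2 * θ) ^ (2 * M + 1)) ≤ 1 := by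
    calc r * (3.31 * A * (2 * θ) ^ (2 * M + 1)) ≤ (3 / 41) ^ (2 * M) * (0.505 * ε) := by
          linarith
      _ ≤ (3 / 41) ^ (2 * M) * (41 / 3) ^ (2 * M) := by gcongr
      _ = 1 := by rw [← mul_pow]; norm_num
  nlinarith [one_add_pow_sub_one_le (by positivity) hone]

section LargeTolerance

variable (hM : 2 ≤ M) (hεA : ε < 1 + A) (hlarge : (41 / 3) ^ (2 * M) < 0.505 * ε)
  (h : r * (41 * θ) ^ (2 * M + 1) * (0.32 * A) ≤ (3 / 2) ^ (2 * M) * ε)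

include hM hεA hlarge h

theorem mul_pow_le_of_large_tolerance : r * (41 * θ) ^ (2 * M + 1) ≤ 3.13 * (3 / 2) ^ (2 * M) := by
  have hpow : (41 / 3 : ℝ) ^ 4 ≤ (41 / 3) ^ (2 * M) :=
    pow_le_pow_right₀ (by norm_num) (by omega)
  have : 10000 ≤ A := by linarith
  refine le_of_mul_le_mul_right (h.trans ?_) (show 0 < 0.32 * A by linarith)
  calc (3 / 2) ^ (2 * M) * ε ≤ (3 / 2) ^ (2 * M) * (3.13 * (0.32 * A)) := by
        gcongr; linarith
    _ = 3.13 * (3 / 2) ^ (2 * M) * (0.32 * A) := by ring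

theorem le_of_large_tolerance (hr : 2 ≤ r) (hθ : 0 ≤ θ) : θ ≤ 1.6 / 41 := by
  have hr' : (2 : ℝ) ≤ r := by exact_mod_cast hr
  have hbound := mul_pow_le_of_large_tolerance hM hεA hlarge h
  have hpow : (41 * θ) ^ (2 * M + 1) ≤ 1.6 ^ (2 * M + 1) := by
    calc (41 * θ) ^ (2 * M + 1) ≤ r / 2 * (41 * θ) ^ (2 * M + 1) :=
          le_mul_of_one_le_left (by positivity) (by linarith)
      _ ≤ 1.6 * (3 / 2) ^ (2 * M) := by
          linarith [show (0 : ℝ) < (3 / 2) ^ (2 * M) by positivity]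
      _ ≤ 1.6 * 1.6 ^ (2 * M) := by gcongr; norm_num
      _ = 1.6 ^ (2 * M + 1) := (pow_succ' _ _).symm
  linarith [le_of_pow_le_pow_left₀ (by omega) (by norm_num) hpow]

theorem mul_pow_error_le_of_large_tolerance :
    r * (21 * M * 5 ^ M * (8.5 * θ) ^ (2 * M + 1)) ≤ M * 4 := by
  have hratio : (5 * (8.5 / 41 * (3 / 2)) ^ 2 : ℝ) ^ M ≤ (5 * (8.5 / 41 * (3 / 2)) ^ 2) ^ 2 :=
    pow_le_pow_of_le_one (by norm_num) (by norm_num) hM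
  calc r * (21 * M * 5 ^ M * (8.5 * θ) ^ (2 * M + 1))
      = 21 * M * 5 ^ M * (8.5 / 41) ^ (2 * M + 1) * (r * (41 * θ) ^ (2 * M + 1)) := by
        rw [show 8.5 * θ = 8.5 / 41 * (41 * θ) by ring, mul_pow]; ring
    _ ≤ 21 * M * 5 ^ M * (8.5 / 41) ^ (2 * M + 1) * (3.13 * (3 / 2) ^ (2 * M)) :=
        mul_le_mul_of_nonneg_left (mul_pow_le_of_large_tolerance hM hεA hlarge h) (by positivity)
    _ = M * (21 * 3.13 * (8.5 / 41) * (5 * (8.5 / 41 * (3 / 2)) ^ 2) ^ M) := by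
        rw [mul_pow 5, ← pow_mul, mul_pow (8.5 / 41)]; ring
    _ ≤ M * (21 * 3.13 * (8.5 / 41) * (5 * (8.5 / 41 * (3 / 2)) ^ 2) ^ 2) := by gcongr
    _ ≤ M * 4 := by gcongr; norm_num

theorem one_add_pow_error_pow_sub_one_le (hθ : 0 ≤ θ) :
    (1 + 21 * M * 5 ^ M * (8.5 * θ) ^ (2 * M + 1)) ^ r - 1 ≤ ε := by
  have hexp : Real.exp 4 ≤ (41 / 3) ^ 2 := by
    calc Real.exp 4 = Real.exp 1 ^ 4 := by rw [← Real.exp_nat_mul]; norm_num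
      _ ≤ 3 ^ 4 := by gcongr; exact Real.exp_one_lt_three.le
      _ ≤ (41 / 3) ^ 2 := by norm_num
  have hpow : (1 + 21 * M * 5 ^ M * (8.5 * θ) ^ (2 * M + 1)) ^ r ≤ (41 / 3) ^ (2 * M) := by
    calc (1 + 21 * M * 5 ^ M * (8.5 * θ) ^ (2 * M + 1)) ^ r
        ≤ Real.exp (r * (21 * M * 5 ^ M * (8.5 * θ) ^ (2 * M + 1))) :=
          one_add_pow_le_exp_mul (by positivity) r
      _ ≤ Real.exp (M * 4) :=
          Real.exp_le_exp.2 (mul_pow_error_le_of_large_tolerance hM hεA hlarge h)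
      _ = Real.exp 4 ^ M := Real.exp_nat_mul _ _
      _ ≤ ((41 / 3) ^ 2) ^ M := by gcongr
      _ = (41 / 3) ^ (2 * M) := (pow_mul _ _ _).symm
  linarith [show (0 : ℝ) < (41 / 3) ^ (2 * M) by positivity]

end LargeTolerance

end StepNumber

section Assembly

variable {d : ℕ} {H : ℝ → CMat d} {Λ : ℝ → ℝ} {t₀ t : ℝ}

theorem timeAverage_mul_sub (ht : t₀ < t) (Λ : ℝ → ℝ) :
    timeAverage Λ t₀ t * (t - t₀) = ∫ τ in t₀..t, Λ τ := by
  have : t - t₀ ≠ 0 := (sub_pos.2 ht).ne'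
  rw [timeAverage]
  field_simp

theorem timeAverage_mul_sub_eq_integral_abs (ht : t₀ < t) (h0 : ∀ τ ∈ Icc t₀ t, 0 ≤ Λ τ) :
    timeAverage Λ t₀ t * (t - t₀) = ∫ τ in t₀..t, |Λ τ| := by
  refine (timeAverage_mul_sub ht Λ).trans (intervalIntegral.integral_congr fun τ hτ => ?_)
  rw [uIcc_of_le ht.le] at hτ
  exact (abs_of_nonneg (h0 τ hτ)).symm

theorem norm_propagator_sub_multiproductFormula_le (ht : t₀ ≤ t)
    (hH : ∀ τ ∈ Icc t₀ t, (H τ).IsHermitian) (hc : ContinuousOn H (Icc t₀ t))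
    {M : ℕ} (a : Fin M → ℝ) (k : Fin M → ℕ) :
    ‖propagator H t₀ t - multiproductFormula H a k t t₀‖ ≤ 1 + l1Norm a :=
  norm_sub_le_of_le (norm_propagator_le_one ht hH hc) (norm_multiproductFormula_le ht hH a k)

theorem norm_propagator_sub_timeOrderedProd_le {r : ℕ} {mesh : Fin (r + 1) → ℝ}
    (hmono : Monotone mesh)
    (hH : ∀ τ ∈ Icc (mesh 0) (mesh (Fin.last r)), (H τ).IsHermitian)
    (hc : ContinuousOn H (Icc (mesh 0) (mesh (Fin.last r)))) {G : Fin r → CMat d} {δ : ℝ}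
    (hG : ∀ i, ‖G i - propagator H (mesh i.castSucc) (mesh i.succ)‖ ≤ δ) :
    ‖propagator H (mesh 0) (mesh (Fin.last r)) - timeOrderedProd G‖ ≤ (1 + δ) ^ r - 1 := by
  rw [propagator_eq_timeOrderedProd hmono hH hc]
  refine norm_timeOrderedProd_sub_le (fun i => ?_) hG
  have hsub := Icc_subset_Icc (hmono (Fin.zero_le i.castSucc)) (hmono (Fin.le_last i.succ))
  exact norm_propagator_le_one (hmono Fin.castSucc_lt_succ.le) (fun τ hτ => hH τ (hsub hτ))
    (hc.mono hsub)

variable {M : ℕ} {a : Fin M → ℝ} {k : Fin M → ℕ}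

theorem l1Norm_eq_one_of_isMultiproductCoeff {a : Fin 1 → ℝ} {k : Fin 1 → ℕ}
    (hak : IsMultiproductCoeff a k) : l1Norm a = 1 := by
  have ha : a 0 = 1 := by simpa using hak.2 0
  simp [l1Norm, ha]

theorem IsMultiproductCoeff.two_le_of_large_tolerance (hak : IsMultiproductCoeff a k)
    (hM : 0 < M) {ε : ℝ} (hεA : ε < 1 + l1Norm a) (hlarge : (41 / 3) ^ (2 * M) < 0.505 * ε) :
    2 ≤ M := by
  by_contra hlt
  obtain rfl : M = 1 := by omega
  rw [l1Norm_eq_one_of_isMultiproductCoeff hak] at hεA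
  norm_num at hlarge
  linarith

theorem IsLambdaBound.exists_step_error_le (hΛ : IsLambdaBound H Λ t₀ t)
    (hSmooth : ContDiffOn ℝ ∞ H (Icc t₀ t)) (hM : 0 < M) (hak : IsMultiproductCoeff a k)
    {r : ℕ} {c θ ε : ℝ} (hε : 0 ≤ ε) (hεA : ε < 1 + l1Norm a) (hθ : 0 ≤ θ)
    (h : r * (41 * θ) ^ (2 * M + 1) * (0.32 * l1Norm a) ≤ c ^ (2 * M) * ε)
    (hrc : r = 1 ∧ c = 2 ∨ 2 ≤ r ∧ c = 3 / 2) :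
    θ ≤ 5 / 41 ∧ ∃ δ, (1 + δ) ^ r - 1 ≤ ε ∧ ∀ s s', t₀ ≤ s → s < s' → s' ≤ t → Λ s * (s' - s) ≤ θ →
      ‖multiproductFormula H a k s' s - propagator H s s'‖ ≤ δ := by
  have hA := hak.one_le_l1Norm hM
  have hθ5 : θ ≤ 5 / 41 := by
    refine stepSize_le_of_mul_pow_le ?_ hθ hM hA hεA ?_ ?_ h <;>
      rcases hrc with ⟨rfl, rfl⟩ | ⟨hr, rfl⟩ <;> first | omega | norm_num
  refine ⟨hθ5, ?_⟩
  by_cases hcase : 2 ≤ r ∧ (41 / 3) ^ (2 * M) < 0.505 * ε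
  · obtain ⟨hr, hlarge⟩ := hcase
    obtain rfl : c = 3 / 2 := (hrc.resolve_left (by omega)).2
    have hM2 := hak.two_le_of_large_tolerance hM hεA hlarge
    refine ⟨_, one_add_pow_error_pow_sub_one_le hM2 hεA hlarge h hθ,
      fun s s' hs0 hs hst hle => ?_⟩
    exact (hΛ.mono hSmooth hs0 hs hst).norm_multiproductFormula_sub_le_pow_mul
      (hSmooth.mono (Icc_subset_Icc hs0 hst)) hs.le hM hak hle
      (le_of_large_tolerance hM2 hεA hlarge h hr hθ)
  · refine ⟨3.31 * l1Norm a * (2 * θ) ^ (2 * M + 1), ?_, fun s s' hs0 hs hst hle => ?_⟩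
    · rcases hrc with ⟨rfl, rfl⟩ | ⟨hr, rfl⟩
      · rw [pow_one, add_sub_cancel_left]
        exact single_l1Norm_error_le hε (by rwa [Nat.cast_one, one_mul] at h)
      · exact one_add_l1Norm_error_pow_sub_one_le hθ hM (zero_le_one.trans hA) hε h
          (not_lt.1 fun hlarge => hcase ⟨hr, hlarge⟩)
    · exact (hΛ.mono hSmooth hs0 hs hst).norm_multiproductFormula_sub_le_l1Norm_mul
        (hSmooth.mono (Icc_subset_Icc hs0 hst)) hs.le hM hak hle hθ5

end Assembly

end

theorem mainTheorem6 {d : ℕ} (H : ℝ → CMat d) (t₀ t : ℝ) (ht : t₀ < t)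
    (hHerm : ∀ τ ∈ Icc t₀ t, (H τ).IsHermitian)
    (hSmooth : ContDiffOn ℝ ∞ H (Icc t₀ t))
    (Λ : ℝ → ℝ) (hΛ : IsLambdaBound H Λ t₀ t)
    (hΛdiff : DifferentiableOn ℝ Λ (Icc t₀ t))
    (K : ℝ) (hK : 0 ≤ K)
    (hΛK : ∀ τ ∈ Icc t₀ t, |derivWithin Λ (Icc t₀ t) τ| ≤ K * Λ τ ^ 2)
    (M : ℕ) (hM : 1 ≤ M) (a : Fin M → ℝ) (k : Fin M → ℕ) (hak : IsMultiproductCoeff a k)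
    (ε : ℝ) (hε : 0 < ε) :
    (∃ (r : ℕ) (mesh : Fin (r + 1) → ℝ),
      StrictMono mesh ∧ mesh 0 = t₀ ∧ mesh (Fin.last r) = t ∧
      ‖propagator H t₀ t -
          timeOrderedProd fun i : Fin r =>
            multiproductFormula H a k (mesh i.succ) (mesh i.castSucc)‖ ≤ ε ∧
      (r : ℝ) ≤ max 1
        ((41 * (1 + 3 / 2 * K) * timeAverage Λ t₀ t * (t - t₀)) ^ (1 + 1 / (2 * (M : ℝ))) *
          (0.32 * l1Norm a / ε) ^ (1 / (2 * (M : ℝ))))) ∧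
    timeAverage Λ t₀ t * (t - t₀) = ∫ τ in t₀..t, |Λ τ| := by
  have hnonneg : ∀ τ ∈ Icc t₀ t, 0 ≤ Λ τ := fun τ hτ => hΛ.nonneg hτ
  have hL : 0 ≤ ∫ τ in t₀..t, Λ τ := intervalIntegral.integral_nonneg ht.le hnonneg
  have hA : 0 ≤ l1Norm a := zero_le_one.trans (hak.one_le_l1Norm hM)
  refine ⟨?_, timeAverage_mul_sub_eq_integral_abs ht hnonneg⟩
  rw [mul_assoc (41 * _), timeAverage_mul_sub ht, mul_assoc 41]
  rcases le_or_gt (1 + l1Norm a) ε with hεA | hεA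
  · refine ⟨1, ![t₀, t], by simpa [Fin.strictMono_iff_lt_succ] using ht, rfl, rfl, ?_, by simp⟩
    simpa [timeOrderedProd] using
      (norm_propagator_sub_multiproductFormula_le ht.le hHerm hSmooth.continuousOn a k).trans hεA
  · obtain ⟨r, c, hrX, hpow, hrc⟩ := exists_stepNumber
      (x := (1 + 3 / 2 * K) * ∫ τ in t₀..t, Λ τ) (by positivity) hM hA hε
    have : NeZero r := ⟨by omega⟩
    obtain ⟨hθ, δ, hδε, hδ⟩ := hΛ.exists_step_error_le hSmooth hM hak hε.le hεA
      (by positivity) hpow (by tauto)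
    rw [mul_div_assoc] at hθ hδ
    obtain ⟨mesh, hmono, rfl, rfl, hmesh⟩ := exists_mesh_mul_sub_le ht hΛ.1 hnonneg hΛdiff hK hΛK
      (r := r) (hrc.imp And.left fun h => pos_of_mul_pos_right h.2.1 (by positivity)) (by linarith)
    exact ⟨r, mesh, hmono, rfl, rfl, (norm_propagator_sub_timeOrderedProd_le hmono.monotone hHerm
      hSmooth.continuousOn fun i => hδ _ _ (hmono.monotone (Fin.zero_le _))
        (hmono Fin.castSucc_lt_succ) (hmono.monotone (Fin.le_last _)) (hmesh i)).trans hδε, hrX⟩
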